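/- Let $M$ be a smooth ($C^\infty$, Hausdorff, second countable) manifold of dimension $n$, let $T_2=g_{jk}\,dx^j dx^k$ be a pseudo-Riemannian metric on $M$ (a smooth nondegenerate symmetric 2-covariant tensor field of arbitrary signature), let $\nabla$ be its Levi-Civita connection, with Christoffel symbols $\Gamma^\ell_{jk}$, and let $\hbar>0$. Let $\mathcal A=C^\infty(M,\mathbb C)$ and let $P\colon\mathcal A\to\mathcal A$ be a linear differential operator: a $\mathbb C$-linear map such that, for some $r\ge 0$ and for every $x\in M$, $P$ maps $\mathfrak m_x^{r+1}$ into $\mathfrak m_x$, where $\mathfrak m_x\subset\mathcal A$ is the ideal of the functions vanishing at $x$. Quantization assigns to a smooth symmetric contravariant tensor field $\Phi=\Phi_N+\dots+\Phi_0$ on $M$ with complex coefficients ($\Phi_r$ homogeneous of order $r$) the operator $$\widehat\Phi(f)=\sum_r(-i\hbar)^r\langle\Phi_r,\nabla^r_{\mathrm{sym}}f\rangle ,\qquad f\in\mathcal A,$$ where $\nabla^r_{\mathrm{sym}}f$ is the symmetrization of the $r$-th iterated covariant differential of $f$. The dequantized of $P$ is the tensor field $\Phi$ with $\widehat\Phi=P$;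 the Hamiltonian of $P$ is the function $F(x,p)=\sum_r\Phi_r(x)(p,\dots,p)$ on $T^*M$; and the infinitesimal canonical transformation associated with $P$ is the field $D_P$ of (complex) tangent vectors on $T^*M$ determined by $D_P\lrcorner\,\omega_2+dF=0$, where $\omega_2=d\theta$ and $\theta$ is the Liouville form of $T^*M$. A field $D$ on $T^*M$ is called a second order differential equation if, for every $x\in M$ and $v\in T_xM$, the value of $D$ at the covector $T_2(v,\cdot)\in T^*_xM$ is mapped to $v$ by the differential of the projection $T^*M\to M$. Then $D_P$ is a second order differential equation if and only if there is a function $U\in\mathcal A$ such that $$P=-\frac{\hbar^2}{2}\Delta+U,$$ where $\Delta f=g^{jk}\left(\frac{\partial^2 f}{\partial x^k\partial x^j}-\Gamma^\ell_{jk}\frac{\partial f}{\partial x^\ell}\right)$ is the Laplacian of the metric. -/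

import Mathlib

open scoped Manifold ContDiff Topology TensorProduct

noncomputable section

namespace Dequantization

/-- `ℂ`, as a real manifold, is a smooth ring; so smooth complex-valued functions form a ring. -/
instance contMDiffRingComplex : ContMDiffRing 𝓘(ℝ, ℂ) ∞ ℂ where
  contMDiff_add := contMDiff_add 𝓘(ℝ, ℂ) ∞
  contMDiff_mul := (contDiff_mul (𝕜 := ℝ) (𝔸 := ℂ)).comp_contMDiff
    (contMDiff_fst.prodMk_space contMDiff_snd)

/-! ### Functions and linear differential operators -/

/-- The ring of complex-valued smooth functions on `M`. -/
abbrev SmoothFun (n : ℕ) (M : Type*) [TopologicalSpace M]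
    [ChartedSpace (EuclideanSpace ℝ (Fin n)) M] : Type _ :=
  C^∞⟮𝓡 n, M; 𝓘(ℝ, ℂ), ℂ⟯

section

variable {n : ℕ} {M : Type*} [TopologicalSpace M] [ChartedSpace (EuclideanSpace ℝ (Fin n)) M]

/-- The constant function with value `c`. -/
def constFun (c : ℂ) : SmoothFun n M := ⟨fun _ => c, contMDiff_const⟩

/-- The ideal `𝔪ₓ` of the smooth functions vanishing at `x`. -/
def vanishingIdeal (x : M) : Ideal (SmoothFun n M) where
  carrier := {f | f x = 0}
  add_mem' := by
    intro a b ha hb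
    simp only [Set.mem_ofPred_eq] at ha hb ⊢
    simp [ha, hb]
  zero_mem' := by simp
  smul_mem' := by
    intro c f hf
    simp only [Set.mem_ofPred_eq] at hf ⊢
    simp [hf]

/-- `P` is a linear differential operator of order at most `r`: it is `ℂ`-linear and maps
`𝔪ₓ ^ (r + 1)` into `𝔪ₓ` for every point `x`. -/
structure IsDiffOpOfOrder (r : ℕ) (P : SmoothFun n M → SmoothFun n M) : Prop where
  map_add : ∀ f h, P (f + h) = P f + P h
  map_const_mul : ∀ (c : ℂ) f, P ((constFun c : SmoothFun n M) * f) = (constFun c : SmoothFun n M) * P f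
  map_pow : ∀ (x : M), ∀ f ∈ vanishingIdeal x ^ (r + 1), P f ∈ vanishingIdeal x

/-- `P` is a linear differential operator (of some finite order). -/
def IsLinearDiffOp (P : SmoothFun n M → SmoothFun n M) : Prop :=
  ∃ r, IsDiffOpOfOrder r P

end

/-! ### Local coordinates -/

section

variable {n : ℕ} {M : Type*} [TopologicalSpace M] [ChartedSpace (EuclideanSpace ℝ (Fin n)) M]

/-- Partial derivative `∂h/∂xʲ` at `y` of a function on coordinate space. -/
def partialDeriv {F : Type*} [NormedAddCommGroup F] [NormedSpace ℝ F] (j : Fin n)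
    (h : EuclideanSpace ℝ (Fin n) → F) (y : EuclideanSpace ℝ (Fin n)) : F :=
  fderiv ℝ h y (EuclideanSpace.single j 1)

/-- The coordinate vector `∂/∂xʲ`, for the coordinates of the chart at `x₀`, at the point with
coordinates `y`. -/
def coordVector (x₀ : M) (j : Fin n) (y : EuclideanSpace ℝ (Fin n)) :
    TangentSpace (𝓡 n) ((extChartAt (𝓡 n) x₀).symm y) :=
  mfderiv 𝓘(ℝ, EuclideanSpace ℝ (Fin n)) (𝓡 n) (extChartAt (𝓡 n) x₀).symm y
    (EuclideanSpace.single j (1 : ℝ) : EuclideanSpace ℝ (Fin n))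

/-- The coordinate covector `dxʲ`, for the coordinates of the chart at `x₀`, at the point `x`. -/
def coordCovector (x₀ : M) (j : Fin n) (x : M) : TangentSpace (𝓡 n) x →L[ℝ] ℝ :=
  (EuclideanSpace.proj j : EuclideanSpace ℝ (Fin n) →L[ℝ] ℝ).comp
    (mfderiv (𝓡 n) 𝓘(ℝ, EuclideanSpace ℝ (Fin n)) (extChartAt (𝓡 n) x₀) x)

end

/-! ### Metric, Christoffel symbols, iterated covariant differentials, Laplacian -/

/-- A pseudo-Riemannian metric: a smooth field of nondegenerate symmetric bilinear forms, of
arbitrary signature, on the tangent spaces. -/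
structure PseudoRiemannianMetric (n : ℕ) (M : Type*) [TopologicalSpace M]
    [ChartedSpace (EuclideanSpace ℝ (Fin n)) M] [IsManifold (𝓡 n) ∞ M] where
  val : ∀ x : M, TangentSpace (𝓡 n) x →L[ℝ] TangentSpace (𝓡 n) x →L[ℝ] ℝ
  symm : ∀ x v w, val x v w = val x w v
  nondegenerate : ∀ x v, (∀ w, val x v w = 0) → v = 0
  contMDiff : ContMDiff (𝓡 n)
    ((𝓡 n).prod 𝓘(ℝ, EuclideanSpace ℝ (Fin n) →L[ℝ] EuclideanSpace ℝ (Fin n) →L[ℝ] ℝ)) ∞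
    (fun x => Bundle.TotalSpace.mk'
      (EuclideanSpace ℝ (Fin n) →L[ℝ] EuclideanSpace ℝ (Fin n) →L[ℝ] ℝ)
      (E := fun x : M => TangentSpace (𝓡 n) x →L[ℝ] TangentSpace (𝓡 n) x →L[ℝ] ℝ) x (val x))

section

variable {n : ℕ} {M : Type*} [TopologicalSpace M] [ChartedSpace (EuclideanSpace ℝ (Fin n)) M]
  [IsManifold (𝓡 n) ∞ M]

/-- The matrix `g_{ij}` of the metric in the chart at `x₀`, at the point with coordinates `y`.
Its inverse matrix is `g^{ij}`. -/
def metricMatrix (g : PseudoRiemannianMetric n M) (x₀ : M) (y : EuclideanSpace ℝ (Fin n)) :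
    Matrix (Fin n) (Fin n) ℝ :=
  Matrix.of fun i j =>
    g.val ((extChartAt (𝓡 n) x₀).symm y) (coordVector x₀ i y) (coordVector x₀ j y)

/-- The Christoffel symbols `Γˡ_{jk}` of the Levi-Civita connection in the chart at `x₀`. -/
def christoffel (g : PseudoRiemannianMetric n M) (x₀ : M) (l j k : Fin n)
    (y : EuclideanSpace ℝ (Fin n)) : ℝ :=
  (1 / 2) * ∑ m, (metricMatrix g x₀ y)⁻¹ l m *
    (partialDeriv j (fun z => metricMatrix g x₀ z m k) y
      + partialDeriv k (fun z => metricMatrix g x₀ z m j) y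
      - partialDeriv m (fun z => metricMatrix g x₀ z j k) y)

/-- The components, in the chart at `x₀`, of the `r`-th iterated covariant differential `∇ʳf`
for the Levi-Civita connection: `∇⁰f = f` and
`(∇ʳ⁺¹f)_{j₀ j₁ … jᵣ} = ∂_{j₀} (∇ʳf)_{j₁ … jᵣ} - ∑ᵢ ∑ₗ Γˡ_{j₀ jᵢ} (∇ʳf)_{j₁ … l … jᵣ}`,
with `l` in the `i`-th place. -/
def covDiff (g : PseudoRiemannianMetric n M) (f : SmoothFun n M) (x₀ : M) :
    (r : ℕ) → (Fin r → Fin n) → EuclideanSpace ℝ (Fin n) → ℂ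
  | 0, _, y => f ((extChartAt (𝓡 n) x₀).symm y)
  | r + 1, J, y =>
      partialDeriv (J 0) (covDiff g f x₀ r (Fin.tail J)) y
        - ∑ i : Fin r, ∑ l : Fin n, (christoffel g x₀ l (J 0) (Fin.tail J i) y : ℂ) *
            covDiff g f x₀ r (Function.update (Fin.tail J) i l) y

/-- The components at `x` (in the chart at `x`) of the symmetrized tensor `∇ʳ_sym f`. -/
def symCovDiff (g : PseudoRiemannianMetric n M) (f : SmoothFun n M) (r : ℕ) (x : M)
    (J : Fin r → Fin n) : ℂ :=
  (r.factorial : ℂ)⁻¹ * ∑ σ : Equiv.Perm (Fin r),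
    covDiff g f x r (J ∘ σ) (extChartAt (𝓡 n) x x)

/-- The Laplacian of the metric:
`Δf = ∑ g^{jk} (∂²f/∂xᵏ∂xʲ - ∑ₗ Γˡ_{jk} ∂f/∂xˡ)`, at `x`, in the chart at `x`. -/
def laplacian (g : PseudoRiemannianMetric n M) (f : SmoothFun n M) (x : M) : ℂ :=
  let y := extChartAt (𝓡 n) x x
  let h : EuclideanSpace ℝ (Fin n) → ℂ := fun z => f ((extChartAt (𝓡 n) x).symm z)
  ∑ j, ∑ k, (((metricMatrix g x y)⁻¹ j k : ℝ) : ℂ) *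
    (partialDeriv k (partialDeriv j h) y
      - ∑ l, (christoffel g x l j k y : ℂ) * partialDeriv l h y)

end

/-! ### Symmetric contravariant tensor fields and quantization -/

/-- A smooth symmetric contravariant tensor field of order `r`, with complex coefficients: at each
point `x`, a symmetric multilinear form on the cotangent space, such that the components in local
coordinates are smooth. -/
structure SymTensorField (n : ℕ) (M : Type*) [TopologicalSpace M]
    [ChartedSpace (EuclideanSpace ℝ (Fin n)) M] (r : ℕ) where
  val : ∀ x : M, MultilinearMap ℝ (fun _ : Fin r => TangentSpace (𝓡 n) x →L[ℝ] ℝ) ℂ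
  symm : ∀ x (σ : Equiv.Perm (Fin r)) (α : Fin r → (TangentSpace (𝓡 n) x →L[ℝ] ℝ)),
    val x (fun k => α (σ k)) = val x α
  smooth : ∀ (x₀ : M) (J : Fin r → Fin n),
    ContMDiffOn (𝓡 n) 𝓘(ℝ, ℂ) ∞
      (fun x => val x (fun k => coordCovector x₀ (J k) x))
      (chartAt (EuclideanSpace ℝ (Fin n)) x₀).source

/-- A symmetric contravariant tensor field, not necessarily homogeneous: its homogeneous
components, all but finitely many of which vanish. -/
structure TensorField (n : ℕ) (M : Type*) [TopologicalSpace M]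
    [ChartedSpace (EuclideanSpace ℝ (Fin n)) M] where
  comp : ∀ r : ℕ, SymTensorField n M r
  finite : ∃ N, ∀ r, N < r → ∀ x, (comp r).val x = 0

/-- The cotangent bundle `T*M`. -/
abbrev CotangentBundle (n : ℕ) (M : Type*) [TopologicalSpace M]
    [ChartedSpace (EuclideanSpace ℝ (Fin n)) M] : Type _ :=
  Bundle.TotalSpace (EuclideanSpace ℝ (Fin n) →L[ℝ] ℝ)
    (fun x : M => TangentSpace (𝓡 n) x →L[ℝ] ℝ)

section

variable {n : ℕ} {M : Type*} [TopologicalSpace M] [ChartedSpace (EuclideanSpace ℝ (Fin n)) M]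

/-- The zero tensor field. -/
def zeroTensorField : TensorField n M where
  comp _ :=
    { val := fun _ => 0
      symm := fun _ _ _ => rfl
      smooth := fun _ _ => contMDiffOn_const }
  finite := ⟨0, fun _ _ _ => rfl⟩

/-- The function on fibres `p ↦ ∑ᵣ Φᵣ(p, …, p)` corresponding to the tensor field `Φ`, as a
function on the cotangent bundle. -/
def TensorField.toFun (Φ : TensorField n M)
    (q : CotangentBundle n M) : ℂ :=
  ∑ᶠ r : ℕ, (Φ.comp r).val q.proj (fun _ => q.snd)

variable [IsManifold (𝓡 n) ∞ M]

/-- The value `(-iħ)ʳ ⟨Φ, ∇ʳ_sym f⟩` at `x` of the quantized of a homogeneous tensor field,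
the contraction being written in the coordinates of the chart at `x`. -/
def SymTensorField.quantized (g : PseudoRiemannianMetric n M) (ħ : ℝ) {r : ℕ}
    (Φ : SymTensorField n M r) (f : SmoothFun n M) (x : M) : ℂ :=
  (-Complex.I * ħ) ^ r *
    ∑ J : Fin r → Fin n, Φ.val x (fun k => coordCovector x (J k) x) * symCovDiff g f r x J

/-- The value at `x` of the quantized of a tensor field: the sum over its homogeneous components. -/
def TensorField.quantized (g : PseudoRiemannianMetric n M) (ħ : ℝ)
    (Φ : TensorField n M) (f : SmoothFun n M) (x : M) : ℂ :=
  ∑ᶠ r : ℕ, (Φ.comp r).quantized g ħ f x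

open Classical in
/-- The dequantized of the operator `P`: the tensor field whose quantized is `P`. -/
def dequantized (g : PseudoRiemannianMetric n M) (ħ : ℝ) (P : SmoothFun n M → SmoothFun n M) :
    TensorField n M :=
  if h : ∃ Φ : TensorField n M, ∀ f x, P f x = Φ.quantized g ħ f x then h.choose
  else zeroTensorField

end

/-! ### The cotangent bundle, its symplectic form, Hamiltonian fields -/

/-- The exterior differential of a 1-form `η` on a manifold modelled on a normed space:
`dη(u, v) = ∂_u η(v) - ∂_v η(u)`, computed at `q` in the chart at `q`. -/
def extDerivOneForm {E H N : Type*} [NormedAddCommGroup E] [NormedSpace ℝ E] [TopologicalSpace H]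
    (I : ModelWithCorners ℝ E H) [TopologicalSpace N] [ChartedSpace H N]
    (η : ∀ q : N, TangentSpace I q →L[ℝ] ℝ) (q : N) :
    TangentSpace I q →ₗ[ℝ] TangentSpace I q →ₗ[ℝ] ℝ :=
  let φ := extChartAt I q
  let η' : E → (E →L[ℝ] ℝ) := fun z => (η (φ.symm z)).comp (mfderiv 𝓘(ℝ, E) I φ.symm z)
  let B : E →L[ℝ] E →L[ℝ] ℝ := fderiv ℝ η' (φ q)
  let A : TangentSpace I q →L[ℝ] E := mfderiv I 𝓘(ℝ, E) φ q
  LinearMap.mk₂ ℝ (fun u v => B (A u) (A v) - B (A v) (A u))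
    (fun u u' v => by simp only [map_add, add_apply]; ring)
    (fun c u v => by simp only [map_smul, smul_apply, smul_eq_mul]; ring)
    (fun u v v' => by simp only [map_add, add_apply]; ring)
    (fun c u v => by simp only [map_smul, smul_apply, smul_eq_mul]; ring)

/-- The model with corners (without boundary) of the cotangent bundle. -/
abbrev cotangentModel (n : ℕ) :=
  (𝓡 n).prod 𝓘(ℝ, EuclideanSpace ℝ (Fin n) →L[ℝ] ℝ)

section

variable {n : ℕ} {M : Type*} [TopologicalSpace M] [ChartedSpace (EuclideanSpace ℝ (Fin n)) M]
  [IsManifold (𝓡 n) ∞ M]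


/-- The differential at `q` of the projection `T*M → M`. -/
def projDeriv (q : CotangentBundle n M) :
    TangentSpace (cotangentModel n) q →L[ℝ] TangentSpace (𝓡 n) q.proj :=
  mfderiv (cotangentModel n) (𝓡 n) (fun q' : CotangentBundle n M => q'.proj) q

/-- The Liouville form `θ` on `T*M`: `θ_α = π^* α`. -/
def liouvilleForm (q : CotangentBundle n M) : TangentSpace (cotangentModel n) q →L[ℝ] ℝ :=
  q.snd.comp (projDeriv q)

/-- The canonical symplectic form `ω₂ = dθ` on `T*M`. -/
def symplecticForm (q : CotangentBundle n M) :
    TangentSpace (cotangentModel n) q →ₗ[ℝ] TangentSpace (cotangentModel n) q →ₗ[ℝ] ℝ :=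
  extDerivOneForm (cotangentModel n) (liouvilleForm (n := n) (M := M)) q

/-- The value on a real tangent vector `w` of the interior product `X ⌟ ω₂` of a complex tangent
vector `X` of `T*M` at `q` with the symplectic form (extended `ℂ`-linearly). -/
def contractSymplectic (q : CotangentBundle n M) (X : ℂ ⊗[ℝ] TangentSpace (cotangentModel n) q)
    (w : TangentSpace (cotangentModel n) q) : ℂ :=
  LinearMap.liftBaseChange ℂ
    (Complex.ofRealCLM.toLinearMap ∘ₗ (symplecticForm q).flip w) X

/-- The differential of a complex function on `T*M` at `q`. -/
def cotangentDiff (F : CotangentBundle n M → ℂ) (q : CotangentBundle n M) :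
    TangentSpace (cotangentModel n) q →L[ℝ] ℂ :=
  mfderiv (cotangentModel n) 𝓘(ℝ, ℂ) F q

open Classical in
/-- The Hamiltonian field of a complex function `F` on `T*M`: the field `D` of complex tangent
vectors with `D ⌟ ω₂ + dF = 0`. -/
def hamiltonianField (F : CotangentBundle n M → ℂ) (q : CotangentBundle n M) :
    ℂ ⊗[ℝ] TangentSpace (cotangentModel n) q :=
  if h : ∃ X : ℂ ⊗[ℝ] TangentSpace (cotangentModel n) q,
      ∀ w, contractSymplectic q X w + cotangentDiff F q w = 0 then h.choose
  else 0

/-- The Hamiltonian of the operator `P`: the function on `T*M` corresponding to the dequantized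
tensor of `P`. -/
def hamiltonianOf (g : PseudoRiemannianMetric n M) (ħ : ℝ) (P : SmoothFun n M → SmoothFun n M) :
    CotangentBundle n M → ℂ :=
  (dequantized g ħ P).toFun

/-- The infinitesimal canonical transformation `D_P` associated with the operator `P`. -/
def associatedField (g : PseudoRiemannianMetric n M) (ħ : ℝ)
    (P : SmoothFun n M → SmoothFun n M) (q : CotangentBundle n M) :
    ℂ ⊗[ℝ] TangentSpace (cotangentModel n) q :=
  hamiltonianField (hamiltonianOf g ħ P) q

/-- A field `D` on `T*M` is a second order differential equation: under the isomorphism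
`TM ≃ T*M`, `v ↦ g(v, ·)`, its value at each tangent vector `v` projects onto `v`. -/
def IsSecondOrderEquation (g : PseudoRiemannianMetric n M)
    (D : ∀ q : CotangentBundle n M, ℂ ⊗[ℝ] TangentSpace (cotangentModel n) q) : Prop :=
  ∀ (x : M) (v : TangentSpace (𝓡 n) x),
    (projDeriv (⟨x, g.val x v⟩ : CotangentBundle n M)).toLinearMap.baseChange ℂ
      (D ⟨x, g.val x v⟩) = (1 : ℂ) ⊗ₜ[ℝ] v

end

end Dequantization

end

/-!
In the canonical coordinates `(x, p)` of `T*M`, the Hamiltonian field of `F` projects to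
`∂F/∂p_j ∂/∂xʲ`, so `D_P` is a second order differential equation if and only if
`∂F/∂p_j = g^{jk} p_k`, that is, `F = ½ g^{jk} p_j p_k + U` with `U` a function of `x` alone. The
tensor field `½ g^{jk} + U` quantizes to `-ħ²/2 Δ + U`.

Quantization is injective: if `h x = 0`, then `h ^ r` detects the component of order `r` at `x`, all
components of order greater than `r` having been dealt with. It is surjective by induction on the
order of `P`: the quantized of the principal symbol of `P` differs from `P` by an operator of
smaller order. That quantized maps smooth functions to smooth functions because the iterated
covariant differentials transform as tensors under changes of coordinates.
-/

noncomputable section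

namespace Dequantization

/-! ### Multilinear and polynomial algebra -/

section

variable {ι R V W : Type*} [CommRing R] [AddCommGroup V] [Module R V]
  [AddCommGroup W] [Module R W]

theorem sum_perm_comp_eq_sum_neg_one_pow_card_smul [Fintype ι] [DecidableEq ι]
    (φ : MultilinearMap R (fun _ : ι => V) W) (v : ι → V) :
    ∑ σ : Equiv.Perm ι, φ (v ∘ σ) =
      ∑ s : Finset ι, (-1 : ℤ) ^ s.card • φ (fun _ => ∑ i ∈ sᶜ, v i) := by
  have expand (s : Finset ι) :
      φ (fun _ => ∑ i ∈ sᶜ, v i) =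
        ∑ J : ι → ι, if s ⊆ (Finset.univ.image J)ᶜ then φ (v ∘ J) else 0 := by
    rw [MultilinearMap.map_sum_finset, ← Finset.sum_filter]
    refine Finset.sum_congr (Finset.ext fun J => ?_) fun _ _ => rfl
    simp only [Fintype.mem_piFinset, Finset.mem_compl, Finset.mem_filter, Finset.mem_univ,
      true_and, Finset.subset_iff, Finset.mem_image, not_exists]
    exact ⟨fun h i hi k hk => h k (hk ▸ hi), fun h k hk => h hk k rfl⟩
  -- By inclusion-exclusion only the surjective index maps survive.
  have inclusion_exclusion (J : ι → ι) :
      ∑ s : Finset ι, (-1 : ℤ) ^ s.card •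
          (if s ⊆ (Finset.univ.image J)ᶜ then φ (v ∘ J) else 0) =
        if Function.Bijective J then φ (v ∘ J) else 0 := by
    have image_eq_univ_iff : Finset.univ.image J = Finset.univ ↔ Function.Bijective J := by
      rw [← Finite.surjective_iff_bijective, ← Set.range_eq_univ, ← Finset.coe_inj]
      simp
    simp only [smul_ite, smul_zero, ← Finset.mem_powerset, Finset.sum_ite_mem,
      Finset.univ_inter, ← Finset.sum_smul, Finset.sum_powerset_neg_one_pow_card,
      Finset.compl_eq_empty_iff, image_eq_univ_iff,
      ite_smul, one_smul, zero_smul]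
  simp only [expand, Finset.smul_sum]
  rw [Finset.sum_comm]
  simp only [inclusion_exclusion]
  rw [← Finset.sum_filter]
  exact Finset.sum_bij (fun σ _ => σ) (fun σ _ => by simp)
    (fun _ _ _ _ h => DFunLike.coe_injective h)
    (fun J hJ => ⟨Equiv.ofBijective J (Finset.mem_filter.1 hJ).2, Finset.mem_univ _, rfl⟩)
    fun _ _ => rfl

theorem multilinearMap_eq_zero_of_diagonal [Finite ι] [IsAddTorsionFree W]
    {φ : MultilinearMap R (fun _ : ι => V) W} (symm : ∀ (σ : Equiv.Perm ι) v, φ (v ∘ σ) = φ v)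
    (diagonal : ∀ v, φ (fun _ => v) = 0) : φ = 0 := by
  classical
  have := Fintype.ofFinite ι
  ext v
  have polarization := sum_perm_comp_eq_sum_neg_one_pow_card_smul φ v
  simp only [symm, diagonal, smul_zero, Finset.sum_const_zero, Finset.sum_const,
    Finset.card_univ] at polarization
  exact (nsmul_eq_zero_iff_right Fintype.card_ne_zero).1 polarization

end

theorem eq_zero_of_sum_pow_mul_eq_zero {R : Type*} [CommRing R] [IsDomain R] {s : Set R}
    (hs : s.Infinite) {N : ℕ} {a : ℕ → R}
    (h : ∀ t ∈ s, ∑ r ∈ Finset.range N, t ^ r * a r = 0) {r : ℕ} (hr : r < N) : a r = 0 := by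
  let p : Polynomial R := ∑ r ∈ Finset.range N, Polynomial.monomial r (a r)
  have hp : p = 0 := Polynomial.eq_zero_of_infinite_isRoot p <| hs.mono fun t ht => by
    simpa [p, Polynomial.IsRoot, Polynomial.eval_finsetSum, mul_comm] using h t ht
  simpa [p, Polynomial.finsetSum_coeff, Polynomial.coeff_monomial, hr] using
    congrArg (Polynomial.coeff · r) hp

/-! ### Linear symplectic algebra -/

section

variable {V : Type*} [AddCommGroup V] [Module ℝ V]

/-- The `ℂ`-linear extension of a real linear form to the complexification. -/
def complexify (β : V →ₗ[ℝ] ℝ) : ℂ ⊗[ℝ] V →ₗ[ℂ] ℂ :=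
  LinearMap.liftBaseChange ℂ (Complex.ofRealCLM.toLinearMap ∘ₗ β)

theorem complexify_tmul (β : V →ₗ[ℝ] ℝ) (c : ℂ) (v : V) : complexify β (c ⊗ₜ v) = c * β v := by
  simp [complexify]

theorem eq_of_forall_complexify_eq {X Y : ℂ ⊗[ℝ] V}
    (h : ∀ β : V →ₗ[ℝ] ℝ, complexify β X = complexify β Y) : X = Y := by
  let b := Module.Free.chooseBasis ℝ V
  have repr_eq (i) (Z : ℂ ⊗[ℝ] V) : (b.baseChange ℂ).repr Z i = complexify (b.coord i) Z := by
    induction Z using TensorProduct.induction_on with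
    | zero => simp
    | tmul c v => simp [complexify_tmul, Algebra.smul_def, mul_comm]
    | add u v hu hv => simp [hu, hv]
  exact (b.baseChange ℂ).ext_elem fun i => by rw [repr_eq, repr_eq, h]

theorem exists_complexify_flip_eq [FiniteDimensional ℝ V] {B : LinearMap.BilinForm ℝ V}
    (hB : B.Nondegenerate) (L : V →ₗ[ℝ] ℂ) :
    ∃ X : ℂ ⊗[ℝ] V, ∀ w, complexify (B.flip w) X = L w := by
  let a := (B.toDual hB).symm (Complex.reCLM.toLinearMap ∘ₗ L)
  let b := (B.toDual hB).symm (Complex.imCLM.toLinearMap ∘ₗ L)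
  refine ⟨(1 : ℂ) ⊗ₜ a + Complex.I ⊗ₜ b, fun w => ?_⟩
  have ha : B a w = (L w).re := B.apply_toDual_symm_apply _ _
  have hb : B b w = (L w).im := B.apply_toDual_symm_apply _ _
  rw [map_add, complexify_tmul, complexify_tmul, one_mul, mul_comm]
  change ((B a w : ℝ) : ℂ) + (B b w : ℝ) * Complex.I = L w
  rw [ha, hb, Complex.re_add_im]

end

section

variable (E : Type*) [NormedAddCommGroup E] [NormedSpace ℝ E]

/-- The canonical symplectic form `dp ∧ dx` of `E × E*`. -/
def canonicalSymplecticForm : LinearMap.BilinForm ℝ (E × (E →L[ℝ] ℝ)) :=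
  LinearMap.mk₂ ℝ (fun u v => u.2 v.1 - v.2 u.1)
    (fun u u' v => by simp only [Prod.fst_add, Prod.snd_add, map_add, add_apply]; ring)
    (fun c u v => by
      simp only [Prod.smul_fst, Prod.smul_snd, map_smul, smul_apply, smul_eq_mul]; ring)
    (fun u v v' => by simp only [Prod.fst_add, Prod.snd_add, map_add, add_apply]; ring)
    (fun c u v => by
      simp only [Prod.smul_fst, Prod.smul_snd, map_smul, smul_apply, smul_eq_mul]; ring)

variable {E}

theorem canonicalSymplecticForm_apply (u v : E × (E →L[ℝ] ℝ)) :
    canonicalSymplecticForm E u v = u.2 v.1 - v.2 u.1 := rfl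

theorem canonicalSymplecticForm_nondegenerate : (canonicalSymplecticForm E).Nondegenerate := by
  have isAlt : (canonicalSymplecticForm E).IsAlt := fun u => sub_self _
  refine isAlt.isRefl.nondegenerate_iff_separatingLeft.2 fun u hu => ?_
  refine Prod.ext ((SeparatingDual.eq_zero_iff_forall_dual_eq_zero (R := ℝ) _).2 fun β => ?_)
    (ContinuousLinearMap.ext fun v => ?_)
  · simpa [canonicalSymplecticForm_apply] using hu (0, β)
  · simpa [canonicalSymplecticForm_apply] using hu (v, 0)

theorem complexify_baseChange_fst (β : E →L[ℝ] ℝ) (X : ℂ ⊗[ℝ] (E × (E →L[ℝ] ℝ))) :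
    complexify β.toLinearMap ((LinearMap.fst ℝ E (E →L[ℝ] ℝ)).baseChange ℂ X) =
      -complexify ((canonicalSymplecticForm E).flip (0, β)) X := by
  induction X using TensorProduct.induction_on with
  | zero => simp
  | tmul c v => simp [complexify_tmul, canonicalSymplecticForm_apply]
  | add u v hu hv => simp only [map_add, hu, hv, neg_add]

end

/-! ### Charts of boundaryless manifolds -/

section

variable {𝕜 E H M : Type*} [NontriviallyNormedField 𝕜] [NormedAddCommGroup E] [NormedSpace 𝕜 E]
  [TopologicalSpace H] {I : ModelWithCorners 𝕜 E H}
  [TopologicalSpace M] [ChartedSpace H M]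

section

variable [I.Boundaryless] [IsManifold I 1 M] {x₀ : M}

theorem mdifferentiableAt_extChartAt_symm {y : E} (hy : y ∈ (extChartAt I x₀).target) :
    MDifferentiableAt 𝓘(𝕜, E) I (extChartAt I x₀).symm y := by
  simpa only [I.range_eq_univ, mdifferentiableWithinAt_univ] using
    mdifferentiableWithinAt_extChartAt_symm hy

theorem mfderiv_extChartAt_comp_mfderiv_extChartAt_symm {y : E}
    (hy : y ∈ (extChartAt I x₀).target) :
    (mfderiv I 𝓘(𝕜, E) (extChartAt I x₀) ((extChartAt I x₀).symm y)).comp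
      (mfderiv 𝓘(𝕜, E) I (extChartAt I x₀).symm y) = ContinuousLinearMap.id 𝕜 E := by
  have h := mfderiv_extChartAt_comp_mfderivWithin_extChartAt_symm hy
  rwa [I.range_eq_univ, mfderivWithin_univ] at h

theorem mfderiv_extChartAt_symm_comp_mfderiv_extChartAt {x : M}
    (hx : x ∈ (extChartAt I x₀).source) :
    (mfderiv 𝓘(𝕜, E) I (extChartAt I x₀).symm (extChartAt I x₀ x)).comp
      (mfderiv I 𝓘(𝕜, E) (extChartAt I x₀) x) = ContinuousLinearMap.id 𝕜 (TangentSpace I x) := by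
  simpa only [I.range_eq_univ, mfderivWithin_univ] using
    mfderivWithin_extChartAt_symm_comp_mfderiv_extChartAt' hx

theorem mfderiv_extChartAt_symm_self :
    mfderiv 𝓘(𝕜, E) I (extChartAt I x₀).symm (extChartAt I x₀ x₀) =
      ContinuousLinearMap.id 𝕜 E := by
  have h := mfderivWithin_range_extChartAt_symm (I := I) (x := x₀)
  rwa [I.range_eq_univ, mfderivWithin_univ] at h

end

variable {F : Type*} [NormedAddCommGroup F] [NormedSpace 𝕜 F]

theorem contDiffOn_comp_extChartAt_symm {k : WithTop ℕ∞} [IsManifold I k M] {x₀ : M} {f : M → F}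
    (hf : ContMDiffOn I 𝓘(𝕜, F) k f (chartAt H x₀).source) :
    ContDiffOn 𝕜 k (f ∘ (extChartAt I x₀).symm) (extChartAt I x₀).target := by
  rw [← contMDiffOn_iff_contDiffOn]
  refine hf.comp (contMDiffOn_extChartAt_symm x₀) fun y hy => ?_
  simpa only [Set.mem_preimage, extChartAt_source] using (extChartAt I x₀).map_target hy

theorem mfderiv_eq_fderiv_of_comp_extChartAt_symm_eventuallyEq [IsManifold I 1 M] {f : M → F}
    {x : M} {h : E → F} (hh : DifferentiableAt 𝕜 h (extChartAt I x x))
    (hfh : f ∘ (extChartAt I x).symm =ᶠ[𝓝 (extChartAt I x x)] h) :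
    mfderiv I 𝓘(𝕜, F) f x = fderiv 𝕜 h (extChartAt I x x) := by
  have hf : f =ᶠ[𝓝 x] h ∘ extChartAt I x := by
    filter_upwards [(continuousAt_extChartAt (I := I) x).eventually hfh,
      extChartAt_source_mem_nhds (I := I) x] with x' hx' hx'_source
    rw [Function.comp_apply, ← hx', Function.comp_apply, PartialEquiv.left_inv _ hx'_source]
  rw [hf.mfderiv_eq, mfderiv_comp x hh.mdifferentiableAt
    (mdifferentiableAt_extChartAt (mem_chart_source _ x)), mfderiv_extChartAt_self,
    mfderiv_eq_fderiv]
  rfl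

end

/-! ### The symplectic form of the cotangent bundle -/

section

variable {n : ℕ} {M : Type*} [TopologicalSpace M] [ChartedSpace (EuclideanSpace ℝ (Fin n)) M]
  [IsManifold (𝓡 n) ∞ M]

local notation "𝔼" => EuclideanSpace ℝ (Fin n)

theorem cotangent_extChartAt_symm_apply (q : CotangentBundle n M) {z : 𝔼 × (𝔼 →L[ℝ] ℝ)}
    (hz : z.1 ∈ (extChartAt (𝓡 n) q.proj).target) :
    (extChartAt (cotangentModel n) q).symm z =
      (⟨(extChartAt (𝓡 n) q.proj).symm z.1, z.2.comp
        (mfderiv (𝓡 n) 𝓘(ℝ, 𝔼) (extChartAt (𝓡 n) q.proj) ((extChartAt (𝓡 n) q.proj).symm z.1))⟩ :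
        CotangentBundle n M) := by
  rw [FiberBundle.extChartAt, ← TangentBundle.continuousLinearMapAt_trivializationAt]
  · have symmL_eq : Bundle.Trivialization.symmL ℝ (trivializationAt ℝ (fun _ : M => ℝ) q.proj)
        ((extChartAt (𝓡 n) q.proj).symm z.1) = ContinuousLinearMap.id ℝ ℝ :=
      Bundle.Trivial.symmL_trivialization ℝ M _ _
    change (⟨(extChartAt (𝓡 n) q.proj).symm z.1,
      (Bundle.Trivialization.symmL ℝ (trivializationAt ℝ (fun _ : M => ℝ) q.proj)
        ((extChartAt (𝓡 n) q.proj).symm z.1)).comp (z.2.comp _)⟩ : CotangentBundle n M) = _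
    rw [symmL_eq]
    rfl
  · simpa only [extChartAt_source] using (extChartAt (𝓡 n) q.proj).map_target hz

theorem cotangent_extChartAt_self (q : CotangentBundle n M) :
    extChartAt (cotangentModel n) q q = (extChartAt (𝓡 n) q.proj q.proj, q.snd) := by
  have symmL_eq := TangentBundle.symmL_trivializationAt (I := 𝓡 n) (mem_chart_source 𝔼 q.proj)
  rw [ModelWithCorners.range_eq_univ, mfderivWithin_univ, mfderiv_extChartAt_symm_self] at symmL_eq
  have linearMapAt_eq : Bundle.Trivialization.continuousLinearMapAt ℝ
      (trivializationAt ℝ (fun _ : M => ℝ) q.proj) q.proj = ContinuousLinearMap.id ℝ ℝ :=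
    Bundle.Trivial.continuousLinearMapAt_trivialization ℝ M _ _
  rw [FiberBundle.extChartAt]
  change (_, (Bundle.Trivialization.continuousLinearMapAt ℝ
    (trivializationAt ℝ (fun _ : M => ℝ) q.proj) q.proj).comp (q.snd.comp
      (Bundle.Trivialization.symmL ℝ (trivializationAt 𝔼 (TangentSpace (𝓡 n)) q.proj)
        q.proj))) = _
  rw [symmL_eq, linearMapAt_eq]
  rfl

theorem mdifferentiable_cotangent_proj :
    MDifferentiable (cotangentModel n) (𝓡 n) (fun q : CotangentBundle n M => q.proj) :=
  (Bundle.contMDiff_proj (n := 1) (IB := 𝓡 n)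
    (fun x : M => TangentSpace (𝓡 n) x →L[ℝ] ℝ)).mdifferentiable one_ne_zero

theorem eventually_fst_mem_extChartAt_target (q : CotangentBundle n M) :
    ∀ᶠ z in 𝓝 (extChartAt (cotangentModel n) q q), z.1 ∈ (extChartAt (𝓡 n) q.proj).target := by
  rw [cotangent_extChartAt_self]
  exact continuous_fst.continuousAt.eventually (p := (· ∈ (extChartAt (𝓡 n) q.proj).target))
    (extChartAt_target_mem_nhds (I := 𝓡 n) q.proj)

theorem projDeriv_apply (q : CotangentBundle n M) (u : 𝔼 × (𝔼 →L[ℝ] ℝ)) :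
    projDeriv q u = u.1 := by
  have proj_eq_fst : writtenInExtChartAt (cotangentModel n) (𝓡 n) q
      (fun q : CotangentBundle n M => q.proj)
        =ᶠ[𝓝 (extChartAt (cotangentModel n) q q)] Prod.fst := by
    filter_upwards [eventually_fst_mem_extChartAt_target q] with z hz
    simp only [writtenInExtChartAt, Function.comp_apply, cotangent_extChartAt_symm_apply q hz]
    exact (extChartAt (𝓡 n) q.proj).right_inv hz
  rw [projDeriv, (mdifferentiable_cotangent_proj q).mfderiv, ModelWithCorners.range_eq_univ,
    fderivWithin_univ, proj_eq_fst.fderiv_eq, fderiv_fst]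
  rfl

theorem projDeriv_mfderiv_extChartAt_symm (q : CotangentBundle n M) {z : 𝔼 × (𝔼 →L[ℝ] ℝ)}
    (hz : z.1 ∈ (extChartAt (𝓡 n) q.proj).target) (u : 𝔼 × (𝔼 →L[ℝ] ℝ)) :
    (projDeriv _ (mfderiv 𝓘(ℝ, 𝔼 × (𝔼 →L[ℝ] ℝ)) (cotangentModel n)
      (extChartAt (cotangentModel n) q).symm z u) : 𝔼) =
        mfderiv 𝓘(ℝ, 𝔼) (𝓡 n) (extChartAt (𝓡 n) q.proj).symm z.1 u.1 := by
  have hz' : z ∈ (extChartAt (cotangentModel n) q).target := by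
    rw [FiberBundle.extChartAt_target]
    refine ⟨⟨hz, ?_⟩, trivial⟩
    simpa using (extChartAt (𝓡 n) q.proj).map_target hz
  have proj_comp_symm :
      (fun q : CotangentBundle n M => q.proj) ∘ (extChartAt (cotangentModel n) q).symm
        =ᶠ[𝓝 z] (extChartAt (𝓡 n) q.proj).symm ∘ Prod.fst := by
    filter_upwards [continuous_fst.continuousAt.eventually
      ((isOpen_extChartAt_target q.proj).mem_nhds hz)] with w hw
    simp only [Function.comp_apply, cotangent_extChartAt_symm_apply q hw]
  have chain_rule := proj_comp_symm.mfderiv_eq (I := 𝓘(ℝ, 𝔼 × (𝔼 →L[ℝ] ℝ))) (I' := 𝓡 n)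
  rw [mfderiv_comp z (mdifferentiable_cotangent_proj _) (mdifferentiableAt_extChartAt_symm hz'),
    mfderiv_comp z (mdifferentiableAt_extChartAt_symm hz) differentiableAt_fst.mdifferentiableAt,
    mfderiv_eq_fderiv, fderiv_fst] at chain_rule
  exact DFunLike.congr_fun chain_rule u

theorem liouvilleForm_comp_mfderiv_extChartAt_symm (q : CotangentBundle n M)
    {z : 𝔼 × (𝔼 →L[ℝ] ℝ)} (hz : z.1 ∈ (extChartAt (𝓡 n) q.proj).target) :
    ((liouvilleForm ((extChartAt (cotangentModel n) q).symm z)).comp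
      (mfderiv 𝓘(ℝ, 𝔼 × (𝔼 →L[ℝ] ℝ)) (cotangentModel n) (extChartAt (cotangentModel n) q).symm z) :
      𝔼 × (𝔼 →L[ℝ] ℝ) →L[ℝ] ℝ)
      = z.2.comp (ContinuousLinearMap.fst ℝ 𝔼 (𝔼 →L[ℝ] ℝ)) := by
  have liouvilleForm_eq {q' : CotangentBundle n M} {x : M} {p : TangentSpace (𝓡 n) x →L[ℝ] ℝ}
      (h : q' = ⟨x, p⟩) (u) : liouvilleForm q' u = p (projDeriv q' u : 𝔼) := by
    subst h; rfl
  refine ContinuousLinearMap.ext fun u => ?_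
  refine (liouvilleForm_eq (cotangent_extChartAt_symm_apply q hz) _).trans ?_
  refine (congrArg _ (projDeriv_mfderiv_extChartAt_symm q hz u)).trans ?_
  exact congrArg z.2
    (DFunLike.congr_fun (mfderiv_extChartAt_comp_mfderiv_extChartAt_symm hz) u.1)

theorem symplecticForm_eq (q : CotangentBundle n M) :
    symplecticForm q = canonicalSymplecticForm 𝔼 := by
  let θ : 𝔼 × (𝔼 →L[ℝ] ℝ) →L[ℝ] 𝔼 × (𝔼 →L[ℝ] ℝ) →L[ℝ] ℝ :=
    ((ContinuousLinearMap.compL ℝ (𝔼 × (𝔼 →L[ℝ] ℝ)) 𝔼 ℝ).flip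
      (ContinuousLinearMap.fst ℝ 𝔼 (𝔼 →L[ℝ] ℝ))).comp (ContinuousLinearMap.snd ℝ 𝔼 (𝔼 →L[ℝ] ℝ))
  have liouvilleForm_eq : (fun z : 𝔼 × (𝔼 →L[ℝ] ℝ) =>
      ((liouvilleForm ((extChartAt (cotangentModel n) q).symm z)).comp
        (mfderiv 𝓘(ℝ, 𝔼 × (𝔼 →L[ℝ] ℝ)) (cotangentModel n)
          (extChartAt (cotangentModel n) q).symm z) : 𝔼 × (𝔼 →L[ℝ] ℝ) →L[ℝ] ℝ))
        =ᶠ[𝓝 (extChartAt (cotangentModel n) q q)] θ := by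
    filter_upwards [eventually_fst_mem_extChartAt_target q] with z hz
    exact liouvilleForm_comp_mfderiv_extChartAt_symm q hz
  have fderiv_liouvilleForm := liouvilleForm_eq.fderiv_eq (𝕜 := ℝ)
  rw [ContinuousLinearMap.fderiv] at fderiv_liouvilleForm
  have of_eq {B : 𝔼 × (𝔼 →L[ℝ] ℝ) →L[ℝ] 𝔼 × (𝔼 →L[ℝ] ℝ) →L[ℝ] ℝ}
      {A : 𝔼 × (𝔼 →L[ℝ] ℝ) →L[ℝ] 𝔼 × (𝔼 →L[ℝ] ℝ)} (hB : B = θ)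
      (hA : A = ContinuousLinearMap.id ℝ _) (u v) :
      B (A u) (A v) - B (A v) (A u) = canonicalSymplecticForm 𝔼 u v := by
    subst hB hA; rfl
  exact LinearMap.ext₂ (of_eq fderiv_liouvilleForm mfderiv_extChartAt_self)

theorem contractSymplectic_eq_complexify (q : CotangentBundle n M)
    (X : ℂ ⊗[ℝ] (𝔼 × (𝔼 →L[ℝ] ℝ))) (w : 𝔼 × (𝔼 →L[ℝ] ℝ)) :
    contractSymplectic q X w = complexify ((canonicalSymplecticForm 𝔼).flip w) X :=
  congrArg (fun Ω : LinearMap.BilinForm ℝ (𝔼 × (𝔼 →L[ℝ] ℝ)) => complexify (Ω.flip w) X)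
    (symplecticForm_eq q)

theorem contractSymplectic_hamiltonianField (F : CotangentBundle n M → ℂ)
    (q : CotangentBundle n M) (w : TangentSpace (cotangentModel n) q) :
    contractSymplectic q (hamiltonianField F q) w = -cotangentDiff F q w := by
  have exists_field : ∃ X : ℂ ⊗[ℝ] TangentSpace (cotangentModel n) q,
      ∀ w, contractSymplectic q X w + cotangentDiff F q w = 0 := by
    obtain ⟨X, hX⟩ := exists_complexify_flip_eq (V := 𝔼 × (𝔼 →L[ℝ] ℝ))
      canonicalSymplecticForm_nondegenerate (-(cotangentDiff F q).toLinearMap)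
    exact ⟨X, fun w => eq_neg_iff_add_eq_zero.1
      ((contractSymplectic_eq_complexify q X w).trans (hX w))⟩
  rw [hamiltonianField, dif_pos exists_field]
  exact eq_neg_of_add_eq_zero_left (exists_field.choose_spec w)

theorem complexify_projDeriv_hamiltonianField (F : CotangentBundle n M → ℂ)
    (q : CotangentBundle n M) (β : 𝔼 →L[ℝ] ℝ) :
    complexify β.toLinearMap ((projDeriv q).toLinearMap.baseChange ℂ (hamiltonianField F q)) =
      cotangentDiff F q ((0, β) : 𝔼 × (𝔼 →L[ℝ] ℝ)) := by
  have projDeriv_eq : (projDeriv q).toLinearMap = LinearMap.fst ℝ 𝔼 (𝔼 →L[ℝ] ℝ) :=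
    LinearMap.ext (projDeriv_apply q)
  have contract : complexify ((canonicalSymplecticForm 𝔼).flip (0, β)) (hamiltonianField F q) = _ :=
    (contractSymplectic_eq_complexify q _ _).symm.trans
      (contractSymplectic_hamiltonianField F q ((0, β) : 𝔼 × (𝔼 →L[ℝ] ℝ)))
  rw [projDeriv_eq]
  exact (complexify_baseChange_fst β _).trans (neg_eq_iff_eq_neg.2 contract)

theorem projDeriv_hamiltonianField_eq_iff (F : CotangentBundle n M → ℂ) (q : CotangentBundle n M)
    (v : 𝔼) :
    (projDeriv q).toLinearMap.baseChange ℂ (hamiltonianField F q) =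
        (1 : ℂ) ⊗ₜ[ℝ] (v : TangentSpace (𝓡 n) q.proj) ↔
      ∀ β : 𝔼 →L[ℝ] ℝ, cotangentDiff F q ((0, β) : 𝔼 × (𝔼 →L[ℝ] ℝ)) = β v := by
  have complexify_one_tmul (β : 𝔼 →L[ℝ] ℝ) :
      complexify β.toLinearMap ((1 : ℂ) ⊗ₜ[ℝ] v) = β v :=
    (complexify_tmul _ 1 v).trans (one_mul _)
  constructor
  · intro h β
    rw [← complexify_projDeriv_hamiltonianField, h]
    exact complexify_one_tmul β
  · intro h
    refine eq_of_forall_complexify_eq (V := 𝔼) fun β => ?_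
    let β' : 𝔼 →L[ℝ] ℝ := LinearMap.toContinuousLinearMap β
    exact (complexify_projDeriv_hamiltonianField F q β').trans
      ((h β').trans (complexify_one_tmul β').symm)

end

/-! ### Hamiltonians of tensor fields -/

section

variable {n : ℕ}

local notation "𝔼" => EuclideanSpace ℝ (Fin n)

theorem covector_eq_sum (p : 𝔼 →L[ℝ] ℝ) :
    p = ∑ j, p (EuclideanSpace.single j 1) • (EuclideanSpace.proj j : 𝔼 →L[ℝ] ℝ) := by
  refine ContinuousLinearMap.ext fun v => ?_
  conv_lhs => rw [← (EuclideanSpace.basisFun (Fin n) ℝ).sum_repr v]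
  simp [mul_comm]

variable {M : Type*} [TopologicalSpace M] [ChartedSpace (EuclideanSpace ℝ (Fin n)) M]

theorem comp_mfderiv_extChartAt_eq_sum (p : 𝔼 →L[ℝ] ℝ) (x₀ x : M) :
    (p.comp (mfderiv (𝓡 n) 𝓘(ℝ, 𝔼) (extChartAt (𝓡 n) x₀) x) : TangentSpace (𝓡 n) x →L[ℝ] ℝ) =
      ∑ j, p (EuclideanSpace.single j 1) • coordCovector x₀ j x := by
  conv_lhs => rw [covector_eq_sum p]
  exact ContinuousLinearMap.finsetSum_comp ..

theorem SymTensorField.val_comp_mfderiv {r : ℕ} (Φ : SymTensorField n M r) (p : 𝔼 →L[ℝ] ℝ)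
    (x₀ x : M) :
    Φ.val x (fun _ => p.comp (mfderiv (𝓡 n) 𝓘(ℝ, 𝔼) (extChartAt (𝓡 n) x₀) x)) =
      ∑ J : Fin r → Fin n, ((∏ k, p (EuclideanSpace.single (J k) 1) : ℝ) : ℂ) *
        Φ.val x (fun k => coordCovector x₀ (J k) x) := by
  simp only [comp_mfderiv_extChartAt_eq_sum, MultilinearMap.map_sum, MultilinearMap.map_smul_univ,
    Complex.real_smul]

theorem TensorField.toFun_eq_sum (Φ : TensorField n M) {N : ℕ}
    (hN : ∀ r, N < r → ∀ x, (Φ.comp r).val x = 0) (q : CotangentBundle n M) :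
    Φ.toFun q = ∑ r ∈ Finset.range (N + 1), (Φ.comp r).val q.proj (fun _ => q.snd) := by
  refine finsum_eq_sum_of_support_subset _ fun r hr => ?_
  by_contra hr_range
  simp only [Finset.coe_range, Set.mem_Iio, not_lt] at hr_range
  exact hr (by simp [hN r hr_range])

variable [IsManifold (𝓡 n) ∞ M]

theorem coordCovector_self (x : M) (j : Fin n) :
    (coordCovector x j x : 𝔼 →L[ℝ] ℝ) = EuclideanSpace.proj j := by
  rw [coordCovector, mfderiv_extChartAt_self]
  rfl

/-- The function `∑ᵣ Φᵣ(p, …, p)` expressed in the canonical coordinates `(x, p)` of `T*M` induced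
by the chart of `M` at `x₀`. -/
def TensorField.coordFun (Φ : TensorField n M) (x₀ : M) (z : 𝔼 × (𝔼 →L[ℝ] ℝ)) : ℂ :=
  Φ.toFun ⟨(extChartAt (𝓡 n) x₀).symm z.1,
    z.2.comp (mfderiv (𝓡 n) 𝓘(ℝ, 𝔼) (extChartAt (𝓡 n) x₀) ((extChartAt (𝓡 n) x₀).symm z.1))⟩

theorem TensorField.coordFun_extChartAt_self (Φ : TensorField n M) (x : M) (p : 𝔼 →L[ℝ] ℝ) :
    Φ.coordFun x (extChartAt (𝓡 n) x x, p) = Φ.toFun ⟨x, p⟩ := by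
  have of_eq {x' : M} (hx' : x' = x) : (⟨x', p.comp (mfderiv (𝓡 n) 𝓘(ℝ, 𝔼)
      (extChartAt (𝓡 n) x) x')⟩ : CotangentBundle n M) = ⟨x, p⟩ := by
    rw [hx', mfderiv_extChartAt_self]
    rfl
  exact congrArg Φ.toFun (of_eq (extChartAt_to_inv x))

theorem TensorField.differentiableAt_coordFun (Φ : TensorField n M) {x₀ : M}
    {z : 𝔼 × (𝔼 →L[ℝ] ℝ)} (hz : z.1 ∈ (extChartAt (𝓡 n) x₀).target) :
    DifferentiableAt ℝ (Φ.coordFun x₀) z := by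
  obtain ⟨N, hN⟩ := Φ.finite
  simp only [funext fun z => show Φ.coordFun x₀ z = _ from Φ.toFun_eq_sum hN _,
    SymTensorField.val_comp_mfderiv]
  refine DifferentiableAt.fun_sum fun r _ => DifferentiableAt.fun_sum fun J _ =>
    DifferentiableAt.mul ?_ ?_
  · have h : ContDiff ℝ 1 fun z : 𝔼 × (𝔼 →L[ℝ] ℝ) => ∏ k, z.2 (EuclideanSpace.single (J k) 1) :=
      contDiff_prod fun k _ => by fun_prop
    exact Complex.ofRealCLM.differentiableAt.comp z (h.differentiable one_ne_zero z)
  · have smooth := contDiffOn_comp_extChartAt_symm ((Φ.comp r).smooth x₀ J)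
    exact ((smooth.contDiffAt ((isOpen_extChartAt_target x₀).mem_nhds hz)).differentiableAt
      (by simp)).comp z differentiableAt_fst

theorem TensorField.hasFDerivAt_toFun_fiber (Φ : TensorField n M) (x : M) (p : 𝔼 →L[ℝ] ℝ) :
    HasFDerivAt (fun p : 𝔼 →L[ℝ] ℝ => Φ.toFun ⟨x, p⟩)
      ((cotangentDiff Φ.toFun ⟨x, p⟩).comp (ContinuousLinearMap.inr ℝ 𝔼 (𝔼 →L[ℝ] ℝ))) p := by
  let q : CotangentBundle n M := ⟨x, p⟩
  have differentiableAt :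
      DifferentiableAt ℝ (Φ.coordFun x) (extChartAt (cotangentModel n) q q) := by
    rw [cotangent_extChartAt_self]
    exact Φ.differentiableAt_coordFun (mem_extChartAt_target x)
  have toFun_eq : Φ.toFun ∘ (extChartAt (cotangentModel n) q).symm
      =ᶠ[𝓝 (extChartAt (cotangentModel n) q q)] Φ.coordFun x := by
    filter_upwards [eventually_fst_mem_extChartAt_target q] with z hz
    exact congrArg Φ.toFun (cotangent_extChartAt_symm_apply q hz)
  have cotangentDiff_eq : cotangentDiff Φ.toFun q = _ :=
    mfderiv_eq_fderiv_of_comp_extChartAt_symm_eventuallyEq differentiableAt toFun_eq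
  rw [cotangent_extChartAt_self] at differentiableAt cotangentDiff_eq
  have chain_rule := differentiableAt.hasFDerivAt.comp p
    (hasFDerivAt_prodMk_right (extChartAt (𝓡 n) x x) p)
  rw [← cotangentDiff_eq] at chain_rule
  exact chain_rule.congr_of_eventuallyEq
    (Filter.Eventually.of_forall fun p => (Φ.coordFun_extChartAt_self x p).symm)

end

/-! ### The musical isomorphism and second order differential equations -/

section

variable {n : ℕ} {M : Type*} [TopologicalSpace M] [ChartedSpace (EuclideanSpace ℝ (Fin n)) M]
  [IsManifold (𝓡 n) ∞ M] (g : PseudoRiemannianMetric n M) (x : M)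

local notation "𝔼" => EuclideanSpace ℝ (Fin n)

/-- The metric at `x` as a bilinear form on the model space, which is the tangent space at `x` by
definition but carries the Euclidean norm. -/
def metricForm : 𝔼 →L[ℝ] 𝔼 →L[ℝ] ℝ := g.val x

/-- The isomorphism `v ↦ g(v, ·)` of the tangent space with the cotangent space. -/
def flat : 𝔼 ≃L[ℝ] (𝔼 →L[ℝ] ℝ) :=
  (LinearEquiv.ofInjectiveOfFinrankEq (metricForm g x).toLinearMap
    ((injective_iff_map_eq_zero _).2 fun v hv =>
      g.nondegenerate x v fun w => DFunLike.congr_fun hv w)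
    ((LinearMap.toContinuousLinearMap (𝕜 := ℝ) (E := 𝔼) (F' := ℝ)).finrank_eq.symm.trans
      Subspace.dual_finrank_eq).symm).toContinuousLinearEquiv

/-- The bilinear form `g^{jk} p_j q_k` on the cotangent space. -/
def cometric : (𝔼 →L[ℝ] ℝ) →L[ℝ] (𝔼 →L[ℝ] ℝ) →L[ℝ] ℝ :=
  (ContinuousLinearMap.apply ℝ ℝ).comp ((flat g x).symm : (𝔼 →L[ℝ] ℝ) →L[ℝ] 𝔼)

theorem cometric_flat (v : 𝔼) (q : 𝔼 →L[ℝ] ℝ) : cometric g x (flat g x v) q = q v :=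
  congrArg q ((flat g x).symm_apply_apply v)

theorem cometric_comm (p q : 𝔼 →L[ℝ] ℝ) : cometric g x p q = cometric g x q p := by
  obtain ⟨v, rfl⟩ := (flat g x).surjective p
  obtain ⟨w, rfl⟩ := (flat g x).surjective q
  rw [cometric_flat, cometric_flat]
  exact g.symm x w v

theorem hasFDerivAt_half_cometric_self (p : 𝔼 →L[ℝ] ℝ) :
    HasFDerivAt (fun p => ((1 / 2 * cometric g x p p : ℝ) : ℂ))
      (Complex.ofRealCLM.comp (cometric g x p)) p := by
  have product_rule := ((cometric g x).hasFDerivAt_of_bilinear (hasFDerivAt_id p)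
    (hasFDerivAt_id p)).const_mul (1 / 2 : ℝ)
  convert! Complex.ofRealCLM.hasFDerivAt.comp p product_rule using 1
  ext β
  simp only [ContinuousLinearMap.comp_apply, Complex.ofRealCLM_apply, id_eq, smul_apply, add_apply,
    ContinuousLinearMap.precompR_apply, ContinuousLinearMap.compL_apply,
    ContinuousLinearMap.precompL_apply, ContinuousLinearMap.id_apply, smul_eq_mul,
    cometric_comm g x β p]
  congr 1
  ring

theorem eq_const_add_half_cometric_iff {F : (𝔼 →L[ℝ] ℝ) → ℂ} (hF : Differentiable ℝ F) :
    (∀ p, fderiv ℝ F p = Complex.ofRealCLM.comp (cometric g x p)) ↔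
      ∀ p, F p = F 0 + ((1 / 2 * cometric g x p p : ℝ) : ℂ) := by
  constructor
  · intro fderiv_eq p
    have hasFDerivAt_sub (p) : HasFDerivAt (𝕜 := ℝ)
        (fun p => F p - ((1 / 2 * cometric g x p p : ℝ) : ℂ)) 0 p := by
      have := (hF p).hasFDerivAt.sub (hasFDerivAt_half_cometric_self g x p)
      rwa [fderiv_eq, sub_self] at this
    have sub_eq := is_const_of_fderiv_eq_zero (𝕜 := ℝ)
      (fun p => (hasFDerivAt_sub p).differentiableAt) (fun p => (hasFDerivAt_sub p).fderiv) p 0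
    simpa only [map_zero, mul_zero, Complex.ofReal_zero, sub_zero, sub_eq_iff_eq_add] using sub_eq
  · intro F_eq p
    rw [funext F_eq]
    exact ((hasFDerivAt_half_cometric_self g x p).const_add _).fderiv

theorem projDeriv_hamiltonianField_flat_iff (Φ : TensorField n M) (v : TangentSpace (𝓡 n) x) :
    (projDeriv (⟨x, g.val x v⟩ : CotangentBundle n M)).toLinearMap.baseChange ℂ
        (hamiltonianField Φ.toFun ⟨x, g.val x v⟩) = (1 : ℂ) ⊗ₜ[ℝ] v ↔
      fderiv ℝ (fun p : 𝔼 →L[ℝ] ℝ => Φ.toFun ⟨x, p⟩) (flat g x v) =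
        Complex.ofRealCLM.comp (cometric g x (flat g x v)) := by
  rw [(Φ.hasFDerivAt_toFun_fiber x (flat g x v)).fderiv]
  refine (projDeriv_hamiltonianField_eq_iff _ _ v).trans
    ⟨fun h => ContinuousLinearMap.ext fun β => (h β).trans ?_,
      fun h β => (DFunLike.congr_fun h β).trans ?_⟩
  · exact congrArg Complex.ofReal (cometric_flat g x v β).symm
  · exact congrArg Complex.ofReal (cometric_flat g x v β)

omit x in
theorem isSecondOrderEquation_hamiltonianField_iff (Φ : TensorField n M) :
    IsSecondOrderEquation g (hamiltonianField Φ.toFun) ↔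
      ∀ (x : M) (p : 𝔼 →L[ℝ] ℝ),
        Φ.toFun ⟨x, p⟩ = Φ.toFun ⟨x, (0 : 𝔼 →L[ℝ] ℝ)⟩ + ((1 / 2 * cometric g x p p : ℝ) : ℂ) := by
  refine forall_congr' fun x => ?_
  rw [← eq_const_add_half_cometric_iff g x
    fun p => (Φ.hasFDerivAt_toFun_fiber x p).differentiableAt]
  exact (forall_congr' (projDeriv_hamiltonianField_flat_iff g x Φ)).trans
    ((flat g x).surjective.forall (p := fun p => fderiv ℝ (fun p => Φ.toFun ⟨x, p⟩) p =
      Complex.ofRealCLM.comp (cometric g x p))).symm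

end

/-! ### Smoothness of inverse matrices and of partial derivatives -/

section

variable {𝕜 E ι : Type*} [NontriviallyNormedField 𝕜] [NormedAddCommGroup E] [NormedSpace 𝕜 E]
  [Fintype ι] [DecidableEq ι] {k : WithTop ℕ∞} {s : Set E} {A : E → Matrix ι ι 𝕜}

theorem contDiffOn_matrix_det (hA : ∀ i j, ContDiffOn 𝕜 k (fun y => A y i j) s) :
    ContDiffOn 𝕜 k (fun y => (A y).det) s := by
  simp only [Matrix.det_apply]
  exact ContDiffOn.sum fun σ _ => (contDiffOn_prod fun i _ => hA _ _).const_smul _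

theorem contDiffOn_matrix_inv [CompleteSpace 𝕜] (hA : ∀ i j, ContDiffOn 𝕜 k (fun y => A y i j) s)
    (hdet : ∀ y ∈ s, IsUnit (A y).det) (i j : ι) :
    ContDiffOn 𝕜 k (fun y => (A y)⁻¹ i j) s := by
  have adjugate : ContDiffOn 𝕜 k (fun y => (A y).adjugate i j) s := by
    simp only [Matrix.adjugate_apply]
    refine contDiffOn_matrix_det fun a b => ?_
    by_cases ha : a = j
    · subst ha
      simpa using contDiffOn_const
    · simpa [Matrix.updateRow_ne ha] using hA a b
  refine (((contDiffOn_matrix_det hA).inv fun y hy => (hdet y hy).ne_zero).mul adjugate).congr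
    fun y _ => ?_
  rw [Matrix.inv_def, Ring.inverse_eq_inv', Matrix.smul_apply, smul_eq_mul, Pi.inv_apply]

end

section

variable {n : ℕ}

local notation "𝔼" => EuclideanSpace ℝ (Fin n)

theorem contDiffOn_partialDeriv {F : Type*} [NormedAddCommGroup F] [NormedSpace ℝ F] {s : Set 𝔼}
    (hs : IsOpen s) {h : 𝔼 → F} (hh : ContDiffOn ℝ ∞ h s) (j : Fin n) :
    ContDiffOn ℝ ∞ (partialDeriv j h) s :=
  (hh.fderiv_of_isOpen hs (by simp)).clm_apply contDiffOn_const

theorem partialDeriv_congr {F : Type*} [NormedAddCommGroup F] [NormedSpace ℝ F] {h h' : 𝔼 → F}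
    {y : 𝔼} (hh : h =ᶠ[𝓝 y] h') (j : Fin n) : partialDeriv j h y = partialDeriv j h' y := by
  rw [partialDeriv, partialDeriv, hh.fderiv_eq]

theorem partialDeriv_add {F : Type*} [NormedAddCommGroup F] [NormedSpace ℝ F] {a b : 𝔼 → F} {y : 𝔼}
    (ha : DifferentiableAt ℝ a y) (hb : DifferentiableAt ℝ b y) (j : Fin n) :
    partialDeriv j (fun z => a z + b z) y = partialDeriv j a y + partialDeriv j b y := by
  simp only [partialDeriv, fderiv_fun_add ha hb, add_apply]

section

variable {𝔸 : Type*} [NormedCommRing 𝔸] [NormedAlgebra ℝ 𝔸]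
  {a b : EuclideanSpace ℝ (Fin n) → 𝔸} {y : EuclideanSpace ℝ (Fin n)}

theorem partialDeriv_mul (ha : DifferentiableAt ℝ a y) (hb : DifferentiableAt ℝ b y) (j : Fin n) :
    partialDeriv j (fun z => a z * b z) y =
      partialDeriv j a y * b y + a y * partialDeriv j b y := by
  simp only [partialDeriv, fderiv_fun_mul ha hb, add_apply, smul_apply, smul_eq_mul]
  ring

theorem partialDeriv_const_mul (c : 𝔸) (ha : DifferentiableAt ℝ a y) (j : Fin n) :
    partialDeriv j (fun z => c * a z) y = c * partialDeriv j a y := by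
  simp only [partialDeriv, fderiv_const_mul ha, smul_apply, smul_eq_mul]

theorem partialDeriv_pow (ha : DifferentiableAt ℝ a y) (m : ℕ) (j : Fin n) :
    partialDeriv j (fun z => a z ^ (m + 1)) y = (m + 1) * a y ^ m * partialDeriv j a y := by
  simp [partialDeriv, fderiv_fun_pow _ ha]

end

end

/-! ### Coordinate frames and the matrix of the metric -/

section

variable {n : ℕ} {M : Type*} [TopologicalSpace M] [ChartedSpace (EuclideanSpace ℝ (Fin n)) M]

local notation "𝔼" => EuclideanSpace ℝ (Fin n)

/-- The coordinate vector `∂/∂xʲ`, as a vector of the model space, which is the tangent space by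
definition but carries the Euclidean norm. -/
def frame (x₀ : M) (j : Fin n) (y : 𝔼) : 𝔼 := coordVector x₀ j y

/-- The coordinate covector `dxʲ`, as a covector of the model space. -/
def coframe (x₀ : M) (j : Fin n) (x : M) : 𝔼 →L[ℝ] ℝ := coordCovector x₀ j x

variable [IsManifold (𝓡 n) ∞ M]

theorem coframe_frame {x₀ : M} {y : 𝔼} (hy : y ∈ (extChartAt (𝓡 n) x₀).target) (i j : Fin n) :
    coframe x₀ i ((extChartAt (𝓡 n) x₀).symm y) (frame x₀ j y) = if i = j then 1 else 0 := by
  have mfderiv_single := DFunLike.congr_fun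
    (mfderiv_extChartAt_comp_mfderiv_extChartAt_symm hy) (EuclideanSpace.single j 1)
  refine (congrArg (fun v : 𝔼 => v i) mfderiv_single).trans ?_
  change (EuclideanSpace.single j (1 : ℝ) : 𝔼) i = _
  simp

theorem sum_coframe_smul_frame {x₀ : M} {y : 𝔼} (hy : y ∈ (extChartAt (𝓡 n) x₀).target) (v : 𝔼) :
    ∑ j, coframe x₀ j ((extChartAt (𝓡 n) x₀).symm y) v • frame x₀ j y = v := by
  have sum_smul_map_single (L : 𝔼 →L[ℝ] 𝔼) (w : 𝔼) :
      ∑ j, w j • L (EuclideanSpace.single j 1) = L w := by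
    conv_rhs => rw [← (EuclideanSpace.basisFun (Fin n) ℝ).sum_repr w, map_sum]
    simp
  have mfderiv_comp := mfderiv_extChartAt_symm_comp_mfderiv_extChartAt
    ((extChartAt (𝓡 n) x₀).map_target hy)
  rw [(extChartAt (𝓡 n) x₀).right_inv hy] at mfderiv_comp
  exact (sum_smul_map_single _ _).trans (DFunLike.congr_fun mfderiv_comp v)

variable (g : PseudoRiemannianMetric n M) {x₀ : M} {y : EuclideanSpace ℝ (Fin n)}

theorem metricMatrix_symm (x₀ : M) (y : 𝔼) (i j : Fin n) :
    metricMatrix g x₀ y i j = metricMatrix g x₀ y j i :=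
  g.symm _ _ _

theorem flat_frame (hy : y ∈ (extChartAt (𝓡 n) x₀).target) (i : Fin n) :
    flat g ((extChartAt (𝓡 n) x₀).symm y) (frame x₀ i y) =
      ∑ j, metricMatrix g x₀ y i j • coframe x₀ j ((extChartAt (𝓡 n) x₀).symm y) := by
  refine ContinuousLinearMap.ext fun v => ?_
  conv_lhs => rw [← sum_coframe_smul_frame hy v, map_sum]
  rw [_root_.sum_apply]
  refine Finset.sum_congr rfl fun j _ => ?_
  rw [map_smul, smul_eq_mul, mul_comm]
  rfl

theorem metricMatrix_mul_cometric (hy : y ∈ (extChartAt (𝓡 n) x₀).target) :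
    metricMatrix g x₀ y * Matrix.of (fun j k => cometric g ((extChartAt (𝓡 n) x₀).symm y)
      (coframe x₀ j ((extChartAt (𝓡 n) x₀).symm y))
      (coframe x₀ k ((extChartAt (𝓡 n) x₀).symm y))) = 1 := by
  ext i k
  have cometric_flat_frame := (cometric_flat g ((extChartAt (𝓡 n) x₀).symm y) (frame x₀ i y)
    (coframe x₀ k ((extChartAt (𝓡 n) x₀).symm y))).trans (coframe_frame hy k i)
  rw [flat_frame g hy, map_sum, _root_.sum_apply] at cometric_flat_frame
  simp only [map_smul, eq_comm (a := k)] at cometric_flat_frame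
  rw [Matrix.mul_apply, Matrix.one_apply]
  exact cometric_flat_frame

theorem cometric_coframe (hy : y ∈ (extChartAt (𝓡 n) x₀).target) (j k : Fin n) :
    cometric g ((extChartAt (𝓡 n) x₀).symm y) (coframe x₀ j ((extChartAt (𝓡 n) x₀).symm y))
      (coframe x₀ k ((extChartAt (𝓡 n) x₀).symm y)) = (metricMatrix g x₀ y)⁻¹ j k := by
  rw [Matrix.inv_eq_right_inv (metricMatrix_mul_cometric g hy)]
  rfl

theorem isUnit_det_metricMatrix (hy : y ∈ (extChartAt (𝓡 n) x₀).target) :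
    IsUnit (metricMatrix g x₀ y).det :=
  (Matrix.isUnit_iff_isUnit_det _).1 (IsUnit.of_mul_eq_one _ (metricMatrix_mul_cometric g hy))

end

/-! ### Smoothness of the Christoffel symbols and of the iterated covariant differentials -/

section

variable {n : ℕ} {M : Type*} [TopologicalSpace M] [ChartedSpace (EuclideanSpace ℝ (Fin n)) M]
  [IsManifold (𝓡 n) ∞ M]

local notation "𝔼" => EuclideanSpace ℝ (Fin n)

theorem contMDiffOn_symmL_single (x₀ : M) (i : Fin n) :
    ContMDiffOn (𝓡 n) (𝓡 n).tangent ∞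
      (fun x => (⟨x, (trivializationAt 𝔼 (TangentSpace (𝓡 n)) x₀).symmL ℝ x
        (EuclideanSpace.single i 1)⟩ : TangentBundle (𝓡 n) M))
      (chartAt 𝔼 x₀).source := by
  let e := trivializationAt 𝔼 (TangentSpace (𝓡 n) (M := M)) x₀
  have pairing : ContMDiff (𝓡 n) ((𝓡 n).prod 𝓘(ℝ, 𝔼)) ∞
      (fun x : M => (x, (EuclideanSpace.single i 1 : 𝔼))) := contMDiff_id.prodMk contMDiff_const
  refine ((e.contMDiffOn_symm (IB := 𝓡 n) (n := ∞)).comp pairing.contMDiffOn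
    (s := (chartAt 𝔼 x₀).source) fun x hx => ?_).congr fun x hx => ?_
  · simpa [e, Bundle.Trivialization.target_eq] using hx
  · have hx_base : x ∈ e.baseSet := by simpa [e] using hx
    rw [Function.comp_apply, Bundle.Trivialization.symmL_apply _ hx_base]
    exact e.mk_symm hx_base _

variable (g : PseudoRiemannianMetric n M)

theorem contMDiffOn_metric_symmL_single (x₀ : M) (i j : Fin n) :
    ContMDiffOn (𝓡 n) 𝓘(ℝ, ℝ) ∞
      (fun x => g.val x ((trivializationAt 𝔼 (TangentSpace (𝓡 n)) x₀).symmL ℝ x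
        (EuclideanSpace.single i 1)) ((trivializationAt 𝔼 (TangentSpace (𝓡 n)) x₀).symmL ℝ x
        (EuclideanSpace.single j 1)))
      (chartAt 𝔼 x₀).source := by
  intro x hx
  have smooth_section : ContMDiffWithinAt (𝓡 n) ((𝓡 n).prod 𝓘(ℝ)) ∞
      (fun m => Bundle.TotalSpace.mk' ℝ (E := Bundle.Trivial M ℝ) m
      (g.val m ((trivializationAt 𝔼 (TangentSpace (𝓡 n)) x₀).symmL ℝ m
        (EuclideanSpace.single i 1)) ((trivializationAt 𝔼 (TangentSpace (𝓡 n)) x₀).symmL ℝ m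
        (EuclideanSpace.single j 1)))) (chartAt 𝔼 x₀).source x :=
    ContMDiffWithinAt.clm_bundle_apply₂ (F₁ := 𝔼) (F₂ := 𝔼) (g.contMDiff x).contMDiffWithinAt
      (contMDiffOn_symmL_single x₀ i x hx) (contMDiffOn_symmL_single x₀ j x hx)
  simp only [Bundle.contMDiffWithinAt_totalSpace] at smooth_section
  exact smooth_section.2

theorem contDiffOn_metricMatrix (x₀ : M) (i j : Fin n) :
    ContDiffOn ℝ ∞ (fun y => metricMatrix g x₀ y i j) (extChartAt (𝓡 n) x₀).target := by
  refine (contDiffOn_comp_extChartAt_symm (contMDiffOn_metric_symmL_single g x₀ i j)).congr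
    fun y hy => Eq.symm ?_
  have symm_mem : (extChartAt (𝓡 n) x₀).symm y ∈ (chartAt 𝔼 x₀).source := by
    simpa using (extChartAt (𝓡 n) x₀).map_target hy
  rw [Function.comp_apply, TangentBundle.symmL_trivializationAt symm_mem,
    (extChartAt (𝓡 n) x₀).right_inv hy,
    ModelWithCorners.range_eq_univ, mfderivWithin_univ]
  rfl

theorem contDiffOn_metricMatrix_inv (x₀ : M) (i j : Fin n) :
    ContDiffOn ℝ ∞ (fun y => (metricMatrix g x₀ y)⁻¹ i j) (extChartAt (𝓡 n) x₀).target :=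
  contDiffOn_matrix_inv (contDiffOn_metricMatrix g x₀)
    (fun _ hy => isUnit_det_metricMatrix g hy) i j

theorem contDiffOn_christoffel (x₀ : M) (l j k : Fin n) :
    ContDiffOn ℝ ∞ (fun y => (christoffel g x₀ l j k y : ℂ)) (extChartAt (𝓡 n) x₀).target := by
  have partialDeriv_metric (a b c : Fin n) : ContDiffOn ℝ ∞
      (partialDeriv a fun z => metricMatrix g x₀ z b c) (extChartAt (𝓡 n) x₀).target :=
    contDiffOn_partialDeriv (isOpen_extChartAt_target x₀) (contDiffOn_metricMatrix g x₀ b c) a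
  refine Complex.ofRealCLM.contDiff.comp_contDiffOn
    (contDiffOn_const.mul (ContDiffOn.sum fun m _ => ?_))
  exact (contDiffOn_metricMatrix_inv g x₀ l m).mul
    (((partialDeriv_metric j m k).add (partialDeriv_metric k m j)).sub (partialDeriv_metric m j k))

theorem contDiffOn_covDiff (f : SmoothFun n M) (x₀ : M) (r : ℕ) (J : Fin r → Fin n) :
    ContDiffOn ℝ ∞ (covDiff g f x₀ r J) (extChartAt (𝓡 n) x₀).target := by
  induction r with
  | zero => exact contDiffOn_comp_extChartAt_symm f.contMDiff.contMDiffOn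
  | succ r ih =>
    refine (contDiffOn_partialDeriv (isOpen_extChartAt_target x₀) (ih _) _).sub ?_
    exact ContDiffOn.sum fun i _ => ContDiffOn.sum fun l _ =>
      (contDiffOn_christoffel g x₀ _ _ _).mul (ih _)

end

/-! ### Covariant differentials of powers -/

section

variable {n : ℕ} {s : Set (EuclideanSpace ℝ (Fin n))} {u q R : EuclideanSpace ℝ (Fin n) → ℂ}

theorem exists_partialDeriv_pow_mul_add_eq (hs : IsOpen s) (hu : ContDiffOn ℝ ∞ u s)
    (hq : ContDiffOn ℝ ∞ q s) (hR : ContDiffOn ℝ ∞ R s) (c : ℂ) (m : ℕ) (j : Fin n) :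
    ∃ R' : EuclideanSpace ℝ (Fin n) → ℂ, ContDiffOn ℝ ∞ R' s ∧ ∀ y ∈ s,
      partialDeriv j (fun z => c * (u z ^ (m + 1) * q z) + u z ^ (m + 2) * R z) y =
        c * (m + 1) * (u y ^ m * (partialDeriv j u y * q y)) + u y ^ (m + 1) * R' y := by
  refine ⟨fun y => c * partialDeriv j q y + (m + 2) * (partialDeriv j u y * R y) +
    u y * partialDeriv j R y, ?_, fun y hy => ?_⟩
  · exact ((contDiffOn_const.mul (contDiffOn_partialDeriv hs hq j)).add
      (contDiffOn_const.mul ((contDiffOn_partialDeriv hs hu j).mul hR))).add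
      (hu.mul (contDiffOn_partialDeriv hs hR j))
  · have differentiableAt {a : EuclideanSpace ℝ (Fin n) → ℂ} (ha : ContDiffOn ℝ ∞ a s) :
        DifferentiableAt ℝ a y :=
      (ha.contDiffAt (hs.mem_nhds hy)).differentiableAt (by simp)
    rw [partialDeriv_add (differentiableAt (contDiffOn_const.mul ((hu.pow _).mul hq)))
        (differentiableAt ((hu.pow _).mul hR)),
      partialDeriv_const_mul c (differentiableAt ((hu.pow _).mul hq)),
      partialDeriv_mul (differentiableAt (hu.pow _)) (differentiableAt hq),
      partialDeriv_mul (differentiableAt (hu.pow _)) (differentiableAt hR),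
      partialDeriv_pow (differentiableAt hu), partialDeriv_pow (differentiableAt hu)]
    push_cast
    ring

end

section

variable {n : ℕ} {M : Type*} [TopologicalSpace M] [ChartedSpace (EuclideanSpace ℝ (Fin n)) M]

local notation "𝔼" => EuclideanSpace ℝ (Fin n)

/-- The expression of a function in the chart at `x₀`. -/
def coordExpr (h : SmoothFun n M) (x₀ : M) (y : 𝔼) : ℂ := h ((extChartAt (𝓡 n) x₀).symm y)

theorem coordExpr_self (h : SmoothFun n M) (x : M) : coordExpr h x (extChartAt (𝓡 n) x x) = h x :=
  congrArg h (extChartAt_to_inv x)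

theorem coordExpr_eventuallyEq {h : SmoothFun n M} {x : M} {u : M → ℂ} (hu : h =ᶠ[𝓝 x] u) :
    coordExpr h x =ᶠ[𝓝 (extChartAt (𝓡 n) x x)] u ∘ (extChartAt (𝓡 n) x).symm := by
  have tendsto_symm := continuousAt_extChartAt_symm (I := 𝓡 n) x
  rw [ContinuousAt, extChartAt_to_inv] at tendsto_symm
  exact tendsto_symm.eventually hu

theorem coordExpr_eventuallyEq_of_comp_extChartAt {h : SmoothFun n M} {x : M} {u : 𝔼 → ℂ}
    (hu : h =ᶠ[𝓝 x] u ∘ extChartAt (𝓡 n) x) :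
    coordExpr h x =ᶠ[𝓝 (extChartAt (𝓡 n) x x)] u := by
  filter_upwards [coordExpr_eventuallyEq hu, extChartAt_target_mem_nhds (I := 𝓡 n) x]
    with y hy y_mem
  rw [hy, Function.comp_apply, Function.comp_apply, PartialEquiv.right_inv _ y_mem]

variable [IsManifold (𝓡 n) ∞ M]

theorem contDiffOn_coordExpr (h : SmoothFun n M) (x₀ : M) :
    ContDiffOn ℝ ∞ (coordExpr h x₀) (extChartAt (𝓡 n) x₀).target :=
  contDiffOn_comp_extChartAt_symm h.contMDiff.contMDiffOn

theorem exists_smoothFun_eventuallyEq [T2Space M] {u : M → ℂ} {s : Set M} (hs : IsOpen s)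
    (hu : ContMDiffOn (𝓡 n) 𝓘(ℝ, ℂ) ∞ u s) {x : M} (hx : x ∈ s) :
    ∃ h : SmoothFun n M, h =ᶠ[𝓝 x] u := by
  obtain ⟨ρ, -, tsupport_subset⟩ :=
    (SmoothBumpFunction.nhds_basis_tsupport (I := 𝓡 n) x).mem_iff.1 (hs.mem_nhds hx)
  refine ⟨⟨fun x' => ρ x' • u x', contMDiff_of_tsupport fun x' hx' => ?_⟩, ?_⟩
  · exact ρ.contMDiff.contMDiffAt.smul
      (hu.contMDiffAt (hs.mem_nhds (tsupport_subset (tsupport_smul_subset_left _ _ hx'))))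
  · filter_upwards [ρ.eventuallyEq_one] with x' hx'
    change ρ x' • u x' = u x'
    rw [hx', Pi.one_apply, one_smul]

theorem exists_smoothFun_eventuallyEq_comp_extChartAt [T2Space M] (x : M) {u : 𝔼 → ℂ}
    (hu : ContDiff ℝ ∞ u) :
    ∃ h : SmoothFun n M, h =ᶠ[𝓝 x] u ∘ extChartAt (𝓡 n) x :=
  exists_smoothFun_eventuallyEq (chartAt 𝔼 x).open_source
    (hu.contMDiff.comp_contMDiffOn contMDiffOn_extChartAt) (mem_chart_source 𝔼 x)

theorem exists_smoothFun_partialDeriv [T2Space M] (x : M) (p : 𝔼 →L[ℝ] ℝ) :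
    ∃ h : SmoothFun n M, h x = 0 ∧ ∀ j,
      partialDeriv j (coordExpr h x) (extChartAt (𝓡 n) x x) = p (EuclideanSpace.single j 1) := by
  let u : 𝔼 → ℂ := fun y => ((p y - p (extChartAt (𝓡 n) x x) : ℝ) : ℂ)
  have contDiff_u : ContDiff ℝ ∞ u :=
    Complex.ofRealCLM.contDiff.comp (p.contDiff.sub contDiff_const)
  obtain ⟨h, hu⟩ := exists_smoothFun_eventuallyEq_comp_extChartAt x contDiff_u
  have hasFDerivAt_u : HasFDerivAt u (Complex.ofRealCLM.comp p) (extChartAt (𝓡 n) x x) :=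
    Complex.ofRealCLM.hasFDerivAt.comp _ (p.hasFDerivAt.sub_const _)
  refine ⟨h, hu.self_of_nhds.trans (by simp [u]), fun j => ?_⟩
  rw [partialDeriv_congr (coordExpr_eventuallyEq_of_comp_extChartAt hu), partialDeriv,
    hasFDerivAt_u.fderiv]
  rfl

variable (g : PseudoRiemannianMetric n M)

theorem exists_covDiff_pow_eq (h : SmoothFun n M) (x₀ : M) {N r : ℕ} (hr : r ≤ N)
    (J : Fin r → Fin n) :
    ∃ R : 𝔼 → ℂ, ContDiffOn ℝ ∞ R (extChartAt (𝓡 n) x₀).target ∧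
      ∀ y ∈ (extChartAt (𝓡 n) x₀).target, covDiff g (h ^ N) x₀ r J y =
        (N.descFactorial r : ℂ) * (coordExpr h x₀ y ^ (N - r) *
          ∏ k, partialDeriv (J k) (coordExpr h x₀) y) + coordExpr h x₀ y ^ (N - r + 1) * R y := by
  have target_open := isOpen_extChartAt_target (I := 𝓡 n) x₀
  have hu := contDiffOn_coordExpr h x₀
  induction r with
  | zero => exact ⟨0, contDiffOn_const, fun y _ => by simp [covDiff, coordExpr]⟩
  | succ r ih =>
    obtain ⟨m, hm⟩ : ∃ m, N = m + 1 + r := ⟨N - r - 1, by lia⟩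
    choose R hR covDiff_eq using ih (by lia)
    simp only [show N - r = m + 1 by lia] at covDiff_eq
    set u := coordExpr h x₀
    set c : ℂ := (N.descFactorial r : ℂ) with hc
    have prod_smooth (J : Fin r → Fin n) : ContDiffOn ℝ ∞
        (fun y => ∏ k, partialDeriv (J k) u y) (extChartAt (𝓡 n) x₀).target :=
      contDiffOn_prod fun k _ => contDiffOn_partialDeriv target_open hu _
    obtain ⟨R', hR', partialDeriv_eq⟩ := exists_partialDeriv_pow_mul_add_eq target_open hu
      (prod_smooth (Fin.tail J)) (hR (Fin.tail J)) c m (J 0)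
    refine ⟨fun y => R' y - ∑ i : Fin r, ∑ l : Fin n,
      (christoffel g x₀ l (J 0) (Fin.tail J i) y : ℂ) *
        (c * ∏ k, partialDeriv (Function.update (Fin.tail J) i l k) u y +
          u y * R (Function.update (Fin.tail J) i l) y), ?_, fun y hy => ?_⟩
    · exact hR'.sub <| ContDiffOn.sum fun i _ => ContDiffOn.sum fun l _ =>
        (contDiffOn_christoffel g x₀ _ _ _).mul
          ((contDiffOn_const.mul (prod_smooth _)).add (hu.mul (hR _)))
    · have descFactorial_eq : (N.descFactorial (r + 1) : ℂ) = c * (m + 1) := by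
        rw [hc, Nat.descFactorial_succ, show N - r = m + 1 by lia]
        push_cast
        ring
      rw [covDiff, partialDeriv_congr
          (Filter.eventually_of_mem (target_open.mem_nhds hy) (covDiff_eq (Fin.tail J))),
        partialDeriv_eq y hy, show N - (r + 1) = m by lia, descFactorial_eq, Fin.prod_univ_succ,
        mul_sub, Finset.mul_sum, add_sub_assoc]
      congr 2
      simp only [Finset.mul_sum, covDiff_eq _ y hy]
      exact Finset.sum_congr rfl fun i _ => Finset.sum_congr rfl fun l _ => by ring

variable {h : SmoothFun n M} {x : M}

theorem covDiff_pow_of_lt (hx : h x = 0) {N r : ℕ} (hr : r < N) (J : Fin r → Fin n) :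
    covDiff g (h ^ N) x r J (extChartAt (𝓡 n) x x) = 0 := by
  obtain ⟨R, -, covDiff_eq⟩ := exists_covDiff_pow_eq g h x hr.le J
  rw [covDiff_eq _ (mem_extChartAt_target x), coordExpr_self, hx,
    zero_pow (Nat.sub_ne_zero_of_lt hr), zero_pow (Nat.succ_ne_zero _), zero_mul, zero_mul,
    mul_zero, add_zero]

theorem covDiff_pow_self (hx : h x = 0) (N : ℕ) (J : Fin N → Fin n) :
    covDiff g (h ^ N) x N J (extChartAt (𝓡 n) x x) =
      N.factorial * ∏ k, partialDeriv (J k) (coordExpr h x) (extChartAt (𝓡 n) x x) := by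
  obtain ⟨R, -, covDiff_eq⟩ := exists_covDiff_pow_eq g h x le_rfl J
  rw [covDiff_eq _ (mem_extChartAt_target x), coordExpr_self, hx]
  simp [Nat.descFactorial_self]

/-! ### A tensor field is determined by its quantization -/

theorem SymTensorField.quantized_eq_sum_covDiff (ħ : ℝ) {r : ℕ} (Φ : SymTensorField n M r)
    (f : SmoothFun n M) (x : M) :
    Φ.quantized g ħ f x = (-Complex.I * ħ) ^ r * ∑ J : Fin r → Fin n,
      Φ.val x (fun k => coordCovector x (J k) x) *
        covDiff g f x r J (extChartAt (𝓡 n) x x) := by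
  have sum_comp_perm (σ : Equiv.Perm (Fin r)) :
      ∑ J : Fin r → Fin n, Φ.val x (fun k => coordCovector x (J k) x) *
          covDiff g f x r (J ∘ σ) (extChartAt (𝓡 n) x x) =
        ∑ J : Fin r → Fin n, Φ.val x (fun k => coordCovector x (J k) x) *
          covDiff g f x r J (extChartAt (𝓡 n) x x) :=
    Fintype.sum_equiv (σ.symm.arrowCongr (Equiv.refl (Fin n))) _ _ fun J =>
      congrArg (· * _) (Φ.symm x σ fun k => coordCovector x (J k) x).symm
  have factorial_ne_zero : (r.factorial : ℂ) ≠ 0 := Nat.cast_ne_zero.2 r.factorial_ne_zero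
  rw [SymTensorField.quantized]
  congr 1
  simp only [symCovDiff, Finset.mul_sum, mul_left_comm _ (r.factorial : ℂ)⁻¹]
  rw [Finset.sum_comm]
  simp only [← Finset.mul_sum, sum_comp_perm, Finset.sum_const, Finset.card_univ,
    Fintype.card_perm, Fintype.card_fin, nsmul_eq_mul]
  rw [inv_mul_cancel_left₀ factorial_ne_zero]

theorem SymTensorField.quantized_pow_of_lt (ħ : ℝ) {r N : ℕ} (Φ : SymTensorField n M r)
    (hx : h x = 0) (hr : r < N) : Φ.quantized g ħ (h ^ N) x = 0 := by
  simp only [Φ.quantized_eq_sum_covDiff g, covDiff_pow_of_lt g hx hr, Finset.sum_const_zero,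
    mul_zero]

theorem SymTensorField.quantized_pow_self (ħ : ℝ) {N : ℕ} (Φ : SymTensorField n M N)
    (hx : h x = 0) :
    Φ.quantized g ħ (h ^ N) x = (-Complex.I * ħ) ^ N * (N.factorial *
      ∑ J : Fin N → Fin n, (∏ k, partialDeriv (J k) (coordExpr h x) (extChartAt (𝓡 n) x x)) *
        Φ.val x (fun k => coordCovector x (J k) x)) := by
  rw [Φ.quantized_eq_sum_covDiff g]
  congr 1
  rw [Finset.mul_sum]
  refine Finset.sum_congr rfl fun J _ => ?_
  rw [covDiff_pow_self g hx]
  ring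

theorem SymTensorField.quantized_pow_self_of_partialDeriv_eq (ħ : ℝ) {N : ℕ}
    (Φ : SymTensorField n M N) (hx : h x = 0) {p : 𝔼 →L[ℝ] ℝ}
    (hp : ∀ j, partialDeriv j (coordExpr h x) (extChartAt (𝓡 n) x x) =
      p (EuclideanSpace.single j 1)) :
    Φ.quantized g ħ (h ^ N) x = (-Complex.I * ħ) ^ N * (N.factorial * Φ.val x (fun _ => p)) := by
  have val_eq := Φ.val_comp_mfderiv p x x
  have mfderiv_self : mfderiv (𝓡 n) 𝓘(ℝ, 𝔼) (extChartAt (𝓡 n) x) x = ContinuousLinearMap.id ℝ 𝔼 :=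
    mfderiv_extChartAt_self
  rw [mfderiv_self] at val_eq
  rw [Φ.quantized_pow_self g ħ hx]
  simp only [hp, ← Complex.ofReal_prod]
  exact congrArg (fun z => (-Complex.I * ħ) ^ N * (N.factorial * z)) val_eq.symm

theorem SymTensorField.quantized_congr (ħ : ℝ) {r : ℕ} {Φ Ψ : SymTensorField n M r}
    (hΦ : Φ.val x = Ψ.val x) (f : SmoothFun n M) :
    Φ.quantized g ħ f x = Ψ.quantized g ħ f x := by
  rw [SymTensorField.quantized, SymTensorField.quantized, hΦ]

theorem TensorField.quantized_eq_sum (ħ : ℝ) (Φ : TensorField n M) {N : ℕ}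
    (hN : ∀ r, N < r → ∀ x, (Φ.comp r).val x = 0) (f : SmoothFun n M) (x : M) :
    Φ.quantized g ħ f x = ∑ r ∈ Finset.range (N + 1), (Φ.comp r).quantized g ħ f x := by
  refine finsum_eq_sum_of_support_subset _ fun r hr => ?_
  by_contra hr_range
  simp only [Finset.coe_range, Set.mem_Iio, not_lt] at hr_range
  exact hr (by simp [SymTensorField.quantized, hN r hr_range])

omit [IsManifold (𝓡 n) ∞ M] in
theorem SymTensorField.val_eq_of_diagonal {r : ℕ} {Φ Ψ : SymTensorField n M r}
    (diagonal : ∀ p, Φ.val x (fun _ => p) = Ψ.val x (fun _ => p)) : Φ.val x = Ψ.val x :=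
  sub_eq_zero.1 <| multilinearMap_eq_zero_of_diagonal
    (fun σ v => congrArg₂ (· - ·) (Φ.symm x σ v) (Ψ.symm x σ v))
    fun p => sub_eq_zero.2 (diagonal p)

omit [IsManifold (𝓡 n) ∞ M] in
theorem TensorField.exists_val_eq_zero_of_lt₂ (Φ Ψ : TensorField n M) :
    ∃ N, (∀ r, N < r → ∀ x, (Φ.comp r).val x = 0) ∧ ∀ r, N < r → ∀ x, (Ψ.comp r).val x = 0 := by
  obtain ⟨N₁, hΦ⟩ := Φ.finite
  obtain ⟨N₂, hΨ⟩ := Ψ.finite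
  exact ⟨max N₁ N₂, fun r hr => hΦ r (lt_of_le_of_lt (le_max_left _ _) hr),
    fun r hr => hΨ r (lt_of_le_of_lt (le_max_right _ _) hr)⟩

theorem TensorField.val_eq_of_quantized_eq_of_forall_gt [T2Space M] {ħ : ℝ} (hħ : ħ ≠ 0)
    {Φ Ψ : TensorField n M} (hΦ : ∀ f, Φ.quantized g ħ f x = Ψ.quantized g ħ f x) {r : ℕ}
    (higher : ∀ s, r < s → (Φ.comp s).val x = (Ψ.comp s).val x) :
    (Φ.comp r).val x = (Ψ.comp r).val x := by
  obtain ⟨N, hΦN, hΨN⟩ := Φ.exists_val_eq_zero_of_lt₂ Ψ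
  rcases lt_or_ge N r with hNr | hrN
  · rw [hΦN r hNr, hΨN r hNr]
  refine SymTensorField.val_eq_of_diagonal fun p => ?_
  obtain ⟨f, hfx, hfp⟩ := exists_smoothFun_partialDeriv x p
  have quantized_pow_eq := hΦ (f ^ r)
  have other_eq (s) (hs : s ∈ (Finset.range (N + 1)).erase r) :
      (Φ.comp s).quantized g ħ (f ^ r) x = (Ψ.comp s).quantized g ħ (f ^ r) x := by
    rcases lt_or_gt_of_ne (Finset.ne_of_mem_erase hs) with hsr | hsr
    · rw [SymTensorField.quantized_pow_of_lt g ħ _ hfx hsr,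
        SymTensorField.quantized_pow_of_lt g ħ _ hfx hsr]
    · exact SymTensorField.quantized_congr g ħ (higher s hsr) _
  have r_mem : r ∈ Finset.range (N + 1) := Finset.mem_range.2 (Nat.lt_succ_of_le hrN)
  rw [Φ.quantized_eq_sum g ħ hΦN, Ψ.quantized_eq_sum g ħ hΨN, ← Finset.add_sum_erase _ _ r_mem,
    ← Finset.add_sum_erase _ _ r_mem, Finset.sum_congr rfl other_eq, add_left_inj,
    SymTensorField.quantized_pow_self_of_partialDeriv_eq g ħ _ hfx hfp,
    SymTensorField.quantized_pow_self_of_partialDeriv_eq g ħ _ hfx hfp] at quantized_pow_eq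
  have iħ_ne_zero : -Complex.I * ħ ≠ 0 := by simp [hħ]
  exact mul_left_cancel₀ (Nat.cast_ne_zero.2 r.factorial_ne_zero)
    (mul_left_cancel₀ (pow_ne_zero r iħ_ne_zero) quantized_pow_eq)

theorem TensorField.val_eq_of_quantized_eq [T2Space M] {ħ : ℝ} (hħ : ħ ≠ 0)
    {Φ Ψ : TensorField n M} (hΦ : ∀ f, Φ.quantized g ħ f x = Ψ.quantized g ħ f x) (r : ℕ) :
    (Φ.comp r).val x = (Ψ.comp r).val x := by
  obtain ⟨N, hΦN, hΨN⟩ := Φ.exists_val_eq_zero_of_lt₂ Ψ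
  suffices eq_of_lt : ∀ k r, N < r + k → (Φ.comp r).val x = (Ψ.comp r).val x from
    eq_of_lt (N + 1) r (by lia)
  intro k
  induction k with
  | zero => exact fun r hr => (hΦN r hr x).trans (hΨN r hr x).symm
  | succ k ih =>
    exact fun r _ => TensorField.val_eq_of_quantized_eq_of_forall_gt g hħ hΦ
      fun s hs => ih s (by lia)

end

/-! ### The tensor field of the energy -/

section

variable {n : ℕ} {M : Type*} [TopologicalSpace M] [ChartedSpace (EuclideanSpace ℝ (Fin n)) M]

local notation "𝔼" => EuclideanSpace ℝ (Fin n)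

/-- A function, as a tensor field of order zero. -/
def scalarField (U : SmoothFun n M) : SymTensorField n M 0 where
  val x := MultilinearMap.constOfIsEmpty ℝ _ (U x)
  symm _ _ _ := rfl
  smooth _ _ := U.contMDiff.contMDiffOn

/-- A tensor field of order zero, as a function. -/
def SymTensorField.toSmoothFun (Φ : SymTensorField n M 0) : SmoothFun n M :=
  ⟨fun x => Φ.val x Fin.elim0, fun x =>
    ((Φ.smooth x Fin.elim0).contMDiffAt (chart_source_mem_nhds 𝔼 x)).congr_of_eventuallyEq
      (Filter.Eventually.of_forall fun x' => congrArg (Φ.val x') (Subsingleton.elim _ _))⟩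

theorem TensorField.toFun_zero (Φ : TensorField n M) (x : M) :
    Φ.toFun ⟨x, (0 : 𝔼 →L[ℝ] ℝ)⟩ = (Φ.comp 0).toSmoothFun x := by
  rw [TensorField.toFun, finsum_eq_single _ 0]
  · exact congrArg ((Φ.comp 0).val x) (Subsingleton.elim _ _)
  · intro s hs
    have : NeZero s := ⟨hs⟩
    exact ((Φ.comp s).val x).map_zero

theorem TensorField.val_eq_of_toFun_eq {Φ Ψ : TensorField n M} {x : M}
    (h : ∀ p : 𝔼 →L[ℝ] ℝ, Φ.toFun ⟨x, p⟩ = Ψ.toFun ⟨x, p⟩) (r : ℕ) :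
    (Φ.comp r).val x = (Ψ.comp r).val x := by
  obtain ⟨N, hΦN, hΨN⟩ := Φ.exists_val_eq_zero_of_lt₂ Ψ
  rcases lt_or_ge N r with hNr | hrN
  · rw [hΦN r hNr, hΨN r hNr]
  refine SymTensorField.val_eq_of_diagonal fun p => sub_eq_zero.1 ?_
  refine eq_zero_of_sum_pow_mul_eq_zero
    (Set.infinite_range_of_injective Complex.ofReal_injective) (N := N + 1)
    (a := fun r => (Φ.comp r).val x (fun _ => p) - (Ψ.comp r).val x (fun _ => p)) ?_
    (Nat.lt_succ_of_le hrN)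
  rintro _ ⟨t, rfl⟩
  have map_smul {s : ℕ} (φ : MultilinearMap ℝ (fun _ : Fin s => TangentSpace (𝓡 n) x →L[ℝ] ℝ) ℂ) :
      φ (fun _ => t • p) = (t : ℂ) ^ s * φ (fun _ => p) := by
    rw [φ.map_smul_univ (fun _ => t) (fun _ => p)]
    simp
  have toFun_eq := h (t • p)
  rw [Φ.toFun_eq_sum hΦN, Ψ.toFun_eq_sum hΨN, ← sub_eq_zero, ← Finset.sum_sub_distrib] at toFun_eq
  rw [← toFun_eq]
  exact Finset.sum_congr rfl fun s _ =>
    (mul_sub _ _ _).trans (congrArg₂ (· - ·) (map_smul _).symm (map_smul _).symm)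

theorem TensorField.toFun_congr {Φ Ψ : TensorField n M} {x : M}
    (h : ∀ r, (Φ.comp r).val x = (Ψ.comp r).val x) (p : 𝔼 →L[ℝ] ℝ) :
    Φ.toFun ⟨x, p⟩ = Ψ.toFun ⟨x, p⟩ :=
  finsum_congr fun r => by rw [h]

variable [IsManifold (𝓡 n) ∞ M] (g : PseudoRiemannianMetric n M)

theorem TensorField.quantized_congr (ħ : ℝ) {Φ Ψ : TensorField n M} {x : M}
    (h : ∀ r, (Φ.comp r).val x = (Ψ.comp r).val x) (f : SmoothFun n M) :
    Φ.quantized g ħ f x = Ψ.quantized g ħ f x :=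
  finsum_congr fun r => SymTensorField.quantized_congr g ħ (h r) f

/-- The symmetric bilinear form `½ g^{jk} p_j q_k` on the cotangent space, with complex values. -/
def kineticForm (x : M) : MultilinearMap ℝ (fun _ : Fin 2 => 𝔼 →L[ℝ] ℝ) ℂ where
  toFun α := ((1 / 2 * cometric g x (α 0) (α 1) : ℝ) : ℂ)
  map_update_add' := by
    intro _ α i p q
    fin_cases i <;> simp [mul_add]
  map_update_smul' := by
    intro _ α i c p
    fin_cases i <;> simp <;> ring

theorem kineticForm_comp_perm (x : M) (σ : Equiv.Perm (Fin 2)) (α : Fin 2 → 𝔼 →L[ℝ] ℝ) :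
    kineticForm g x (fun k => α (σ k)) = kineticForm g x α := by
  have eq_one_or_swap : ∀ σ : Equiv.Perm (Fin 2), σ = 1 ∨ σ = Equiv.swap 0 1 := by decide
  rcases eq_one_or_swap σ with rfl | rfl
  · rfl
  · simp [kineticForm, cometric_comm g x (α 1) (α 0)]

theorem kineticForm_coframe {x₀ x : M} (hx : x ∈ (extChartAt (𝓡 n) x₀).source) (J : Fin 2 → Fin n) :
    kineticForm g x (fun k => coframe x₀ (J k) x) =
      ((1 / 2 * (metricMatrix g x₀ (extChartAt (𝓡 n) x₀ x))⁻¹ (J 0) (J 1) : ℝ) : ℂ) := by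
  rw [← cometric_coframe g ((extChartAt (𝓡 n) x₀).map_source hx),
    (extChartAt (𝓡 n) x₀).left_inv hx]
  rfl

/-- The tensor field `½ g^{jk}` of the kinetic energy. -/
def kineticField : SymTensorField n M 2 where
  val x := kineticForm g x
  symm x σ α := kineticForm_comp_perm g x σ α
  smooth x₀ J := by
    rw [← extChartAt_source (𝓡 n)]
    have smooth_inv : ContDiffOn ℝ ∞
        (fun y => ((1 / 2 * (metricMatrix g x₀ y)⁻¹ (J 0) (J 1) : ℝ) : ℂ))
        (extChartAt (𝓡 n) x₀).target :=
      Complex.ofRealCLM.contDiff.comp_contDiffOn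
        (contDiffOn_const.mul (contDiffOn_metricMatrix_inv g x₀ _ _))
    exact (smooth_inv.contMDiffOn.comp (by rw [extChartAt_source]; exact contMDiffOn_extChartAt)
      (extChartAt (𝓡 n) x₀).mapsTo).congr fun x hx => kineticForm_coframe g hx J

theorem christoffel_symm (x₀ : M) (l j k : Fin n) (y : 𝔼) :
    christoffel g x₀ l j k y = christoffel g x₀ l k j y := by
  simp only [christoffel, metricMatrix_symm g x₀ _ j k]
  congr 1
  exact Finset.sum_congr rfl fun m _ => by ring

theorem covDiff_one (f : SmoothFun n M) (x₀ : M) (J : Fin 1 → Fin n) :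
    covDiff g f x₀ 1 J = partialDeriv (J 0) (coordExpr f x₀) := by
  funext y
  simp only [covDiff, Finset.univ_eq_empty, Finset.sum_empty, sub_zero]
  rfl

theorem covDiff_two (f : SmoothFun n M) (x₀ : M) (J : Fin 2 → Fin n) (y : 𝔼) :
    covDiff g f x₀ 2 J y = partialDeriv (J 0) (partialDeriv (J 1) (coordExpr f x₀)) y -
      ∑ l, (christoffel g x₀ l (J 0) (J 1) y : ℂ) * partialDeriv l (coordExpr f x₀) y := by
  rw [covDiff, covDiff_one, Fin.sum_univ_one]
  simp only [covDiff_one, Function.update_self]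
  rfl

theorem sum_inv_metricMatrix_mul_covDiff_two (f : SmoothFun n M) (x : M) :
    ∑ J : Fin 2 → Fin n, ((metricMatrix g x (extChartAt (𝓡 n) x x))⁻¹ (J 0) (J 1) : ℂ) *
      covDiff g f x 2 J (extChartAt (𝓡 n) x x) = laplacian g f x := by
  have inv_symm (j k : Fin n) : (metricMatrix g x (extChartAt (𝓡 n) x x))⁻¹ j k =
      (metricMatrix g x (extChartAt (𝓡 n) x x))⁻¹ k j := by
    rw [← cometric_coframe g (mem_extChartAt_target x), cometric_comm,
      cometric_coframe g (mem_extChartAt_target x)]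
  rw [← (finTwoArrowEquiv (Fin n)).symm.sum_comp, Fintype.sum_prod_type, Finset.sum_comm]
  refine Finset.sum_congr rfl fun j _ => Finset.sum_congr rfl fun k _ => ?_
  simp only [finTwoArrowEquiv_symm_apply, covDiff_two, Matrix.cons_val_zero, Matrix.cons_val_one,
    inv_symm k j, christoffel_symm g x _ k j]
  rfl

theorem kineticField_quantized (ħ : ℝ) (f : SmoothFun n M) (x : M) :
    (kineticField g).quantized g ħ f x = -((ħ : ℂ) ^ 2 / 2) * laplacian g f x := by
  have val_coframe (J : Fin 2 → Fin n) : (kineticField g).val x (fun k => coordCovector x (J k) x) =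
      1 / 2 * (metricMatrix g x (extChartAt (𝓡 n) x x))⁻¹ (J 0) (J 1) :=
    (kineticForm_coframe g (mem_extChartAt_source x) J).trans (by push_cast; rfl)
  simp only [SymTensorField.quantized_eq_sum_covDiff, val_coframe, mul_assoc, ← Finset.mul_sum,
    sum_inv_metricMatrix_mul_covDiff_two]
  rw [mul_pow, neg_sq, Complex.I_sq]
  ring

theorem scalarField_quantized (ħ : ℝ) (U f : SmoothFun n M) (x : M) :
    (scalarField U).quantized g ħ f x = U x * f x := by
  simp [SymTensorField.quantized, symCovDiff, covDiff, scalarField]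

/-- The tensor field `½ g^{jk} + U` of the energy with potential `U`. -/
def energyField (U : SmoothFun n M) : TensorField n M where
  comp
    | 0 => scalarField U
    | 2 => kineticField g
    | r => zeroTensorField.comp r
  finite := ⟨2, fun r hr x => by
    match r, hr with
    | r + 3, _ => rfl⟩

theorem energyField_comp_of_two_lt (U : SmoothFun n M) (r : ℕ) (hr : 2 < r) (x : M) :
    ((energyField g U).comp r).val x = 0 := by
  match r, hr with
  | r + 3, _ => rfl

theorem energyField_quantized (ħ : ℝ) (U f : SmoothFun n M) (x : M) :
    (energyField g U).quantized g ħ f x = -((ħ : ℂ) ^ 2 / 2) * laplacian g f x + U x * f x := by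
  have comp_zero : ((energyField g U).comp 0).quantized g ħ f x = U x * f x :=
    scalarField_quantized g ħ U f x
  have comp_one : ((energyField g U).comp 1).quantized g ħ f x = 0 := by
    have val_eq : ((energyField g U).comp 1).val x = 0 := rfl
    simp [SymTensorField.quantized, val_eq]
  have comp_two : ((energyField g U).comp 2).quantized g ħ f x =
      -((ħ : ℂ) ^ 2 / 2) * laplacian g f x := kineticField_quantized g ħ f x
  rw [TensorField.quantized_eq_sum g ħ _ (energyField_comp_of_two_lt g U), Finset.sum_range_succ,
    Finset.sum_range_succ, Finset.sum_range_one, comp_zero, comp_one, comp_two]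
  ring

theorem energyField_toFun (U : SmoothFun n M) (x : M) (p : 𝔼 →L[ℝ] ℝ) :
    (energyField g U).toFun ⟨x, p⟩ = U x + ((1 / 2 * cometric g x p p : ℝ) : ℂ) := by
  rw [TensorField.toFun_eq_sum _ (energyField_comp_of_two_lt g U), Finset.sum_range_succ,
    Finset.sum_range_succ, Finset.sum_range_one]
  change U x + 0 + ((1 / 2 * cometric g x p p : ℝ) : ℂ) = _
  rw [add_zero]

theorem isSecondOrderEquation_associatedField_iff [T2Space M] {ħ : ℝ} (hħ : ħ ≠ 0)
    {P : SmoothFun n M → SmoothFun n M}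
    (hP : ∃ Φ : TensorField n M, ∀ f x, P f x = Φ.quantized g ħ f x) :
    IsSecondOrderEquation g (associatedField g ħ P) ↔
      ∃ U : SmoothFun n M, ∀ (f : SmoothFun n M) (x : M),
        P f x = -((ħ : ℂ) ^ 2 / 2) * laplacian g f x + U x * f x := by
  have quantized_dequantized (f x) : P f x = (dequantized g ħ P).quantized g ħ f x := by
    rw [dequantized, dif_pos hP]
    exact hP.choose_spec f x
  refine (isSecondOrderEquation_hamiltonianField_iff g (dequantized g ħ P)).trans
    ⟨fun toFun_eq => ⟨((dequantized g ħ P).comp 0).toSmoothFun, fun f x => ?_⟩, ?_⟩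
  · rw [quantized_dequantized, ← energyField_quantized]
    exact TensorField.quantized_congr g ħ (TensorField.val_eq_of_toFun_eq fun p => by
      rw [toFun_eq, TensorField.toFun_zero, energyField_toFun]) f
  · rintro ⟨U, hU⟩ x p
    have val_eq := TensorField.val_eq_of_quantized_eq g (x := x) hħ (Φ := dequantized g ħ P)
      (Ψ := energyField g U) fun f => by rw [← quantized_dequantized, hU, energyField_quantized]
    rw [TensorField.toFun_congr val_eq, TensorField.toFun_congr val_eq, energyField_toFun,
      energyField_toFun]
    simp

end

/-! ### Hadamard's lemma -/

section

variable {E F : Type*} [NormedAddCommGroup E] [NormedSpace ℝ E]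
  [NormedAddCommGroup F] [NormedSpace ℝ F]

theorem hasFDerivAt_intervalIntegral_of_contDiff [FiniteDimensional ℝ E] {φ : E × ℝ → F}
    (hφ : ContDiff ℝ ∞ φ) (z₀ : E) :
    HasFDerivAt (fun z => ∫ t in (0 : ℝ)..1, φ (z, t))
      (∫ t in (0 : ℝ)..1, (fderiv ℝ φ (z₀, t)).comp (ContinuousLinearMap.inl ℝ E ℝ)) z₀ := by
  have continuous_partial :
      Continuous fun q : E × ℝ => (fderiv ℝ φ q).comp (ContinuousLinearMap.inl ℝ E ℝ) :=
    (hφ.continuous_fderiv (by simp)).clm_comp continuous_const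
  have continuous_slice (z : E) : Continuous fun t : ℝ => (z, t) := by fun_prop
  obtain ⟨C, hC⟩ := ((isCompact_closedBall z₀ 1).prod (isCompact_Icc (a := (0 : ℝ)) (b := 1)))
    |>.exists_bound_of_continuousOn continuous_partial.continuousOn
  refine intervalIntegral.hasFDerivAt_integral_of_dominated_of_fderiv_le
    (F := fun z t => φ (z, t))
    (F' := fun z t => (fderiv ℝ φ (z, t)).comp (ContinuousLinearMap.inl ℝ E ℝ))
    (bound := fun _ => C) (Metric.closedBall_mem_nhds z₀ one_pos) ?_ ?_ ?_ ?_ ?_ ?_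
  · exact Filter.Eventually.of_forall fun z =>
      (hφ.continuous.comp (continuous_slice z)).aestronglyMeasurable
  · exact (hφ.continuous.comp (continuous_slice z₀)).intervalIntegrable _ _
  · exact (continuous_partial.comp (continuous_slice z₀)).aestronglyMeasurable
  · refine Filter.Eventually.of_forall fun t ht z hz => hC (z, t) ⟨hz, ?_⟩
    rw [Set.uIoc_of_le zero_le_one] at ht
    exact Set.Ioc_subset_Icc_self ht
  · exact intervalIntegrable_const
  · refine Filter.Eventually.of_forall fun t _ z _ => ?_
    exact (hφ.differentiable (by simp) (z, t)).hasFDerivAt.comp z (hasFDerivAt_prodMk_left z t)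

theorem contDiff_intervalIntegral_of_contDiff [FiniteDimensional ℝ E] [CompleteSpace F]
    {φ : E × ℝ → F} (hφ : ContDiff ℝ ∞ φ) :
    ContDiff ℝ ∞ (fun z => ∫ t in (0 : ℝ)..1, φ (z, t)) := by
  refine contDiff_infty.2 fun k => ?_
  induction k generalizing φ with
  | zero =>
    exact contDiff_zero.2 <| continuous_iff_continuousAt.2 fun z =>
      (hasFDerivAt_intervalIntegral_of_contDiff hφ z).continuousAt
  | succ k ih =>
    refine (contDiff_succ_iff_fderiv_apply (n := (k : WithTop ℕ∞))).2 ⟨fun z =>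
      (hasFDerivAt_intervalIntegral_of_contDiff hφ z).differentiableAt, by simp, fun v => ?_⟩
    have fderiv_eq : (fun z => fderiv ℝ (fun z => ∫ t in (0 : ℝ)..1, φ (z, t)) z v) =
        fun z => ∫ t in (0 : ℝ)..1, fderiv ℝ φ (z, t) (v, 0) := by
      funext z
      have intervalIntegrable_partial : IntervalIntegrable
          (fun t : ℝ => (fderiv ℝ φ (z, t)).comp (ContinuousLinearMap.inl ℝ E ℝ))
          MeasureTheory.volume 0 1 :=
        (((hφ.continuous_fderiv (by simp)).comp (by fun_prop : Continuous fun t : ℝ => (z, t))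
          ).clm_comp continuous_const).intervalIntegrable _ _
      rw [(hasFDerivAt_intervalIntegral_of_contDiff hφ z).fderiv,
        ContinuousLinearMap.intervalIntegral_apply intervalIntegrable_partial]
      simp only [ContinuousLinearMap.comp_apply, ContinuousLinearMap.inl_apply]
    rw [fderiv_eq]
    exact ih ((hφ.fderiv_right (by simp)).clm_apply contDiff_const)

theorem exists_contDiff_eq_add_clm_apply_sub [FiniteDimensional ℝ E] [CompleteSpace F]
    {u : E → F} (hu : ContDiff ℝ ∞ u) (y₀ : E) :
    ∃ W : E → E →L[ℝ] F, ContDiff ℝ ∞ W ∧ W y₀ = fderiv ℝ u y₀ ∧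
      ∀ z, u z = u y₀ + W z (z - y₀) := by
  let segment : E × ℝ → E := fun q => y₀ + q.2 • (q.1 - y₀)
  have contDiff_segment : ContDiff ℝ ∞ segment := by fun_prop
  have contDiff_integrand : ContDiff ℝ ∞ fun q => fderiv ℝ u (segment q) :=
    (hu.fderiv_right (by simp)).comp contDiff_segment
  refine ⟨fun z => ∫ t in (0 : ℝ)..1, fderiv ℝ u (segment (z, t)),
    contDiff_intervalIntegral_of_contDiff contDiff_integrand, by simp [segment], fun z => ?_⟩
  have continuous_integrand : Continuous fun t : ℝ => fderiv ℝ u (segment (z, t)) :=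
    contDiff_integrand.continuous.comp (by fun_prop)
  have hasDerivAt_comp_segment (t : ℝ) :
      HasDerivAt (fun t => u (segment (z, t))) (fderiv ℝ u (segment (z, t)) (z - y₀)) t := by
    have hasDerivAt_segment : HasDerivAt (fun t => segment (z, t)) (z - y₀) t := by
      simpa [segment] using ((hasDerivAt_id t).smul_const (z - y₀)).const_add y₀
    exact (hu.differentiable (by simp) _).hasFDerivAt.comp_hasDerivAt t hasDerivAt_segment
  have integral_eq := intervalIntegral.integral_eq_sub_of_hasDerivAt
    (fun t _ => hasDerivAt_comp_segment t)
    ((continuous_integrand.clm_apply continuous_const).intervalIntegrable 0 1)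
  rw [ContinuousLinearMap.intervalIntegral_apply (continuous_integrand.intervalIntegrable _ _),
    integral_eq]
  simp [segment]

end

theorem exists_contDiff_eq_add_sum_sub_mul {n : ℕ} {u : EuclideanSpace ℝ (Fin n) → ℂ}
    (hu : ContDiff ℝ ∞ u) (y₀ : EuclideanSpace ℝ (Fin n)) :
    ∃ w : Fin n → EuclideanSpace ℝ (Fin n) → ℂ, (∀ j, ContDiff ℝ ∞ (w j)) ∧
      (∀ j, w j y₀ = partialDeriv j u y₀) ∧
      ∀ z, u z = u y₀ + ∑ j, ((z j - y₀ j : ℝ) : ℂ) * w j z := by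
  obtain ⟨W, hW, W_self, u_eq⟩ := exists_contDiff_eq_add_clm_apply_sub hu y₀
  refine ⟨fun j z => W z (EuclideanSpace.single j 1), fun j => hW.clm_apply contDiff_const,
    fun j => DFunLike.congr_fun W_self _, fun z => ?_⟩
  rw [u_eq]
  conv_lhs => rw [← (EuclideanSpace.basisFun (Fin n) ℝ).sum_repr (z - y₀), map_sum]
  simp

/-! ### Powers of the ideal of a point -/

section

variable {n : ℕ} {M : Type*} [TopologicalSpace M] [ChartedSpace (EuclideanSpace ℝ (Fin n)) M]
  {x : M}

local notation "𝔼" => EuclideanSpace ℝ (Fin n)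

theorem mem_vanishingIdeal {f : SmoothFun n M} : f ∈ vanishingIdeal x ↔ f x = 0 := Iff.rfl

theorem smoothFun_sum_apply {ι : Type*} (s : Finset ι) (f : ι → SmoothFun n M) (x : M) :
    (∑ i ∈ s, f i) x = ∑ i ∈ s, f i x :=
  map_sum (ContMDiffMap.evalRingHom x) f s

theorem prod_constFun {ι : Type*} (s : Finset ι) (c : ι → ℂ) :
    (∏ i ∈ s, constFun (c i) : SmoothFun n M) = constFun (∏ i ∈ s, c i) := by
  ext x
  exact (map_prod (ContMDiffMap.evalRingHom x) (fun i => constFun (c i)) s)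

theorem prod_sub_prod_mem_pow {A : Type*} [CommRing A] {I : Ideal A} {r : ℕ} {a b : Fin r → A}
    (ha : ∀ k, a k ∈ I) (hb : ∀ k, b k ∈ I) (hab : ∀ k, a k - b k ∈ I ^ 2) :
    ∏ k, a k - ∏ k, b k ∈ I ^ (r + 1) := by
  induction r with
  | zero => simp
  | succ r ih =>
    have tail_mem : ∏ k : Fin r, a k.succ ∈ I ^ r := by
      simpa only [Finset.prod_const, Finset.card_univ, Fintype.card_fin] using
        Ideal.prod_mem_prod (s := Finset.univ) (I := fun _ : Fin r => I) fun k _ => ha k.succ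
    have head_mem : (a 0 - b 0) * ∏ k : Fin r, a k.succ ∈ I ^ (r + 1 + 1) := by
      rw [show r + 1 + 1 = 2 + r by ring, pow_add]
      exact Ideal.mul_mem_mul (hab 0) tail_mem
    have tail_sub_mem : b 0 * (∏ k : Fin r, a k.succ - ∏ k : Fin r, b k.succ) ∈
        I ^ (r + 1 + 1) := by
      rw [pow_succ']
      exact Ideal.mul_mem_mul (hb 0) (ih (fun k => ha _) (fun k => hb _) fun k => hab _)
    rw [Fin.prod_univ_succ, Fin.prod_univ_succ]
    convert! Ideal.add_mem _ head_mem tail_sub_mem using 1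
    ring

variable [IsManifold (𝓡 n) ∞ M]

theorem exists_contDiff_comp_extChartAt_eventuallyEq (x : M) (h : SmoothFun n M) :
    ∃ u : 𝔼 → ℂ, ContDiff ℝ ∞ u ∧ h =ᶠ[𝓝 x] u ∘ extChartAt (𝓡 n) x := by
  obtain ⟨ε, hε, closedBall_subset⟩ :=
    Metric.nhds_basis_closedBall.mem_iff.1 (extChartAt_target_mem_nhds (I := 𝓡 n) x)
  let φ : ContDiffBump (extChartAt (𝓡 n) x x) := ⟨ε / 2, ε, half_pos hε, half_lt_self hε⟩
  have tsupport_subset : tsupport φ ⊆ (extChartAt (𝓡 n) x).target :=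
    φ.tsupport_eq.trans_subset closedBall_subset
  refine ⟨fun y => φ y • coordExpr h x y, (contMDiff_of_tsupport fun y hy => ?_).contDiff, ?_⟩
  · refine ContDiffAt.contMDiffAt ?_
    exact φ.contDiff.contDiffAt.smul ((contDiffOn_coordExpr h x).contDiffAt
      ((isOpen_extChartAt_target x).mem_nhds
        (tsupport_subset (tsupport_smul_subset_left _ _ hy))))
  · filter_upwards [(continuousAt_extChartAt (I := 𝓡 n) x).eventually φ.eventuallyEq_one,
      extChartAt_source_mem_nhds (I := 𝓡 n) x] with x' hφ hx'
    rw [Function.comp_apply, hφ, coordExpr, PartialEquiv.left_inv _ hx', Pi.one_apply, one_smul]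

variable [T2Space M]

theorem exists_smoothFun_mul_eq_zero {f : SmoothFun n M} (hf : f =ᶠ[𝓝 x] 0) :
    ∃ b : SmoothFun n M, b * f = 0 ∧ b x = 1 := by
  obtain ⟨ρ, -, tsupport_subset⟩ :=
    (SmoothBumpFunction.nhds_basis_tsupport (I := 𝓡 n) x).mem_iff.1 hf
  refine ⟨⟨fun x' => (ρ x' : ℂ), Complex.ofRealCLM.contDiff.comp_contMDiff ρ.contMDiff⟩, ?_, ?_⟩
  · ext x'
    change (ρ x' : ℂ) * f x' = 0
    by_cases hx' : ρ x' = 0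
    · rw [hx', Complex.ofReal_zero, zero_mul]
    · rw [show f x' = 0 from tsupport_subset (subset_tsupport _ hx'), mul_zero]
  · change (ρ x : ℂ) = 1
    rw [ρ.eq_one, Complex.ofReal_one]

theorem mem_vanishingIdeal_pow_of_eventuallyEq {f : SmoothFun n M} (hf : f =ᶠ[𝓝 x] 0) (k : ℕ) :
    f ∈ vanishingIdeal x ^ k := by
  obtain ⟨b, hb, hbx⟩ := exists_smoothFun_mul_eq_zero hf
  have eq_pow_mul : f = (1 - b) ^ k * f := by
    induction k with
    | zero => rw [pow_zero, one_mul]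
    | succ k ih => rwa [pow_succ, mul_assoc, sub_mul, hb, one_mul, sub_zero]
  rw [eq_pow_mul]
  exact Ideal.mul_mem_right _ _ (Ideal.pow_mem_pow (mem_vanishingIdeal.2 (by simp [hbx])) k)

theorem exists_centredCoord (x : M) (j : Fin n) :
    ∃ ξ : SmoothFun n M, ξ =ᶠ[𝓝 x]
      fun x' => ((extChartAt (𝓡 n) x x' j - extChartAt (𝓡 n) x x j : ℝ) : ℂ) :=
  exists_smoothFun_eventuallyEq_comp_extChartAt x
    (u := fun y => ((y j - extChartAt (𝓡 n) x x j : ℝ) : ℂ))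
    (Complex.ofRealCLM.contDiff.comp
      ((EuclideanSpace.proj j : 𝔼 →L[ℝ] ℝ).contDiff.sub contDiff_const))

/-- A global smooth function equal, near `x`, to the `j`-th coordinate of the chart at `x`
centred at `x`; it stands for that coordinate in computations modulo powers of `𝔪ₓ`. -/
def centredCoord (x : M) (j : Fin n) : SmoothFun n M := (exists_centredCoord x j).choose

theorem centredCoord_eventuallyEq (x : M) (j : Fin n) :
    centredCoord x j =ᶠ[𝓝 x]
      fun x' => ((extChartAt (𝓡 n) x x' j - extChartAt (𝓡 n) x x j : ℝ) : ℂ) :=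
  (exists_centredCoord x j).choose_spec

theorem centredCoord_mem_vanishingIdeal (x : M) (j : Fin n) :
    centredCoord x j ∈ vanishingIdeal x :=
  (centredCoord_eventuallyEq x j).self_of_nhds.trans (by simp)

theorem exists_sub_sum_mul_centredCoord_mem {h : SmoothFun n M} (hx : h ∈ vanishingIdeal x)
    (m : ℕ) :
    ∃ k : Fin n → SmoothFun n M,
      (∀ j, k j x = partialDeriv j (coordExpr h x) (extChartAt (𝓡 n) x x)) ∧
      h - ∑ j, k j * centredCoord x j ∈ vanishingIdeal x ^ m := by
  obtain ⟨u, hu, h_eq⟩ := exists_contDiff_comp_extChartAt_eventuallyEq x h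
  have u_zero : u (extChartAt (𝓡 n) x x) = 0 := h_eq.self_of_nhds.symm.trans hx
  obtain ⟨w, hw, w_self, u_eq_sum⟩ := exists_contDiff_eq_add_sum_sub_mul hu (extChartAt (𝓡 n) x x)
  choose k hk using fun j => exists_smoothFun_eventuallyEq_comp_extChartAt x (hw j)
  refine ⟨k, fun j => ?_, mem_vanishingIdeal_pow_of_eventuallyEq ?_ m⟩
  · rw [partialDeriv_congr (coordExpr_eventuallyEq_of_comp_extChartAt h_eq), ← w_self]
    exact (hk j).self_of_nhds
  · have hξ : ∀ᶠ x' in 𝓝 x, ∀ j, centredCoord x j x' =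
        ((extChartAt (𝓡 n) x x' j - extChartAt (𝓡 n) x x j : ℝ) : ℂ) :=
      Filter.eventually_all.2 (centredCoord_eventuallyEq x)
    filter_upwards [Filter.eventually_all.2 hk, hξ, h_eq] with x' hk' hξ' h_eq'
    change h x' - (∑ j, k j * centredCoord x j) x' = 0
    rw [smoothFun_sum_apply, h_eq', Function.comp_apply, u_eq_sum, u_zero, zero_add, sub_eq_zero]
    refine Finset.sum_congr rfl fun j _ => ?_
    change _ = k j x' * centredCoord x j x'
    rw [hk', hξ', mul_comm, Function.comp_apply]

theorem sub_sum_centredCoord_mem {h : SmoothFun n M} (hx : h ∈ vanishingIdeal x) :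
    h - ∑ j, constFun (partialDeriv j (coordExpr h x) (extChartAt (𝓡 n) x x)) * centredCoord x j ∈
      vanishingIdeal x ^ 2 := by
  obtain ⟨k, k_self, sub_mem⟩ := exists_sub_sum_mul_centredCoord_mem hx 2
  have eq_add : h - ∑ j, constFun (partialDeriv j (coordExpr h x) (extChartAt (𝓡 n) x x)) *
      centredCoord x j = (h - ∑ j, k j * centredCoord x j) +
        ∑ j, (k j - constFun (k j x)) * centredCoord x j := by
    simp only [k_self, sub_mul, Finset.sum_sub_distrib]
    ring
  rw [eq_add]
  refine Ideal.add_mem _ sub_mem (Ideal.sum_mem _ fun j _ => ?_)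
  rw [pow_two]
  exact Ideal.mul_mem_mul (sub_self (k j x)) (centredCoord_mem_vanishingIdeal x j)

end

/-! ### The action of a differential operator on products -/

namespace IsDiffOpOfOrder

variable {n : ℕ} {M : Type*} [TopologicalSpace M] [ChartedSpace (EuclideanSpace ℝ (Fin n)) M]
  {r : ℕ} {P : SmoothFun n M → SmoothFun n M} (hP : IsDiffOpOfOrder r P)

include hP

theorem map_sum {ι : Type*} (s : Finset ι) (f : ι → SmoothFun n M) :
    P (∑ i ∈ s, f i) = ∑ i ∈ s, P (f i) :=
  _root_.map_sum (AddMonoidHom.mk' P hP.map_add) f s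

theorem apply_eq_of_sub_mem {x : M} {f h : SmoothFun n M}
    (hfh : f - h ∈ vanishingIdeal x ^ (r + 1)) : P f x = P h x := by
  have map_sub : P (f - h) = P f - P h := _root_.map_sub (AddMonoidHom.mk' P hP.map_add) f h
  have sub_apply := mem_vanishingIdeal.1 (hP.map_pow x _ hfh)
  rw [map_sub] at sub_apply
  exact sub_eq_zero.1 sub_apply

theorem apply_prod [IsManifold (𝓡 n) ∞ M] [T2Space M] {x : M} {h : Fin r → SmoothFun n M}
    (hh : ∀ k, h k ∈ vanishingIdeal x) :
    P (∏ k, h k) x = ∑ J : Fin r → Fin n,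
      (∏ k, partialDeriv (J k) (coordExpr (h k) x) (extChartAt (𝓡 n) x x)) *
        P (∏ k, centredCoord x (J k)) x := by
  let linearPart (k : Fin r) : SmoothFun n M := ∑ j,
    constFun (partialDeriv j (coordExpr (h k) x) (extChartAt (𝓡 n) x x)) * centredCoord x j
  have linearPart_mem (k) : linearPart k ∈ vanishingIdeal x :=
    Ideal.sum_mem _ fun j _ => Ideal.mul_mem_left _ _ (centredCoord_mem_vanishingIdeal x j)
  rw [hP.apply_eq_of_sub_mem
      (prod_sub_prod_mem_pow hh linearPart_mem fun k => sub_sum_centredCoord_mem (hh k)),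
    Finset.prod_univ_sum]
  simp only [Finset.prod_mul_distrib, prod_constFun, Fintype.piFinset_univ, hP.map_sum,
    hP.map_const_mul, smoothFun_sum_apply]
  rfl

end IsDiffOpOfOrder

/-! ### Derivatives of matrix-valued functions -/

section

variable {n : ℕ}

local notation "𝔼" => EuclideanSpace ℝ (Fin n)

theorem partialDeriv_partialDeriv_comm {F : Type*} [NormedAddCommGroup F] [NormedSpace ℝ F]
    {h : 𝔼 → F} {y : 𝔼} (hh : ContDiffAt ℝ 2 h y) (j k : Fin n) :
    partialDeriv j (partialDeriv k h) y = partialDeriv k (partialDeriv j h) y := by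
  have second_derivative (j k : Fin n) : partialDeriv j (partialDeriv k h) y =
      fderiv ℝ (fderiv ℝ h) y (EuclideanSpace.single j 1) (EuclideanSpace.single k 1) := by
    have hd : DifferentiableAt ℝ (fderiv ℝ h) y :=
      (hh.fderiv_right (m := 1) (by norm_num)).differentiableAt (by simp)
    exact (DFunLike.congr_fun (hd.hasFDerivAt.clm_apply
      (hasFDerivAt_const (EuclideanSpace.single k (1 : ℝ) : 𝔼) y)).fderiv _).trans (by simp)
  rw [second_derivative, second_derivative]
  exact hh.isSymmSndFDerivAt (by simp) _ _

theorem partialDeriv_sum {F ι : Type*} [NormedAddCommGroup F] [NormedSpace ℝ F] {s : Finset ι}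
    {a : ι → 𝔼 → F} {y : 𝔼} (ha : ∀ i ∈ s, DifferentiableAt ℝ (a i) y) (j : Fin n) :
    partialDeriv j (fun z => ∑ i ∈ s, a i z) y = ∑ i ∈ s, partialDeriv j (a i) y := by
  simp only [partialDeriv, fderiv_fun_sum ha, _root_.sum_apply]

theorem partialDeriv_prod {𝔸 ι : Type*} [NormedCommRing 𝔸] [NormedAlgebra ℝ 𝔸] [DecidableEq ι]
    {s : Finset ι} {a : ι → 𝔼 → 𝔸} {y : 𝔼} (ha : ∀ i ∈ s, DifferentiableAt ℝ (a i) y) (j : Fin n) :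
    partialDeriv j (fun z => ∏ i ∈ s, a i z) y =
      ∑ i ∈ s, partialDeriv j (a i) y * ∏ k ∈ s.erase i, a k y := by
  simp only [partialDeriv, fderiv_finsetProd ha, _root_.sum_apply, _root_.smul_apply, smul_eq_mul,
    mul_comm]

theorem partialDeriv_ofReal {u : 𝔼 → ℝ} {y : 𝔼} (hu : DifferentiableAt ℝ u y) (j : Fin n) :
    partialDeriv j (fun z => (u z : ℂ)) y = partialDeriv j u y :=
  DFunLike.congr_fun (Complex.ofRealCLM.hasFDerivAt.comp y hu.hasFDerivAt).fderiv _

/-- The entrywise partial derivative `∂A/∂xᵏ` of a matrix-valued function. -/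
def matrixDeriv {ι κ F : Type*} [NormedAddCommGroup F] [NormedSpace ℝ F] (k : Fin n)
    (A : 𝔼 → Matrix ι κ F) (y : 𝔼) : Matrix ι κ F :=
  Matrix.of fun i j => partialDeriv k (fun z => A z i j) y

theorem matrixDeriv_mul {ι κ μ 𝔸 : Type*} [Fintype κ] [NormedCommRing 𝔸] [NormedAlgebra ℝ 𝔸]
    {A : 𝔼 → Matrix ι κ 𝔸} {B : 𝔼 → Matrix κ μ 𝔸} {y : 𝔼}
    (hA : ∀ i j, DifferentiableAt ℝ (fun z => A z i j) y)
    (hB : ∀ i j, DifferentiableAt ℝ (fun z => B z i j) y) (k : Fin n) :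
    matrixDeriv k (fun z => A z * B z) y =
      matrixDeriv k A y * B y + A y * matrixDeriv k B y := by
  ext i j
  simp only [matrixDeriv, Matrix.add_apply, Matrix.mul_apply, Matrix.of_apply,
    ← Finset.sum_add_distrib]
  rw [partialDeriv_sum fun l _ => (hA i l).fun_mul (hB l j)]
  exact Finset.sum_congr rfl fun l _ => partialDeriv_mul (hA i l) (hB l j) k

end

/-! ### Changes of coordinates -/

section

variable {n : ℕ} {M : Type*} [TopologicalSpace M] [ChartedSpace (EuclideanSpace ℝ (Fin n)) M]

local notation "𝔼" => EuclideanSpace ℝ (Fin n)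

/-- The domain, in the chart at `a`, of the change of coordinates to the chart at `b`. -/
def overlap (a b : M) : Set 𝔼 :=
  (extChartAt (𝓡 n) a).target ∩ (extChartAt (𝓡 n) a).symm ⁻¹' (extChartAt (𝓡 n) b).source

/-- The change of coordinates from the chart at `a` to the chart at `b`, meaningful on
`overlap a b`. -/
def transition (a b : M) (y : 𝔼) : 𝔼 := extChartAt (𝓡 n) b ((extChartAt (𝓡 n) a).symm y)

/-- The Jacobian matrix `∂x'ᵐ/∂xᵏ` of the change of coordinates from the chart at `a` to the chart
at `b`. -/
def jacobian (a b : M) (y : 𝔼) : Matrix (Fin n) (Fin n) ℝ :=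
  Matrix.of fun m k => partialDeriv k (fun z => transition a b z m) y

theorem isOpen_overlap (a b : M) : IsOpen (overlap (n := n) a b) :=
  (continuousOn_extChartAt_symm a).isOpen_inter_preimage (isOpen_extChartAt_target a)
    (isOpen_extChartAt_source b)

variable {a b : M} {y : EuclideanSpace ℝ (Fin n)}

theorem transition_mem_target (hy : y ∈ overlap a b) :
    transition a b y ∈ (extChartAt (𝓡 n) b).target :=
  (extChartAt (𝓡 n) b).map_source hy.2

theorem extChartAt_symm_transition (hy : y ∈ overlap a b) :
    (extChartAt (𝓡 n) b).symm (transition a b y) = (extChartAt (𝓡 n) a).symm y :=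
  (extChartAt (𝓡 n) b).left_inv hy.2

theorem differentiableAt_of_contDiffOn_overlap {F : Type*} [NormedAddCommGroup F]
    [NormedSpace ℝ F] {h : 𝔼 → F} (hh : ContDiffOn ℝ ∞ h (overlap a b)) (hy : y ∈ overlap a b) :
    DifferentiableAt ℝ h y :=
  (hh.contDiffAt ((isOpen_overlap a b).mem_nhds hy)).differentiableAt (by simp)

variable [IsManifold (𝓡 n) ∞ M]

theorem contDiffOn_transition (a b : M) :
    ContDiffOn ℝ ∞ (transition a b) (overlap (n := n) a b) :=
  contMDiffOn_iff_contDiffOn.1 <| contMDiffOn_extChartAt.comp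
    ((contMDiffOn_extChartAt_symm a).mono Set.inter_subset_left) fun _ hy => by simpa using hy.2

theorem contDiffOn_transition_apply (a b : M) (m : Fin n) :
    ContDiffOn ℝ ∞ (fun y => transition a b y m) (overlap (n := n) a b) :=
  (EuclideanSpace.proj m : 𝔼 →L[ℝ] ℝ).contDiff.comp_contDiffOn (contDiffOn_transition a b)

theorem contDiffOn_jacobian (a b : M) (m k : Fin n) :
    ContDiffOn ℝ ∞ (fun y => jacobian a b y m k) (overlap (n := n) a b) :=
  contDiffOn_partialDeriv (isOpen_overlap a b) (contDiffOn_transition_apply a b m) k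

theorem matrixDeriv_jacobian_comm (hy : y ∈ overlap a b) (m j k : Fin n) :
    matrixDeriv j (jacobian a b) y m k = matrixDeriv k (jacobian a b) y m j :=
  partialDeriv_partialDeriv_comm (((contDiffOn_transition_apply a b m).contDiffAt
    ((isOpen_overlap a b).mem_nhds hy)).of_le (WithTop.coe_le_coe.2 le_top)) j k

theorem contDiffOn_comp_transition {F : Type*} [NormedAddCommGroup F] [NormedSpace ℝ F]
    {h : 𝔼 → F} (hh : ContDiffOn ℝ ∞ h (extChartAt (𝓡 n) b).target) :
    ContDiffOn ℝ ∞ (fun y => h (transition a b y)) (overlap a b) :=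
  hh.comp (contDiffOn_transition a b) fun _ hy => transition_mem_target hy

theorem partialDeriv_comp_transition {F : Type*} [NormedAddCommGroup F] [NormedSpace ℝ F]
    (hy : y ∈ overlap a b) {h : 𝔼 → F} (hh : DifferentiableAt ℝ h (transition a b y)) (k : Fin n) :
    partialDeriv k (fun z => h (transition a b z)) y =
      ∑ q, jacobian a b y q k • partialDeriv q h (transition a b y) := by
  have hτ := (differentiableAt_of_contDiffOn_overlap (contDiffOn_transition a b) hy).hasFDerivAt
  have fderiv_single (q : Fin n) :
      fderiv ℝ (transition a b) y (EuclideanSpace.single k 1) q = jacobian a b y q k :=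
    (DFunLike.congr_fun ((EuclideanSpace.proj q : 𝔼 →L[ℝ] ℝ).hasFDerivAt.comp y hτ).fderiv _).symm
  refine (DFunLike.congr_fun (hh.hasFDerivAt.comp y hτ).fderiv _).trans ?_
  rw [ContinuousLinearMap.comp_apply,
    ← (EuclideanSpace.basisFun (Fin n) ℝ).sum_repr
      (fderiv ℝ (transition a b) y (EuclideanSpace.single k 1)), map_sum]
  simp [fderiv_single, partialDeriv]

theorem jacobian_eq_coframe_frame (hy : y ∈ overlap a b) (m k : Fin n) :
    jacobian a b y m k = coframe b m ((extChartAt (𝓡 n) a).symm y) (frame a k y) := by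
  have mfderiv_transition := mfderiv_comp (I := 𝓘(ℝ, 𝔼)) (I' := 𝓡 n) (I'' := 𝓘(ℝ, 𝔼)) y
    (mdifferentiableAt_extChartAt (x := b) (by simpa using hy.2))
    (mdifferentiableAt_extChartAt_symm hy.1)
  have hτ := differentiableAt_of_contDiffOn_overlap (contDiffOn_transition a b) hy
  rw [mfderiv_eq_fderiv] at mfderiv_transition
  exact (DFunLike.congr_fun
    ((EuclideanSpace.proj m : 𝔼 →L[ℝ] ℝ).hasFDerivAt.comp y hτ.hasFDerivAt).fderiv _).trans
    (congrArg (fun L : 𝔼 →L[ℝ] 𝔼 => L (EuclideanSpace.single k 1) m) mfderiv_transition)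

theorem frame_eq_sum (hy : y ∈ overlap a b) (k : Fin n) :
    frame a k y = ∑ m, jacobian a b y m k • frame b m (transition a b y) := by
  simp only [jacobian_eq_coframe_frame hy, ← extChartAt_symm_transition hy]
  exact (sum_coframe_smul_frame (transition_mem_target hy) _).symm

end

/-! ### The transformation law of the Christoffel symbols -/

section

/- Uniqueness of the Levi-Civita connection, with lowered index: `hE` is the vanishing of the
torsion, and the symmetric part of `E k` is prescribed by `∂ₖg`. -/
theorem eq_of_transpose_add_eq {ι R : Type*} [AddCommGroup R] [IsAddTorsionFree R]
    {E E' : ι → Matrix ι ι R} (hE : ∀ k i j, E k i j = E j i k) (hE' : ∀ k i j, E' k i j = E' j i k)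
    (h : ∀ k, (E k).transpose + E k = (E' k).transpose + E' k) : E = E' := by
  have h_apply (k i j : ι) : E k j i + E k i j = E' k j i + E' k i j :=
    congrFun (congrFun (h k) i) j
  -- Koszul's formula: `2 E k i j` is the alternating sum of the symmetric parts.
  have koszul (F : ι → Matrix ι ι R) (hF : ∀ k i j, F k i j = F j i k) (k i j : ι) :
      2 • F k i j =
        (F k j i + F k i j) + (F j k i + F j i k) - (F i j k + F i k j) := by
    rw [hF j i k, hF j k i, hF k j i]
    abel
  ext k i j
  refine nsmul_right_injective two_ne_zero ?_
  change 2 • E k i j = 2 • E' k i j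
  rw [koszul E hE, koszul E' hE', h_apply k i j, h_apply j i k, h_apply i k j]

variable {n : ℕ} {M : Type*} [TopologicalSpace M] [ChartedSpace (EuclideanSpace ℝ (Fin n)) M]
  [IsManifold (𝓡 n) ∞ M] (g : PseudoRiemannianMetric n M)

local notation "𝔼" => EuclideanSpace ℝ (Fin n)

/-- The matrix `(Γˡ_{kj})_{l,j}` of the Levi-Civita connection in the direction `∂/∂xᵏ`, in the
frame of the chart at `x₀`. -/
def connectionMatrix (x₀ : M) (k : Fin n) (y : 𝔼) : Matrix (Fin n) (Fin n) ℝ :=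
  Matrix.of fun l j => christoffel g x₀ l k j y

theorem transpose_metricMatrix (x₀ : M) (y : 𝔼) :
    (metricMatrix g x₀ y).transpose = metricMatrix g x₀ y :=
  Matrix.ext fun i j => metricMatrix_symm g x₀ y j i

theorem metricMatrix_mul_connectionMatrix {x₀ : M} {y : 𝔼}
    (hy : y ∈ (extChartAt (𝓡 n) x₀).target) (k i j : Fin n) :
    (metricMatrix g x₀ y * connectionMatrix g x₀ k y) i j =
      1 / 2 * (matrixDeriv k (metricMatrix g x₀) y i j + matrixDeriv j (metricMatrix g x₀) y i k
        - matrixDeriv i (metricMatrix g x₀) y k j) := by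
  let koszul : Matrix (Fin n) (Fin n) ℝ := Matrix.of fun i j =>
    matrixDeriv k (metricMatrix g x₀) y i j + matrixDeriv j (metricMatrix g x₀) y i k
      - matrixDeriv i (metricMatrix g x₀) y k j
  have connectionMatrix_eq : connectionMatrix g x₀ k y =
      (1 / 2 : ℝ) • ((metricMatrix g x₀ y)⁻¹ * koszul) := by
    ext l j
    rfl
  rw [connectionMatrix_eq, Matrix.mul_smul,
    Matrix.mul_nonsing_inv_cancel_left _ _ (isUnit_det_metricMatrix g hy)]
  rfl

theorem matrixDeriv_metricMatrix {x₀ : M} {y : 𝔼} (hy : y ∈ (extChartAt (𝓡 n) x₀).target)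
    (k : Fin n) :
    matrixDeriv k (metricMatrix g x₀) y =
      (metricMatrix g x₀ y * connectionMatrix g x₀ k y).transpose +
        metricMatrix g x₀ y * connectionMatrix g x₀ k y := by
  have matrixDeriv_symm (k i j : Fin n) :
      matrixDeriv k (metricMatrix g x₀) y i j = matrixDeriv k (metricMatrix g x₀) y j i := by
    simp only [matrixDeriv, Matrix.of_apply, metricMatrix_symm g x₀ _ i j]
  ext i j
  rw [Matrix.add_apply, Matrix.transpose_apply, metricMatrix_mul_connectionMatrix g hy,
    metricMatrix_mul_connectionMatrix g hy, matrixDeriv_symm k j i, matrixDeriv_symm i j k,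
    matrixDeriv_symm j k i]
  ring

variable {a b : M} {y : EuclideanSpace ℝ (Fin n)} (hy : y ∈ overlap a b)
include hy

theorem metricMatrix_eq_transpose_jacobian_mul :
    metricMatrix g a y =
      (jacobian a b y).transpose * (metricMatrix g b (transition a b y) * jacobian a b y) := by
  have metricMatrix_apply (c : M) (z : 𝔼) (i j : Fin n) : metricMatrix g c z i j =
      flat g ((extChartAt (𝓡 n) c).symm z) (frame c i z) (frame c j z) := rfl
  ext i j
  simp only [Matrix.mul_apply, Matrix.transpose_apply, metricMatrix_apply,
    extChartAt_symm_transition hy, frame_eq_sum hy, map_sum, _root_.sum_apply, map_smul,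
    _root_.smul_apply, smul_eq_mul, Finset.mul_sum]
  rw [Finset.sum_comm]
  exact Finset.sum_congr rfl fun m _ => Finset.sum_congr rfl fun l _ => by ring

omit g in
theorem matrixDeriv_comp_transition {ι κ : Type*} {A : 𝔼 → Matrix ι κ ℝ}
    (hA : ∀ i j, DifferentiableAt ℝ (fun z => A z i j) (transition a b y)) (k : Fin n) :
    matrixDeriv k (fun z => A (transition a b z)) y =
      ∑ q, jacobian a b y q k • matrixDeriv q A (transition a b y) := by
  ext i j
  rw [Matrix.sum_apply]
  exact partialDeriv_comp_transition hy (hA i j) k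

/-- The matrix of the Levi-Civita connection of the chart at `b` in the direction `∂/∂xᵏ` of the
chart at `a`. -/
def pulledConnectionMatrix (a b : M) (k : Fin n) (y : 𝔼) : Matrix (Fin n) (Fin n) ℝ :=
  ∑ q, jacobian a b y q k • connectionMatrix g b q (transition a b y)

theorem matrixDeriv_metricMatrix_transition (k : Fin n) :
    matrixDeriv k (fun z => metricMatrix g b (transition a b z)) y =
      (metricMatrix g b (transition a b y) * pulledConnectionMatrix g a b k y).transpose +
        metricMatrix g b (transition a b y) * pulledConnectionMatrix g a b k y := by
  have hτy := transition_mem_target hy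
  rw [matrixDeriv_comp_transition hy fun i j => ((contDiffOn_metricMatrix g b i j).contDiffAt
    ((isOpen_extChartAt_target b).mem_nhds hτy)).differentiableAt (by simp)]
  simp only [matrixDeriv_metricMatrix g hτy, pulledConnectionMatrix, Matrix.mul_sum,
    Matrix.mul_smul, Matrix.transpose_sum, Matrix.transpose_smul, smul_add,
    Finset.sum_add_distrib]

omit hy in
theorem pulledConnectionMatrix_mul_jacobian_apply (l j k : Fin n) :
    (pulledConnectionMatrix g a b k y * jacobian a b y) l j =
      ∑ q, ∑ m, jacobian a b y q k * jacobian a b y m j *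
        christoffel g b l q m (transition a b y) := by
  rw [pulledConnectionMatrix, Matrix.sum_mul, Matrix.sum_apply]
  refine Finset.sum_congr rfl fun q _ => ?_
  rw [Matrix.smul_mul, Matrix.smul_apply, Matrix.mul_apply, smul_eq_mul, Finset.mul_sum]
  refine Finset.sum_congr rfl fun m _ => ?_
  rw [connectionMatrix, Matrix.of_apply]
  ring

theorem matrixDeriv_jacobian_add_symm (l j k : Fin n) :
    (matrixDeriv k (jacobian a b) y + pulledConnectionMatrix g a b k y * jacobian a b y) l j =
      (matrixDeriv j (jacobian a b) y + pulledConnectionMatrix g a b j y * jacobian a b y) l k := by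
  rw [Matrix.add_apply, Matrix.add_apply, matrixDeriv_jacobian_comm hy l k j,
    pulledConnectionMatrix_mul_jacobian_apply, pulledConnectionMatrix_mul_jacobian_apply,
    Finset.sum_comm]
  congr 1
  refine Finset.sum_congr rfl fun m _ => Finset.sum_congr rfl fun q _ => ?_
  rw [christoffel_symm]
  ring

theorem matrixDeriv_metricMatrix_eq (k : Fin n) :
    let E := (jacobian a b y).transpose * (metricMatrix g b (transition a b y) *
      (matrixDeriv k (jacobian a b) y + pulledConnectionMatrix g a b k y * jacobian a b y))
    matrixDeriv k (metricMatrix g a) y = E.transpose + E := by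
  intro E
  have hJ (i j : Fin n) := differentiableAt_of_contDiffOn_overlap (contDiffOn_jacobian a b i j) hy
  have hG (i j : Fin n) := differentiableAt_of_contDiffOn_overlap
    (contDiffOn_comp_transition (contDiffOn_metricMatrix g b i j)) hy
  have hGJ (i j : Fin n) : DifferentiableAt ℝ
      (fun z => (metricMatrix g b (transition a b z) * jacobian a b z) i j) y := by
    simp only [Matrix.mul_apply]
    exact DifferentiableAt.fun_sum fun l _ => (hG i l).fun_mul (hJ l j)
  have matrixDeriv_congr : matrixDeriv k (metricMatrix g a) y = matrixDeriv k (fun z =>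
      (jacobian a b z).transpose * (metricMatrix g b (transition a b z) * jacobian a b z)) y := by
    ext i j
    refine partialDeriv_congr ?_ k
    filter_upwards [(isOpen_overlap a b).mem_nhds hy] with z hz
    rw [metricMatrix_eq_transpose_jacobian_mul g hz]
  have matrixDeriv_transpose : matrixDeriv k (fun z => (jacobian a b z).transpose) y =
      (matrixDeriv k (jacobian a b) y).transpose := rfl
  rw [matrixDeriv_congr, matrixDeriv_mul (A := fun z => (jacobian a b z).transpose)
    (fun i j => hJ j i) hGJ, matrixDeriv_mul hG hJ,
    matrixDeriv_transpose, matrixDeriv_metricMatrix_transition g hy]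
  simp only [E, Matrix.transpose_mul, Matrix.transpose_add, transpose_metricMatrix,
    Matrix.transpose_transpose, Matrix.mul_add, Matrix.add_mul, Matrix.mul_assoc]
  abel

theorem jacobian_mul_connectionMatrix (k : Fin n) :
    jacobian a b y * connectionMatrix g a k y =
      matrixDeriv k (jacobian a b) y + pulledConnectionMatrix g a b k y * jacobian a b y := by
  set J := jacobian a b y
  set G := metricMatrix g b (transition a b y)
  let C (k : Fin n) := matrixDeriv k (jacobian a b) y + pulledConnectionMatrix g a b k y * J
  have metricMatrix_eq : metricMatrix g a y = J.transpose * G * J :=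
    (metricMatrix_eq_transpose_jacobian_mul g hy).trans (Matrix.mul_assoc ..).symm
  have lowered_eq : (fun k => J.transpose * (G * C k)) =
      fun k => metricMatrix g a y * connectionMatrix g a k y := by
    refine eq_of_transpose_add_eq (fun k i j => ?_) (fun k i j => ?_) fun k => ?_
    · simp only [← Matrix.mul_assoc]
      rw [Matrix.mul_apply, Matrix.mul_apply]
      exact Finset.sum_congr rfl fun l _ =>
        congrArg (_ * ·) (matrixDeriv_jacobian_add_symm g hy l j k)
    · rw [Matrix.mul_apply, Matrix.mul_apply]
      exact Finset.sum_congr rfl fun l _ => congrArg (_ * ·) (christoffel_symm g a l k j y)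
    · rw [← matrixDeriv_metricMatrix g hy.1]
      exact (matrixDeriv_metricMatrix_eq g hy k).symm
  have isUnit_det : IsUnit (J.transpose * G).det := by
    have h := isUnit_det_metricMatrix g hy.1
    rw [metricMatrix_eq, Matrix.det_mul] at h
    exact isUnit_of_mul_isUnit_left h
  have cancel := congrFun lowered_eq k
  simp only [metricMatrix_eq, ← Matrix.mul_assoc] at cancel
  rw [Matrix.mul_assoc (J.transpose * G) J] at cancel
  exact ((Matrix.isUnit_iff_isUnit_det _).2 isUnit_det).mul_left_cancel cancel.symm

end

/-! ### Linear changes of the components of a covariant tensor -/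

section

variable {κ ι R : Type*} [Fintype κ] [DecidableEq κ] [Fintype ι] [CommSemiring R]

theorem sum_sum_update (i : κ) (T : (κ → ι) → ι → R) :
    ∑ K, ∑ l, T K l = ∑ K, ∑ l, T (Function.update K i l) (K i) := by
  have swap_involutive : Function.Involutive
      fun Kl : (κ → ι) × ι => (Function.update Kl.1 i Kl.2, Kl.1 i) := fun Kl => by simp
  simp only [← Fintype.sum_prod_type']
  exact (Equiv.sum_comp swap_involutive.toPerm fun Kl => T Kl.1 Kl.2).symm

omit [Fintype ι] in
theorem prod_erase_update (F : κ → ι → R) (K : κ → ι) (i : κ) (l : ι) :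
    ∏ k ∈ Finset.univ.erase i, F k (Function.update K i l k) =
      ∏ k ∈ Finset.univ.erase i, F k (K k) :=
  Finset.prod_congr rfl fun k hk => by
    rw [Function.update_of_ne (Finset.ne_of_mem_erase hk)]

/-- The `J`-component, after a linear change of frame with matrix `A`, of the covariant tensor with
components `S`. -/
def componentPullback (A : Matrix ι ι R) (J : κ → ι) : ((κ → ι) → R) →ₗ[R] R :=
  ∑ K, (∏ k, A (K k) (J k)) • LinearMap.proj K

theorem componentPullback_apply (A : Matrix ι ι R) (J : κ → ι) (S : (κ → ι) → R) :
    componentPullback A J S = ∑ K, (∏ k, A (K k) (J k)) * S K := by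
  simp [componentPullback]

/-- `componentPullback A J S` with the matrix used in the `i`-th slot as a separate variable. -/
def slotPullback (A : Matrix ι ι R) (J : κ → ι) (S : (κ → ι) → R) (i : κ) :
    Matrix ι ι R →ₗ[R] R :=
  ∑ K, ((∏ k ∈ Finset.univ.erase i, A (K k) (J k)) * S K) • Matrix.entryLinearMap R R (K i) (J i)

theorem slotPullback_apply (A : Matrix ι ι R) (J : κ → ι) (S : (κ → ι) → R) (i : κ)
    (B : Matrix ι ι R) :
    slotPullback A J S i B =
      ∑ K, (∏ k ∈ Finset.univ.erase i, A (K k) (J k)) * S K * B (K i) (J i) := by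
  simp [slotPullback]

theorem slotPullback_mul_left (Γ A : Matrix ι ι R) (J : κ → ι) (S : (κ → ι) → R) (i : κ) :
    slotPullback A J S i (Γ * A) =
      componentPullback A J fun K => ∑ l, Γ l (K i) * S (Function.update K i l) := by
  simp only [slotPullback_apply, componentPullback_apply, Matrix.mul_apply, Finset.mul_sum]
  rw [sum_sum_update i]
  refine Finset.sum_congr rfl fun K _ => Finset.sum_congr rfl fun l _ => ?_
  rw [← Finset.mul_prod_erase _ _ (Finset.mem_univ i),
    prod_erase_update (fun k m => A m (J k)) K i l, Function.update_self]
  ring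

theorem slotPullback_mul_right (A Γ : Matrix ι ι R) (J : κ → ι) (S : (κ → ι) → R) (i : κ) :
    slotPullback A J S i (A * Γ) =
      ∑ l, Γ l (J i) * componentPullback A (Function.update J i l) S := by
  simp only [slotPullback_apply, componentPullback_apply, Matrix.mul_apply, Finset.mul_sum]
  rw [Finset.sum_comm]
  refine Finset.sum_congr rfl fun l _ => Finset.sum_congr rfl fun K _ => ?_
  rw [← Finset.mul_prod_erase _ _ (Finset.mem_univ i),
    prod_erase_update (fun k m => A (K k) m) J i l, Function.update_self]
  ring

omit [DecidableEq κ] [Fintype κ] in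
theorem componentPullback_succ {r : ℕ} (A : Matrix ι ι R) (J : Fin (r + 1) → ι)
    (S : (Fin (r + 1) → ι) → R) :
    componentPullback A J S =
      ∑ p, A p (J 0) * componentPullback A (Fin.tail J) fun K => S (Fin.cons p K) := by
  simp only [componentPullback_apply, Finset.mul_sum]
  rw [← (Fin.consEquiv fun _ => ι).sum_comp, Fintype.sum_prod_type]
  refine Finset.sum_congr rfl fun p _ => Finset.sum_congr rfl fun K _ => ?_
  rw [Fin.prod_univ_succ, ← mul_assoc]
  rfl

end

section

variable {n : ℕ}

local notation "𝔼" => EuclideanSpace ℝ (Fin n)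

theorem partialDeriv_componentPullback {κ ι 𝔸 : Type*} [Fintype κ] [DecidableEq κ] [Fintype ι]
    [NormedCommRing 𝔸] [NormedAlgebra ℝ 𝔸] {A : 𝔼 → Matrix ι ι 𝔸} {S : (κ → ι) → 𝔼 → 𝔸} {y : 𝔼}
    (hA : ∀ i j, DifferentiableAt ℝ (fun z => A z i j) y)
    (hS : ∀ K, DifferentiableAt ℝ (S K) y) (J : κ → ι) (j : Fin n) :
    partialDeriv j (fun z => componentPullback (A z) J fun K => S K z) y =
      ∑ i, slotPullback (A y) J (fun K => S K y) i (matrixDeriv j A y) +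
        componentPullback (A y) J fun K => partialDeriv j (S K) y := by
  have hprod (K : κ → ι) : DifferentiableAt ℝ (fun z => ∏ k, A z (K k) (J k)) y :=
    (HasFDerivAt.finsetProd fun k _ => (hA (K k) (J k)).hasFDerivAt).differentiableAt
  simp only [componentPullback_apply, slotPullback_apply]
  rw [partialDeriv_sum fun K _ => (hprod K).fun_mul (hS K), Finset.sum_comm,
    ← Finset.sum_add_distrib]
  refine Finset.sum_congr rfl fun K _ => ?_
  rw [partialDeriv_mul (hprod K) (hS K), partialDeriv_prod fun k _ => hA (K k) (J k),
    Finset.sum_mul]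
  congr 1
  refine Finset.sum_congr rfl fun i _ => ?_
  rw [matrixDeriv, Matrix.of_apply]
  ring

end

/-! ### The quantized of a tensor field in an arbitrary chart -/

section

variable {n : ℕ} {M : Type*} [TopologicalSpace M] [ChartedSpace (EuclideanSpace ℝ (Fin n)) M]
  [IsManifold (𝓡 n) ∞ M] (g : PseudoRiemannianMetric n M)

local notation "𝔼" => EuclideanSpace ℝ (Fin n)

/-- The Jacobian matrix of a change of coordinates, acting on the components of complex tensors. -/
def complexJacobian (a b : M) (y : 𝔼) : Matrix (Fin n) (Fin n) ℂ :=
  Complex.ofRealHom.mapMatrix (jacobian a b y)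

omit [IsManifold (𝓡 n) ∞ M] in
theorem mem_overlap_self {x₀ x : M} (hx : x ∈ (extChartAt (𝓡 n) x₀).source) :
    extChartAt (𝓡 n) x x ∈ overlap (n := n) x x₀ :=
  ⟨mem_extChartAt_target x, by rwa [Set.mem_preimage, extChartAt_to_inv]⟩

omit [IsManifold (𝓡 n) ∞ M] in
theorem transition_self (x₀ x : M) :
    transition (n := n) x x₀ (extChartAt (𝓡 n) x x) = extChartAt (𝓡 n) x₀ x := by
  rw [transition, extChartAt_to_inv]

section

variable {a b : M} {y : EuclideanSpace ℝ (Fin n)} (hy : y ∈ overlap a b)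
include hy

theorem differentiableAt_complexJacobian (m k : Fin n) :
    DifferentiableAt ℝ (fun z => complexJacobian a b z m k) y :=
  Complex.ofRealCLM.differentiableAt.comp y
    (differentiableAt_of_contDiffOn_overlap (contDiffOn_jacobian a b m k) hy)

theorem matrixDeriv_complexJacobian (k : Fin n) :
    matrixDeriv k (complexJacobian a b) y =
      complexJacobian a b y * Complex.ofRealHom.mapMatrix (connectionMatrix g a k y) -
        Complex.ofRealHom.mapMatrix (pulledConnectionMatrix g a b k y) * complexJacobian a b y := by
  have matrixDeriv_ofReal : matrixDeriv k (complexJacobian a b) y =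
      Complex.ofRealHom.mapMatrix (matrixDeriv k (jacobian a b) y) := by
    ext i j
    exact partialDeriv_ofReal
      (differentiableAt_of_contDiffOn_overlap (contDiffOn_jacobian a b i j) hy) k
  rw [complexJacobian, ← map_mul, ← map_mul, ← map_sub, jacobian_mul_connectionMatrix g hy,
    add_sub_cancel_right, ← matrixDeriv_ofReal]

theorem differentiableAt_covDiff_transition (f : SmoothFun n M) (r : ℕ) (K : Fin r → Fin n) :
    DifferentiableAt ℝ (covDiff g f b r K) (transition a b y) :=
  ((contDiffOn_covDiff g f b r K).contDiffAt
    ((isOpen_extChartAt_target b).mem_nhds (transition_mem_target hy))).differentiableAt (by simp)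

omit hy in
theorem mapMatrix_pulledConnectionMatrix_apply (k l j : Fin n) :
    Complex.ofRealHom.mapMatrix (pulledConnectionMatrix g a b k y) l j =
      ∑ q, complexJacobian a b y q k * christoffel g b l q j (transition a b y) := by
  rw [pulledConnectionMatrix, map_sum, Matrix.sum_apply]
  exact Finset.sum_congr rfl fun q _ => map_mul Complex.ofRealHom _ _

theorem componentPullback_covDiff_succ (f : SmoothFun n M) (r : ℕ) (J : Fin (r + 1) → Fin n) :
    componentPullback (complexJacobian a b y) J
        (fun K => covDiff g f b (r + 1) K (transition a b y)) =
      (componentPullback (complexJacobian a b y) (Fin.tail J) fun K =>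
        partialDeriv (J 0) (fun z => covDiff g f b r K (transition a b z)) y) -
      ∑ i, componentPullback (complexJacobian a b y) (Fin.tail J) fun K =>
        ∑ l, Complex.ofRealHom.mapMatrix (pulledConnectionMatrix g a b (J 0) y) l (K i) *
          covDiff g f b r (Function.update K i l) (transition a b y) := by
  rw [← map_sum, ← map_sub, componentPullback_succ]
  simp only [← smul_eq_mul (α := ℂ), ← map_smul, ← map_sum]
  congr 1
  ext K
  rw [Pi.sub_apply, Finset.sum_apply, Finset.sum_apply,
    partialDeriv_comp_transition hy (differentiableAt_covDiff_transition g hy f r K)]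
  simp only [Pi.smul_apply, covDiff, Fin.cons_zero, Fin.tail_cons, smul_sub,
    Finset.sum_sub_distrib, mapMatrix_pulledConnectionMatrix_apply, Finset.sum_smul,
    Finset.smul_sum, ← smul_eq_mul (α := ℂ), smul_smul]
  congr 1
  rw [Finset.sum_comm]
  exact Finset.sum_congr rfl fun i _ => Finset.sum_comm

theorem covDiff_eq_componentPullback (f : SmoothFun n M) (r : ℕ) (J : Fin r → Fin n) :
    covDiff g f a r J y = componentPullback (complexJacobian a b y) J
      fun K => covDiff g f b r K (transition a b y) := by
  induction r generalizing y with
  | zero =>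
    simp only [componentPullback_apply, Finset.univ_eq_empty, Finset.prod_empty, one_mul,
      Finset.univ_unique, Finset.sum_singleton, covDiff, extChartAt_symm_transition hy]
  | succ r ih =>
    have covDiff_eventuallyEq : covDiff g f a r (Fin.tail J) =ᶠ[𝓝 y] fun z =>
        componentPullback (complexJacobian a b z) (Fin.tail J)
          fun K => covDiff g f b r K (transition a b z) := by
      filter_upwards [(isOpen_overlap a b).mem_nhds hy] with z hz
      exact ih hz _
    have hS (K : Fin r → Fin n) :=
      differentiableAt_of_contDiffOn_overlap
        (contDiffOn_comp_transition (a := a) (contDiffOn_covDiff g f b r K)) hy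
    have sum_christoffel (i : Fin r) :
        ∑ l, (christoffel g a l (J 0) (Fin.tail J i) y : ℂ) *
            covDiff g f a r (Function.update (Fin.tail J) i l) y =
          slotPullback (complexJacobian a b y) (Fin.tail J)
            (fun K => covDiff g f b r K (transition a b y)) i
            (complexJacobian a b y *
              Complex.ofRealHom.mapMatrix (connectionMatrix g a (J 0) y)) := by
      simp only [ih hy, slotPullback_mul_right]
      rfl
    rw [componentPullback_covDiff_succ g hy, covDiff, partialDeriv_congr covDiff_eventuallyEq,
      partialDeriv_componentPullback (differentiableAt_complexJacobian hy) hS]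
    simp only [sum_christoffel, matrixDeriv_complexJacobian g hy, map_sub, slotPullback_mul_left,
      Finset.sum_sub_distrib]
    ring

end

theorem coframe_single {x₀ x : M} (hx : x ∈ (extChartAt (𝓡 n) x₀).source) (m k : Fin n) :
    coframe x₀ m x (EuclideanSpace.single k 1) = jacobian x x₀ (extChartAt (𝓡 n) x x) m k := by
  have frame_self : frame x k (extChartAt (𝓡 n) x x) = EuclideanSpace.single k 1 :=
    DFunLike.congr_fun (mfderiv_extChartAt_symm_self (I := 𝓡 n) (x₀ := x)) _
  rw [jacobian_eq_coframe_frame (mem_overlap_self hx), extChartAt_to_inv, frame_self]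

theorem coframe_eq_sum {x₀ x : M} (hx : x ∈ (extChartAt (𝓡 n) x₀).source) (m : Fin n) :
    coframe x₀ m x = ∑ k, jacobian x x₀ (extChartAt (𝓡 n) x x) m k • coframe x k x := by
  have coframe_self (k : Fin n) : coframe x k x = EuclideanSpace.proj k := coordCovector_self x k
  simp only [← coframe_single hx, coframe_self]
  exact covector_eq_sum _

theorem SymTensorField.quantized_eq_of_mem_source (ħ : ℝ) {r : ℕ} (Φ : SymTensorField n M r)
    (f : SmoothFun n M) {x₀ x : M} (hx : x ∈ (extChartAt (𝓡 n) x₀).source) :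
    Φ.quantized g ħ f x = (-Complex.I * ħ) ^ r *
      ∑ K : Fin r → Fin n, Φ.val x (fun k => coordCovector x₀ (K k) x) *
        covDiff g f x₀ r K (extChartAt (𝓡 n) x₀ x) := by
  have map_coframe (φ : MultilinearMap ℝ (fun _ : Fin r => 𝔼 →L[ℝ] ℝ) ℂ) (K : Fin r → Fin n) :
      φ (fun k => coframe x₀ (K k) x) = ∑ J : Fin r → Fin n,
        (∏ k, complexJacobian x x₀ (extChartAt (𝓡 n) x x) (K k) (J k)) *
          φ (fun k => coframe x (J k) x) := by
    simp only [coframe_eq_sum hx, MultilinearMap.map_sum, MultilinearMap.map_smul_univ,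
      Complex.real_smul, Complex.ofReal_prod]
    rfl
  rw [Φ.quantized_eq_sum_covDiff g]
  simp only [covDiff_eq_componentPullback g (mem_overlap_self hx), componentPullback_apply,
    transition_self, Finset.mul_sum]
  rw [Finset.sum_comm]
  refine Finset.sum_congr rfl fun K _ => ?_
  refine Eq.trans ?_ (congrArg (fun z : ℂ => (-Complex.I * ħ) ^ r *
    (z * covDiff g f x₀ r K (extChartAt (𝓡 n) x₀ x))) (map_coframe (Φ.val x) K).symm)
  rw [Finset.sum_mul, Finset.mul_sum]
  exact Finset.sum_congr rfl fun J _ => congrArg ((-Complex.I * ħ) ^ r * ·)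
    ((mul_left_comm _ _ _).trans (mul_assoc _ _ _).symm)

theorem SymTensorField.contMDiff_quantized (ħ : ℝ) {r : ℕ} (Φ : SymTensorField n M r)
    (f : SmoothFun n M) : ContMDiff (𝓡 n) 𝓘(ℝ, ℂ) ∞ (Φ.quantized g ħ f) := by
  intro x₀
  have source_mem : (chartAt 𝔼 x₀).source ∈ 𝓝 x₀ := chart_source_mem_nhds 𝔼 x₀
  refine ContMDiffAt.congr_of_eventuallyEq ?_ (Filter.eventually_of_mem source_mem fun x hx =>
    Φ.quantized_eq_of_mem_source g ħ f (x₀ := x₀) (by simpa using hx))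
  refine contMDiffAt_const.mul (contMDiffAt_finsetSum fun K _ =>
    ((Φ.smooth x₀ K).contMDiffAt source_mem).mul ?_)
  exact ((contDiffOn_covDiff g f x₀ r K).contMDiffOn.comp (contMDiffOn_extChartAt (x := x₀))
    fun x hx => (extChartAt (𝓡 n) x₀).map_source (by simpa using hx)).contMDiffAt source_mem

end

/-! ### Linearity of quantization -/

section

variable {n : ℕ} {M : Type*} [TopologicalSpace M] [ChartedSpace (EuclideanSpace ℝ (Fin n)) M]
  [IsManifold (𝓡 n) ∞ M] (g : PseudoRiemannianMetric n M)

local notation "𝔼" => EuclideanSpace ℝ (Fin n)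

theorem differentiableAt_covDiff (f : SmoothFun n M) (x₀ : M) (r : ℕ) (J : Fin r → Fin n) {y : 𝔼}
    (hy : y ∈ (extChartAt (𝓡 n) x₀).target) : DifferentiableAt ℝ (covDiff g f x₀ r J) y :=
  ((contDiffOn_covDiff g f x₀ r J).contDiffAt
    ((isOpen_extChartAt_target x₀).mem_nhds hy)).differentiableAt (by simp)

theorem covDiff_add (f h : SmoothFun n M) (x₀ : M) (r : ℕ) (J : Fin r → Fin n) {y : 𝔼}
    (hy : y ∈ (extChartAt (𝓡 n) x₀).target) :
    covDiff g (f + h) x₀ r J y = covDiff g f x₀ r J y + covDiff g h x₀ r J y := by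
  induction r generalizing y with
  | zero => rfl
  | succ r ih =>
    have eventuallyEq : covDiff g (f + h) x₀ r (Fin.tail J) =ᶠ[𝓝 y]
        fun z => covDiff g f x₀ r (Fin.tail J) z + covDiff g h x₀ r (Fin.tail J) z :=
      Filter.eventually_of_mem ((isOpen_extChartAt_target x₀).mem_nhds hy) fun z hz => ih _ hz
    rw [covDiff, partialDeriv_congr eventuallyEq,
      partialDeriv_add (differentiableAt_covDiff g f x₀ r _ hy)
        (differentiableAt_covDiff g h x₀ r _ hy)]
    simp only [covDiff, ih _ hy, mul_add, Finset.sum_add_distrib]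
    ring

theorem covDiff_const_mul (c : ℂ) (f : SmoothFun n M) (x₀ : M) (r : ℕ) (J : Fin r → Fin n) {y : 𝔼}
    (hy : y ∈ (extChartAt (𝓡 n) x₀).target) :
    covDiff g ((constFun c : SmoothFun n M) * f) x₀ r J y = c * covDiff g f x₀ r J y := by
  induction r generalizing y with
  | zero => rfl
  | succ r ih =>
    have eventuallyEq : covDiff g ((constFun c : SmoothFun n M) * f) x₀ r (Fin.tail J) =ᶠ[𝓝 y]
        fun z => c * covDiff g f x₀ r (Fin.tail J) z :=
      Filter.eventually_of_mem ((isOpen_extChartAt_target x₀).mem_nhds hy) fun z hz => ih _ hz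
    rw [covDiff, partialDeriv_congr eventuallyEq,
      partialDeriv_const_mul c (differentiableAt_covDiff g f x₀ r _ hy)]
    simp only [covDiff, ih _ hy, mul_sub, Finset.mul_sum, mul_left_comm c]

theorem SymTensorField.quantized_add (ħ : ℝ) {r : ℕ} (Φ : SymTensorField n M r)
    (f h : SmoothFun n M) (x : M) :
    Φ.quantized g ħ (f + h) x = Φ.quantized g ħ f x + Φ.quantized g ħ h x := by
  simp only [Φ.quantized_eq_sum_covDiff g, covDiff_add g f h x r _ (mem_extChartAt_target x),
    mul_add, Finset.sum_add_distrib]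

theorem SymTensorField.quantized_const_mul (ħ : ℝ) {r : ℕ} (Φ : SymTensorField n M r) (c : ℂ)
    (f : SmoothFun n M) (x : M) :
    Φ.quantized g ħ ((constFun c : SmoothFun n M) * f) x = c * Φ.quantized g ħ f x := by
  simp only [Φ.quantized_eq_sum_covDiff g, covDiff_const_mul g c f x r _ (mem_extChartAt_target x),
    mul_left_comm _ c, ← Finset.mul_sum]

end

/-! ### The principal symbol of a differential operator -/

section

variable {n : ℕ} {M : Type*} [TopologicalSpace M] [T2Space M]
  [ChartedSpace (EuclideanSpace ℝ (Fin n)) M] [IsManifold (𝓡 n) ∞ M]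

local notation "𝔼" => EuclideanSpace ℝ (Fin n)

omit [T2Space M] in
theorem partialDeriv_coordExpr_eq_jacobian {h : SmoothFun n M} {x₀ x : M} {m : Fin n} {c : ℂ}
    (hx : x ∈ (extChartAt (𝓡 n) x₀).source)
    (hh : h =ᶠ[𝓝 x] fun x' => (extChartAt (𝓡 n) x₀ x' m : ℂ) - c) (j : Fin n) :
    partialDeriv j (coordExpr h x) (extChartAt (𝓡 n) x x) =
      (jacobian x x₀ (extChartAt (𝓡 n) x x) m j : ℂ) := by
  have differentiableAt_transition := differentiableAt_of_contDiffOn_overlap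
    (contDiffOn_transition_apply x x₀ m) (mem_overlap_self hx)
  rw [partialDeriv_congr (coordExpr_eventuallyEq hh)]
  refine Eq.trans ?_ (partialDeriv_ofReal differentiableAt_transition j)
  exact congrArg (fun L : 𝔼 →L[ℝ] ℂ => L (EuclideanSpace.single j 1))
    (fderiv_sub_const (f := fun z => (transition x x₀ z m : ℂ)) c)

/-- The principal symbol at `x` of a differential operator of order `r`, multiplied by `r!` and
without the powers of `-iħ`: its components are the values of the operator at the products of
coordinate functions vanishing at `x`. -/
def symbolForm (P : SmoothFun n M → SmoothFun n M) (r : ℕ) (x : M) :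
    MultilinearMap ℝ (fun _ : Fin r => 𝔼 →L[ℝ] ℝ) ℂ :=
  ∑ J : Fin r → Fin n, P (∏ k, centredCoord x (J k)) x •
    (MultilinearMap.mkPiAlgebra ℝ (Fin r) ℂ).compLinearMap fun k =>
      Complex.ofRealCLM.toLinearMap ∘ₗ
        (ContinuousLinearMap.apply ℝ ℝ (EuclideanSpace.single (J k) (1 : ℝ) : 𝔼)).toLinearMap

theorem symbolForm_apply (P : SmoothFun n M → SmoothFun n M) (r : ℕ) (x : M)
    (α : Fin r → 𝔼 →L[ℝ] ℝ) :
    symbolForm P r x α = ∑ J : Fin r → Fin n,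
      (∏ k, (α k (EuclideanSpace.single (J k) 1) : ℂ)) * P (∏ k, centredCoord x (J k)) x := by
  simp [symbolForm, mul_comm]

theorem symbolForm_symm (P : SmoothFun n M → SmoothFun n M) (r : ℕ) (x : M)
    (σ : Equiv.Perm (Fin r)) (α : Fin r → 𝔼 →L[ℝ] ℝ) :
    symbolForm P r x (fun k => α (σ k)) = symbolForm P r x α := by
  rw [symbolForm_apply, symbolForm_apply,
    ← (Equiv.arrowCongr σ.symm (Equiv.refl (Fin n))).sum_comp]
  refine Finset.sum_congr rfl fun J _ => congrArg₂ (· * ·) ?_ (congrArg (fun f => P f x) ?_)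
  · exact Equiv.prod_comp σ fun k => (α k (EuclideanSpace.single (J k) 1) : ℂ)
  · exact Equiv.prod_comp σ fun k => centredCoord x (J k)

theorem symbolForm_proj (P : SmoothFun n M → SmoothFun n M) (r : ℕ) (x : M)
    (J : Fin r → Fin n) :
    symbolForm P r x (fun k => EuclideanSpace.proj (J k)) = P (∏ k, centredCoord x (J k)) x := by
  rw [symbolForm_apply, Finset.sum_eq_single J]
  · simp
  · intro K _ hK
    obtain ⟨k, hk⟩ := Function.ne_iff.1 hK
    rw [Finset.prod_eq_zero (Finset.mem_univ k) (by simp [hk.symm]), zero_mul]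
  · simp

theorem IsDiffOpOfOrder.symbolForm_eq_apply_prod {r : ℕ} {P : SmoothFun n M → SmoothFun n M}
    (hP : IsDiffOpOfOrder r P) {x : M} {h : Fin r → SmoothFun n M}
    (hh : ∀ k, h k ∈ vanishingIdeal x) {α : Fin r → 𝔼 →L[ℝ] ℝ}
    (hα : ∀ k j, partialDeriv j (coordExpr (h k) x) (extChartAt (𝓡 n) x x) =
      (α k (EuclideanSpace.single j 1) : ℂ)) :
    symbolForm P r x α = P (∏ k, h k) x := by
  simp only [symbolForm_apply, hP.apply_prod hh, hα]

omit [T2Space M] [IsManifold (𝓡 n) ∞ M] in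
theorem IsDiffOpOfOrder.apply_prod_sub_constFun {r : ℕ} {P : SmoothFun n M → SmoothFun n M}
    (hP : IsDiffOpOfOrder r P) {ι : Type*} [DecidableEq ι] (s : Finset ι) (h : ι → SmoothFun n M)
    (c : ι → ℂ) (x : M) :
    P (∏ k ∈ s, (h k - constFun (c k))) x =
      ∑ t ∈ s.powerset, (∏ k ∈ s \ t, -c k) * P (∏ k ∈ t, h k) x := by
  have sub_eq (k : ι) : h k - constFun (c k) = h k + constFun (-c k) := sub_eq_add_neg _ _
  simp only [sub_eq, Finset.prod_add, mul_comm (∏ k ∈ _, h k), prod_constFun, hP.map_sum,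
    hP.map_const_mul, smoothFun_sum_apply]
  rfl

theorem IsDiffOpOfOrder.contMDiffOn_symbolForm_coframe {r : ℕ} {P : SmoothFun n M → SmoothFun n M}
    (hP : IsDiffOpOfOrder r P) (x₀ : M) (K : Fin r → Fin n) :
    ContMDiffOn (𝓡 n) 𝓘(ℝ, ℂ) ∞ (fun x => symbolForm P r x (fun k => coframe x₀ (K k) x))
      (chartAt 𝔼 x₀).source := by
  intro x₁ hx₁
  have contMDiffOn_coord (m : Fin n) : ContMDiffOn (𝓡 n) 𝓘(ℝ, ℂ) ∞
      (fun x => (extChartAt (𝓡 n) x₀ x m : ℂ)) (chartAt 𝔼 x₀).source :=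
    (Complex.ofRealCLM.contDiff.comp
      (EuclideanSpace.proj m : 𝔼 →L[ℝ] ℝ).contDiff).contMDiff.comp_contMDiffOn
        contMDiffOn_extChartAt
  choose h hh using fun k =>
    exists_smoothFun_eventuallyEq (chartAt 𝔼 x₀).open_source (contMDiffOn_coord (K k)) hx₁
  have symbolForm_eventuallyEq :
      (fun x => symbolForm P r x (fun k => coframe x₀ (K k) x)) =ᶠ[𝓝 x₁] fun x =>
        ∑ t ∈ (Finset.univ : Finset (Fin r)).powerset,
          (∏ k ∈ Finset.univ \ t, -h k x) * P (∏ k ∈ t, h k) x := by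
    filter_upwards [Filter.eventually_all.2 fun k => eventually_eventually_nhds.2 (hh k),
      (chartAt 𝔼 x₀).open_source.mem_nhds hx₁] with x hx x_mem
    have x_mem_source : x ∈ (extChartAt (𝓡 n) x₀).source := by simpa using x_mem
    have sub_eventuallyEq (k : Fin r) : (h k - constFun (h k x) : SmoothFun n M) =ᶠ[𝓝 x]
        fun x' => (extChartAt (𝓡 n) x₀ x' (K k) : ℂ) - h k x :=
      (hx k).mono fun x' hx' => congrArg (· - h k x) hx'
    rw [← hP.apply_prod_sub_constFun]
    refine hP.symbolForm_eq_apply_prod (fun k => sub_self (h k x)) fun k j => ?_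
    rw [partialDeriv_coordExpr_eq_jacobian x_mem_source (sub_eventuallyEq k),
      coframe_single x_mem_source]
  refine (ContMDiffAt.congr_of_eventuallyEq (contMDiffAt_finsetSum fun t _ => ?_)
    symbolForm_eventuallyEq).contMDiffWithinAt
  exact (contMDiffAt_finsetProd fun k _ => (h k).contMDiff.contMDiffAt.neg).mul
    (P _).contMDiff.contMDiffAt

/-- The tensor field of order `r` whose quantized has the same principal symbol as a differential
operator of order `r`. -/
def IsDiffOpOfOrder.symbol {r : ℕ} {P : SmoothFun n M → SmoothFun n M}
    (hP : IsDiffOpOfOrder r P) (ħ : ℝ) : SymTensorField n M r where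
  val x := (((-Complex.I * ħ) ^ r * r.factorial : ℂ)⁻¹ • symbolForm P r x :
    MultilinearMap ℝ (fun _ : Fin r => 𝔼 →L[ℝ] ℝ) ℂ)
  symm x σ α :=
    congrArg (((-Complex.I * ħ) ^ r * r.factorial : ℂ)⁻¹ * ·) (symbolForm_symm P r x σ α)
  smooth x₀ J := contMDiffOn_const.mul (hP.contMDiffOn_symbolForm_coframe x₀ J)

theorem IsDiffOpOfOrder.symbol_coordCovector {r : ℕ} {P : SmoothFun n M → SmoothFun n M}
    (hP : IsDiffOpOfOrder r P) (ħ : ℝ) (x : M) (J : Fin r → Fin n) :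
    (hP.symbol ħ).val x (fun k => coordCovector x (J k) x) =
      ((-Complex.I * ħ) ^ r * r.factorial : ℂ)⁻¹ * P (∏ k, centredCoord x (J k)) x := by
  refine congrArg (((-Complex.I * ħ) ^ r * r.factorial : ℂ)⁻¹ * ·) ?_
  rw [← symbolForm_proj]
  exact congrArg _ (funext fun k => coordCovector_self x (J k))

theorem IsDiffOpOfOrder.symbol_quantized_pow {r : ℕ} {P : SmoothFun n M → SmoothFun n M}
    (hP : IsDiffOpOfOrder r P) (g : PseudoRiemannianMetric n M) {ħ : ℝ} (hħ : ħ ≠ 0)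
    {h : SmoothFun n M} {x : M} (hx : h ∈ vanishingIdeal x) :
    (hP.symbol ħ).quantized g ħ (h ^ r) x = P (h ^ r) x := by
  have apply_pow := hP.apply_prod (h := fun _ => h) fun _ => hx
  rw [Finset.prod_const, Finset.card_univ, Fintype.card_fin] at apply_pow
  have factor_ne_zero : ((-Complex.I * ħ) ^ r * r.factorial : ℂ) ≠ 0 := by
    simp [hħ, r.factorial_ne_zero]
  rw [apply_pow, SymTensorField.quantized_pow_self g ħ _ hx, ← mul_assoc, Finset.mul_sum]
  refine Finset.sum_congr rfl fun J _ => ?_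
  rw [hP.symbol_coordCovector, mul_left_comm, mul_inv_cancel_left₀ factor_ne_zero]

end

section

variable {A W : Type*} [CommRing A] [AddCommGroup W] {I : Ideal A} {r : ℕ}

theorem eq_zero_of_mem_ideal_pow (T : A →+ W)
    (hT : ∀ h : Fin (r + 1) → A, (∀ k, h k ∈ I) → T (∏ k, h k) = 0) {f : A}
    (hf : f ∈ I ^ (r + 1)) : T f = 0 := by
  induction r generalizing T f with
  | zero => simpa using hT (fun _ => f) fun _ => by simpa using hf
  | succ r ih =>
    rw [pow_succ] at hf
    refine Submodule.mul_induction_on hf (fun a ha b hb => ?_) fun a b ha hb => by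
      rw [map_add, ha, hb, add_zero]
    refine ih (T.comp (AddMonoidHom.mulRight b)) (fun h hh => ?_) ha
    have snoc_mem (k : Fin (r + 2)) : Fin.snoc (α := fun _ => A) h b k ∈ I := by
      refine Fin.lastCases ?_ (fun k => ?_) k
      · simpa using hb
      · simpa using hh k
    simpa [Fin.prod_univ_castSucc] using hT _ snoc_mem

theorem map_prod_eq_zero_of_map_pow [IsAddTorsionFree W] (T : A →+ W)
    (hT : ∀ h ∈ I, T (h ^ r) = 0) {h : Fin r → A} (hh : ∀ k, h k ∈ I) : T (∏ k, h k) = 0 := by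
  let φ : MultilinearMap ℤ (fun _ : Fin r => I) W :=
    (T.toIntLinearMap.compMultilinearMap (MultilinearMap.mkPiAlgebra ℤ (Fin r) A)).compLinearMap
      fun _ => I.subtype.restrictScalars ℤ
  have φ_eq_zero : φ = 0 := multilinearMap_eq_zero_of_diagonal
    (fun σ v => congrArg T (Equiv.prod_comp σ fun k => (v k : A)))
    fun v => by simpa [φ] using hT v v.2
  exact DFunLike.congr_fun φ_eq_zero fun k => ⟨h k, hh k⟩

end

/-! ### Surjectivity of quantization -/

section

variable {n : ℕ} {M : Type*} [TopologicalSpace M] [ChartedSpace (EuclideanSpace ℝ (Fin n)) M]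
  [IsManifold (𝓡 n) ∞ M]

omit [IsManifold (𝓡 n) ∞ M] in
theorem TensorField.exists_comp_eq_of_forall_gt (Φ : TensorField n M) {r : ℕ}
    (hΦ : ∀ s, r < s → ∀ x, (Φ.comp s).val x = 0) (Ψ : SymTensorField n M r) :
    ∃ Φ' : TensorField n M, (∀ s, r < s → ∀ x, (Φ'.comp s).val x = 0) ∧ Φ'.comp r = Ψ ∧
      ∀ s, s < r → Φ'.comp s = Φ.comp s := by
  have update_val_eq_zero (s) (hs : r < s) (x) : (Function.update Φ.comp r Ψ s).val x = 0 := by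
    rw [Function.update_of_ne hs.ne', hΦ s hs]
  exact ⟨⟨Function.update Φ.comp r Ψ, r, update_val_eq_zero⟩, update_val_eq_zero,
    Function.update_self .., fun s hs => Function.update_of_ne hs.ne ..⟩

theorem TensorField.exists_quantized_eq_add (g : PseudoRiemannianMetric n M) (ħ : ℝ)
    (Φ : TensorField n M) {r : ℕ} (hΦ : ∀ s, r < s → ∀ x, (Φ.comp s).val x = 0)
    (Ψ : SymTensorField n M (r + 1)) :
    ∃ Φ' : TensorField n M, (∀ s, r + 1 < s → ∀ x, (Φ'.comp s).val x = 0) ∧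
      ∀ f x, Φ'.quantized g ħ f x = Φ.quantized g ħ f x + Ψ.quantized g ħ f x := by
  obtain ⟨Φ', vanishing, comp_top, comp_of_lt⟩ :=
    Φ.exists_comp_eq_of_forall_gt (fun s hs => hΦ s (Nat.lt_of_succ_lt hs)) Ψ
  refine ⟨Φ', vanishing, fun f x => ?_⟩
  rw [TensorField.quantized_eq_sum g ħ Φ' vanishing, TensorField.quantized_eq_sum g ħ Φ hΦ,
    Finset.sum_range_succ, comp_top]
  congr 1
  exact Finset.sum_congr rfl fun s hs => by rw [comp_of_lt s (Finset.mem_range.1 hs)]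

omit [IsManifold (𝓡 n) ∞ M] in
theorem IsDiffOpOfOrder.apply_eq_mul {P : SmoothFun n M → SmoothFun n M}
    (hP : IsDiffOpOfOrder 0 P) (f : SmoothFun n M) (x : M) : P f x = P 1 x * f x := by
  have sub_mem : f - constFun (f x) * 1 ∈ vanishingIdeal x ^ (0 + 1) := by
    rw [zero_add, pow_one, mem_vanishingIdeal, mul_one]
    exact sub_self (f x)
  rw [hP.apply_eq_of_sub_mem sub_mem, hP.map_const_mul]
  exact mul_comm (f x) (P 1 x)

variable [T2Space M]

/- The symbol is chosen so that the difference kills the powers `h ^ (r + 1)` with `h x = 0`, hence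
by polarization all products of `r + 1` functions vanishing at `x`. -/
theorem IsDiffOpOfOrder.exists_isDiffOpOfOrder_sub_symbol (g : PseudoRiemannianMetric n M) {ħ : ℝ}
    (hħ : ħ ≠ 0) {r : ℕ} {P : SmoothFun n M → SmoothFun n M} (hP : IsDiffOpOfOrder (r + 1) P) :
    ∃ Q : SmoothFun n M → SmoothFun n M, IsDiffOpOfOrder r Q ∧
      ∀ f x, Q f x = P f x - (hP.symbol ħ).quantized g ħ f x := by
  set Ψ := hP.symbol ħ
  let Q (f : SmoothFun n M) : SmoothFun n M :=
    P f - ⟨Ψ.quantized g ħ f, Ψ.contMDiff_quantized g ħ f⟩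
  have Q_apply (f x) : Q f x = P f x - Ψ.quantized g ħ f x := rfl
  have map_add (f h) : Q (f + h) = Q f + Q h := ContMDiffMap.ext fun x => by
    rw [Q_apply, Ψ.quantized_add, hP.map_add]
    exact add_sub_add_comm (P f x) (P h x) (Ψ.quantized g ħ f x) (Ψ.quantized g ħ h x)
  have map_const_mul (c : ℂ) (f) : Q ((constFun c : SmoothFun n M) * f) = constFun c * Q f :=
    ContMDiffMap.ext fun x => by
      rw [Q_apply, Ψ.quantized_const_mul, hP.map_const_mul]
      exact (mul_sub c (P f x) (Ψ.quantized g ħ f x)).symm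
  have map_pow (x : M) (h) (hh : h ∈ vanishingIdeal x) : Q (h ^ (r + 1)) x = 0 :=
    sub_eq_zero.2 (hP.symbol_quantized_pow g hħ hh).symm
  let evalQ (x : M) : SmoothFun n M →+ ℂ :=
    AddMonoidHom.mk' (fun f => Q f x) fun f h =>
      congrArg (fun u : SmoothFun n M => u x) (map_add f h)
  exact ⟨Q, ⟨map_add, map_const_mul, fun x f hf => eq_zero_of_mem_ideal_pow (evalQ x)
    (fun h hh => map_prod_eq_zero_of_map_pow (evalQ x) (map_pow x) hh) hf⟩, Q_apply⟩

theorem IsDiffOpOfOrder.exists_quantized_eq (g : PseudoRiemannianMetric n M) {ħ : ℝ}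
    (hħ : ħ ≠ 0) {r : ℕ} {P : SmoothFun n M → SmoothFun n M} (hP : IsDiffOpOfOrder r P) :
    ∃ Φ : TensorField n M, (∀ s, r < s → ∀ x, (Φ.comp s).val x = 0) ∧
      ∀ f x, P f x = Φ.quantized g ħ f x := by
  induction r generalizing P with
  | zero =>
    obtain ⟨Φ, vanishing, comp_zero, -⟩ :=
      zeroTensorField.exists_comp_eq_of_forall_gt (fun _ _ _ => rfl) (scalarField (P 1))
    refine ⟨Φ, vanishing, fun f x => ?_⟩
    rw [TensorField.quantized_eq_sum g ħ Φ vanishing, Finset.sum_range_one, comp_zero,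
      scalarField_quantized, hP.apply_eq_mul]
  | succ r ih =>
    obtain ⟨Q, hQ, Q_apply⟩ := hP.exists_isDiffOpOfOrder_sub_symbol g hħ
    obtain ⟨Φ, vanishing, hΦ⟩ := ih hQ
    obtain ⟨Φ', vanishing', hΦ'⟩ := Φ.exists_quantized_eq_add g ħ vanishing (hP.symbol ħ)
    exact ⟨Φ', vanishing', fun f x => by rw [hΦ', ← hΦ, Q_apply, sub_add_cancel]⟩

end

end Dequantization

end

theorem mainTheorem1_general {n : ℕ} {M : Type*} [TopologicalSpace M] [T2Space M]
    [ChartedSpace (EuclideanSpace ℝ (Fin n)) M] [IsManifold (𝓡 n) ∞ M]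
    (g : Dequantization.PseudoRiemannianMetric n M) {ħ : ℝ} (hħ : ħ ≠ 0)
    {P : Dequantization.SmoothFun n M → Dequantization.SmoothFun n M}
    (hP : Dequantization.IsLinearDiffOp P) :
    Dequantization.IsSecondOrderEquation g (Dequantization.associatedField g ħ P) ↔
      ∃ U : Dequantization.SmoothFun n M, ∀ (f : Dequantization.SmoothFun n M) (x : M),
        P f x = -((ħ : ℂ) ^ 2 / 2) * Dequantization.laplacian g f x + U x * f x := by
  obtain ⟨r, hr⟩ := hP
  obtain ⟨Φ, -, hΦ⟩ := hr.exists_quantized_eq g hħ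
  exact Dequantization.isSecondOrderEquation_associatedField_iff g hħ ⟨Φ, hΦ⟩

theorem mainTheorem1 {n : ℕ} {M : Type*} [TopologicalSpace M] [T2Space M]
    [SecondCountableTopology M] [ChartedSpace (EuclideanSpace ℝ (Fin n)) M]
    [IsManifold (𝓡 n) ∞ M] (g : Dequantization.PseudoRiemannianMetric n M)
    (ħ : ℝ) (hħ : 0 < ħ)
    (P : Dequantization.SmoothFun n M → Dequantization.SmoothFun n M)
    (hP : Dequantization.IsLinearDiffOp P) :
    Dequantization.IsSecondOrderEquation g (Dequantization.associatedField g ħ P) ↔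
      ∃ U : Dequantization.SmoothFun n M, ∀ (f : Dequantization.SmoothFun n M) (x : M),
        P f x = -((ħ : ℂ) ^ 2 / 2) * Dequantization.laplacian g f x + U x * f x :=
  mainTheorem1_general g hħ.ne' hP
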